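/- **Theorem 1.1.** Let $d\ge 2$ and $\sigma>\frac{1-d}{4}$, and use the Fourier transform $\widehat f(\xi)=\int_{\mathbb R^d}f(x)e^{-ix\cdot\xi}\,dx$, extended to tempered distributions. For tempered distributions $u_0,v_0$ on $\mathbb R^d$ whose Fourier transforms are functions put $$I_\sigma(u_0,v_0)=\int_{\mathbb R^{2d}}|\widehat u_0(\zeta)|^2|\widehat v_0(\eta)|^2|\zeta-\eta|^{4\sigma+d-2}\,d\zeta\,d\eta\in[0,\infty],\qquad \mathbf{OT}(d,\sigma)=2^{-3d}\pi^{\frac{1-5d}{2}}\frac{\Gamma(2\sigma+\frac{d-1}{2})}{\Gamma(2\sigma+d-1)}.$$ The solution of $i\partial_tu+\Delta u=0$, $u(0)=u_0$ is a measurable function $u$ on $\mathbb R^{1+d}$ such that $u(t,\cdot)=e^{it\Delta}u_0$ as tempered distributions for almost every $t$. For a function $F$ on $\mathbb R^{1+d}$, $(-\Delta)^\sigma F$ is the function whose space-time Fourier transform is $|\xi|^{2\sigma}\widetilde F(\tau,\xi)$, where $\widetilde F$, the space-time Fourier transform of $F$, is required to be a function; $\|(-\Delta)^\sigma F\|_{L^2}$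 is its norm in $L^2(\mathbb R^{1+d})$, taken to be $\infty$ if there is no such function in $L^2$. (i) If $u_0,v_0\ne0$ and $I_\sigma(u_0,v_0)<\infty$, then such solutions $u,v$ with initial data $u_0,v_0$ exist. (ii) If $I_\sigma(u_0,v_0)<\infty$ and $u,v$ are the solutions with initial data $u_0,v_0$, then $$\|(-\Delta)^\sigma(u\overline v)\|_{L^2}^2\le \mathbf{OT}(d,\sigma)\,I_\sigma(u_0,v_0).$$ (iii) The constant $\mathbf{OT}(d,\sigma)$ is the smallest one for which (ii) holds. (iv) For $u_0,v_0\neq 0$ with solutions $u,v$: one has $I_\sigma(u_0,v_0)<\infty$ and equality in (ii) if and only if $\widehat u_0(\eta)=\exp(a|\eta|^2+b\cdot\eta+c)$ for almost every $\eta$, for some $a,c\in\mathbb C$, $b\in\mathbb C^d$ with $\operatorname{Re}a<0$, and $v_0$ is a scalar multiple of $u_0$. -/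

import Mathlib

open MeasureTheory
open scoped FourierTransform SchwartzMap ENNReal

noncomputable section

namespace BilinearSchrodinger

/-- The space `ℝ^d`. -/
abbrev Space (d : ℕ) := EuclideanSpace ℝ (Fin d)

/-- Space-time `ℝ^{1+d}`, with points `(t, x)`, the Euclidean inner product and Lebesgue measure. -/
abbrev SpaceTime (d : ℕ) := WithLp 2 (ℝ × Space d)

section Distributions

variable {E : Type*} [NormedAddCommGroup E] [InnerProductSpace ℝ E] [FiniteDimensional ℝ E]
  [MeasurableSpace E] [BorelSpace E]

/-- The tempered distribution `T` is the function `f`: the products of `f` with all Schwartz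
functions are integrable and `T φ = ∫ φ f`. (Testing against a gaussian shows that `f` is then
a.e. strongly measurable.) -/
def IsFunction (T : 𝓢'(E, ℂ)) (f : E → ℂ) : Prop :=
  ∀ φ : 𝓢(E, ℂ), Integrable (fun x => φ x * f x) ∧ T φ = ∫ x, φ x * f x

/-- The Fourier transform of the tempered distribution `T`, in the normalisation
`∫ F(x) exp(-i x · ξ) dx`, is the function `f`. Mathlib's `𝓕` uses the kernel `exp(-2 π i x · ξ)`,
so that `(𝓕 T)(ξ)` is the value of the former at `2 π ξ`. -/
def HasFourierTransform (T : 𝓢'(E, ℂ)) (f : E → ℂ) : Prop :=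
  IsFunction (𝓕 T) (fun ξ => f ((2 * Real.pi) • ξ))

end Distributions

/-- The Fourier multiplier `exp(-i t |ξ|²)` of `exp(i t Δ)`, with the factor `2 π` of Mathlib's
normalisation of the Fourier transform. -/
def schrodingerSymbol (d : ℕ) (t : ℝ) (ξ : Space d) : ℂ :=
  Complex.exp (((-(t * (2 * Real.pi * ‖ξ‖) ^ 2) : ℝ) : ℂ) * Complex.I)

/-- The symbol is smooth with polynomially bounded derivatives, so that Mathlib's Fourier multiplier
operator with this symbol is the genuine one. -/
theorem schrodingerSymbol_hasTemperateGrowth (d : ℕ) (t : ℝ) :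
    (schrodingerSymbol d t).HasTemperateGrowth := by
  have key : ∀ n : ℕ, iteratedDeriv n (fun x : ℝ => Complex.exp ((x : ℂ) * Complex.I)) =
      fun x : ℝ => Complex.I ^ n * Complex.exp ((x : ℂ) * Complex.I) := by
    intro n
    induction n with
    | zero => simp
    | succ n ih =>
      rw [iteratedDeriv_succ, ih]
      funext x
      have h : HasDerivAt (fun x : ℝ => Complex.exp ((x : ℂ) * Complex.I))
          (Complex.exp ((x : ℂ) * Complex.I) * (1 * Complex.I)) x :=
        ((Complex.ofRealCLM.hasDerivAt (x := x)).mul_const Complex.I).cexp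
      rw [(h.const_mul (Complex.I ^ n)).deriv]
      ring
  have h1 : (fun x : ℝ => Complex.exp ((x : ℂ) * Complex.I)).HasTemperateGrowth := by
    refine ⟨Complex.contDiff_exp.comp (Complex.ofRealCLM.contDiff.mul contDiff_const), ?_⟩
    intro n
    refine ⟨0, 1, fun x => ?_⟩
    rw [norm_iteratedFDeriv_eq_norm_iteratedDeriv, key]
    simp [Complex.norm_exp_ofReal_mul_I]
  have h2 : (fun ξ : Space d => -(t * (2 * Real.pi * ‖ξ‖) ^ 2)).HasTemperateGrowth := by
    have : (fun ξ : Space d => -(t * (2 * Real.pi * ‖ξ‖) ^ 2)) =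
        fun ξ => (-(t * (2 * Real.pi) ^ 2)) * ‖ξ‖ ^ 2 := by
      funext ξ; ring
    rw [this]
    fun_prop
  exact h1.comp h2

/-- The free Schrödinger propagator `exp(i t Δ)` on tempered distributions. -/
def propagator (d : ℕ) (t : ℝ) : 𝓢'(Space d, ℂ) →L[ℂ] 𝓢'(Space d, ℂ) :=
  TemperedDistribution.fourierMultiplierCLM ℂ (schrodingerSymbol d t)

/-- The measurable function `u` on space-time is the solution of `i ∂ₜ u + Δ u = 0`, `u(0) = u₀`:
for almost every time `t`, the function `u(t, ·)` is the distribution `exp(i t Δ) u₀`. -/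
def IsSolution {d : ℕ} (u₀ : 𝓢'(Space d, ℂ)) (u : SpaceTime d → ℂ) : Prop :=
  AEStronglyMeasurable u ∧
    ∀ᵐ t : ℝ, IsFunction (propagator d t u₀) (fun x => u (WithLp.toLp 2 (t, x)))

/-- `w = (-Δ)^σ F` for functions on space-time, with `Δ` the Laplacian in the space variable: the
space-time Fourier transform of `F` is a function `G` and that of `w` is `|ξ|^(2σ) G(τ, ξ)`. -/
def IsFracLaplacian {d : ℕ} (σ : ℝ) (F w : SpaceTime d → ℂ) : Prop :=
  ∃ (T S : 𝓢'(SpaceTime d, ℂ)) (G : SpaceTime d → ℂ),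
    IsFunction T F ∧ HasFourierTransform T G ∧
    IsFunction S w ∧ HasFourierTransform S (fun p => ((‖p.snd‖ ^ (2 * σ) : ℝ) : ℂ) * G p)

/-- The norm of `(-Δ)^σ F` in `L²(ℝ^{1+d})`; it is `∞` if there is no function `(-Δ)^σ F` in `L²`.
(There is at most one up to null sets.) -/
def fracLaplacianNorm {d : ℕ} (σ : ℝ) (F : SpaceTime d → ℂ) : ℝ≥0∞ :=
  ⨅ (w : SpaceTime d → ℂ) (_ : IsFracLaplacian σ F w), eLpNorm w 2 volume

/-- `∫∫ |f(ζ)|² |g(η)|² |ζ - η|^(4σ+d-2) dζ dη`, to be used with `f`, `g` the Fourier transforms of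
the initial data. -/
def energy {d : ℕ} (σ : ℝ) (f g : Space d → ℂ) : ℝ≥0∞ :=
  ∫⁻ p : Space d × Space d,
    ‖f p.1‖ₑ ^ 2 * ‖g p.2‖ₑ ^ 2 * ENNReal.ofReal (‖p.1 - p.2‖ ^ (4 * σ + (d : ℝ) - 2))

/-- The constant `2^(-3d) π^((1-5d)/2) Γ(2σ+(d-1)/2) / Γ(2σ+d-1)`. -/
def OT (d : ℕ) (σ : ℝ) : ℝ :=
  (2 : ℝ) ^ (-(3 * (d : ℝ))) * Real.pi ^ ((1 - 5 * (d : ℝ)) / 2) *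
    (Real.Gamma (2 * σ + ((d : ℝ) - 1) / 2) / Real.Gamma (2 * σ + (d : ℝ) - 1))

/-- `f` agrees almost everywhere with `exp(a |η|² + b · η + c)` for some `a, c ∈ ℂ`, `b ∈ ℂ^d` with
`Re a < 0`. -/
def IsGaussian {d : ℕ} (f : Space d → ℂ) : Prop :=
  ∃ (a c : ℂ) (b : Fin d → ℂ), a.re < 0 ∧
    f =ᵐ[volume] fun η => Complex.exp (a * ((‖η‖ ^ 2 : ℝ) : ℂ) + ∑ i, b i * ((η i : ℝ) : ℂ) + c)

end BilinearSchrodinger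

end

open BilinearSchrodinger

/-! Let `f`, `g` be the Fourier transforms of the data, in the normalisation of `𝓕`, and let Γ(ζ) =
(-2π|ζ|², ζ) parametrise the paraboloid. The solutions superpose plane waves with frequencies on the
paraboloid, so u v̄ superposes the frequencies Γ(ζ) - Γ(η) with amplitudes f(ζ) conj g(η). Such a
difference depends only on ξ = ζ - η and on the component s of the centre (ζ + η)/2 along ξ: its
time component is -4π|ξ|s. Hence the space-time Fourier transform of u v̄ is (4π|ξ|)⁻¹ H(ξ, s),
where H integrates f conj g over a hyperplane orthogonal to ξ
(`integral_schwartz_mul_bilinearTransform`). By Plancherel the left side of the estimate is a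
constant times ∫ |ξ|^(4σ-1) |H(ξ, s)|² dξ ds.

Cauchy-Schwarz on each hyperplane would give an inequality; Lagrange's identity
(`lagrange_identity`) also keeps the remainder. Its double integrals over transverse coordinates y,
y' become, together with ξ and s, integrals over all rectangles with a side ξ. One diagonal joins ζ
and η, and swapping y with y' (`exchange`) gives the other. For ξ = re in polar coordinates, the
variables r, s, y, y' describe the pairs with ⟨e, ζ - η⟩ = r > 0, so the weight becomes ⟨e, ζ -
η⟩₊^a with a = 4σ + d - 2. Its integral over the sphere of directions e is a constant times |ζ -
η|^a, finite because a > -1, which is the hypothesis on σ. The outcome is an exact identity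
(`fracLaplacianNorm_sq_add_defect`): twice the squared norm, plus a positive multiple of a
nonnegative defect, equals 2 OT I. The defect measures how far f ⊗ g is from being invariant under
exchanges. The inequality follows, and equality means that the defect vanishes.

Gaussians have no defect, since an exchange preserves ζ + η and |ζ|² + |η|². Conversely, suppose
that the defect vanishes. Multiplying f and g by exp(-|ζ|²) keeps the invariance and makes the
Fourier transforms h, k differentiable; the invariance passes to them, and h(m + x) k(m - x) depends
only on m and |x|. Thus k is a multiple of h, h has no zeros, its logarithmic derivative is affine,
and h is Gaussian (`gaussian_of_rectangles`). Inverting the transform and removing the damping gives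
f.

Finiteness of I only yields ∫ |f|² / (1 + |ζ|) < ∞, that is, data in H^(-1/2)
(`smoothNorm_lt_top_of_energy`). The solutions are then functions by local smoothing: a Schur test
for the differences Γ(ζ) - Γ(η) bounds the evolution in L² on unit balls of space-time
(`exists_lintegral_ball_evolve_le`). The general evolution is a limit from truncated data, and
uniqueness on time slices identifies it with any given solution. -/

noncomputable section

namespace BilinearSchrodinger

open Set RealInnerProductSpace Filter Topology

set_option linter.unusedSectionVars false

/-! ### Orthogonal coordinates adapted to a direction -/

section

variable {d : ℕ} [NeZero d]

/-- An isometric splitting of `ℝ^d` into a line and a hyperplane. -/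
def splitting (d : ℕ) [NeZero d] : WithLp 2 (ℝ × Space (d - 1)) ≃ₗᵢ[ℝ] Space d :=
  (stdOrthonormalBasis ℝ (WithLp 2 (ℝ × Space (d - 1)))).equiv (stdOrthonormalBasis ℝ (Space d))
    (finCongr (by
      have h : Module.finrank ℝ (WithLp 2 (ℝ × Space (d - 1))) =
          Module.finrank ℝ (ℝ × Space (d - 1)) :=
        (WithLp.linearEquiv 2 ℝ (ℝ × Space (d - 1))).finrank_eq
      rw [h, Module.finrank_prod, finrank_euclideanSpace_fin, finrank_euclideanSpace_fin,
        Module.finrank_self]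
      have := NeZero.one_le (n := d)
      omega))

/-- The unit vector spanning the line of `splitting d`. -/
def pole (d : ℕ) [NeZero d] : Space d := splitting d (WithLp.toLp 2 (1, 0))

/-- Orthogonal coordinates on `ℝ^d` whose first axis points in the direction of `ξ`, obtained from
`splitting d` by the reflection that maps `pole d` to the direction of `ξ`. -/
def frame (ξ : Space d) (p : ℝ × Space (d - 1)) : Space d :=
  splitting d (WithLp.toLp 2 p) -
    (2 * ⟪pole d - ‖ξ‖⁻¹ • ξ, splitting d (WithLp.toLp 2 p)⟫ / ‖pole d - ‖ξ‖⁻¹ • ξ‖ ^ 2) •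
      (pole d - ‖ξ‖⁻¹ • ξ)

theorem norm_pole : ‖pole d‖ = 1 := by
  rw [pole, LinearIsometryEquiv.norm_map, WithLp.prod_norm_eq_of_L2]
  simp

theorem frame_eq_reflection (ξ : Space d) (p : ℝ × Space (d - 1)) :
    frame ξ p = (ℝ ∙ (pole d - ‖ξ‖⁻¹ • ξ))ᗮ.reflection (splitting d (WithLp.toLp 2 p)) := by
  rw [Submodule.reflection_orthogonal_apply, Submodule.reflection_singleton_apply, frame]
  simp only [two_smul, RCLike.ofReal_real_eq_id, id_eq]
  module

theorem frame_sub (ξ : Space d) (p q : ℝ × Space (d - 1)) :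
    frame ξ (p - q) = frame ξ p - frame ξ q := by
  simp only [frame_eq_reflection, WithLp.toLp_sub, map_sub]

theorem inner_frame_frame (ξ : Space d) (p q : ℝ × Space (d - 1)) :
    ⟪frame ξ p, frame ξ q⟫ = p.1 * q.1 + ⟪p.2, q.2⟫ := by
  rw [frame_eq_reflection, frame_eq_reflection, LinearIsometryEquiv.inner_map_map,
    LinearIsometryEquiv.inner_map_map, WithLp.prod_inner_apply]
  simp [mul_comm]

theorem norm_frame_sq (ξ : Space d) (p : ℝ × Space (d - 1)) :
    ‖frame ξ p‖ ^ 2 = p.1 ^ 2 + ‖p.2‖ ^ 2 := by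
  rw [← real_inner_self_eq_norm_sq, inner_frame_frame, real_inner_self_eq_norm_sq]
  ring

/-- The reflection in the hyperplane bisecting two unit vectors interchanges them, so the pole goes
to the direction of `ξ`. For `ξ = 0` both sides vanish. -/
theorem frame_norm (ξ : Space d) : frame ξ (‖ξ‖, 0) = ξ := by
  rcases eq_or_ne ξ 0 with rfl | h
  · have h0 : ((0 : ℝ), (0 : Space (d - 1))) = 0 := rfl
    simp [frame_eq_reflection, h0]
  · have h1 : WithLp.toLp 2 ((‖ξ‖, 0) : ℝ × Space (d - 1)) = ‖ξ‖ • WithLp.toLp 2 (1, 0) := by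
      rw [← WithLp.toLp_smul]; simp
    have hn : ‖ξ‖ ≠ 0 := by simpa using h
    rw [frame_eq_reflection, h1, map_smul, map_smul]
    change ‖ξ‖ • (ℝ ∙ (pole d - ‖ξ‖⁻¹ • ξ))ᗮ.reflection (pole d) = ξ
    rw [Submodule.reflection_sub, smul_inv_smul₀ hn]
    rw [norm_pole, norm_smul, norm_inv, norm_norm, inv_mul_cancel₀ hn]

theorem inner_frame (ξ : Space d) (p : ℝ × Space (d - 1)) : ⟪ξ, frame ξ p⟫ = ‖ξ‖ * p.1 := by
  conv_lhs => rw [← frame_norm ξ]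
  rw [frame_norm, ← frame_norm ξ, frame_norm]
  nth_rewrite 1 [← frame_norm ξ]
  rw [inner_frame_frame]
  simp

theorem frame_smul {r : ℝ} (hr : 0 < r) (ξ : Space d) : frame (r • ξ) = frame ξ := by
  have : ‖r • ξ‖⁻¹ • r • ξ = ‖ξ‖⁻¹ • ξ := by
    rw [norm_smul, Real.norm_of_nonneg hr.le, smul_smul, mul_inv, mul_assoc, mul_comm, mul_assoc,
      mul_inv_cancel₀ hr.ne', mul_one]
  funext p
  rw [frame, frame, this]

-- Joint measurability in the direction and the point is what the explicit formula for `frame` is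
-- for; later integrals let both vary.
@[fun_prop]
theorem measurable_frame {α : Type*} [MeasurableSpace α] {f : α → Space d}
    {g : α → ℝ × Space (d - 1)} (hf : Measurable f) (hg : Measurable g) :
    Measurable fun x => frame (f x) (g x) := by
  have h1 : Measurable fun x => splitting d (WithLp.toLp 2 (g x)) :=
    (splitting d).continuous.measurable.comp ((WithLp.measurable_toLp 2 _).comp hg)
  unfold frame
  fun_prop

theorem measurePreserving_frame (ξ : Space d) : MeasurePreserving (frame ξ) := by
  have h1 : MeasurePreserving (WithLp.toLp 2 : ℝ × Space (d - 1) → WithLp 2 (ℝ × Space (d - 1))) :=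
    WithLp.volume_preserving_toLp ..
  have := (((ℝ ∙ (pole d - ‖ξ‖⁻¹ • ξ))ᗮ.reflection.measurePreserving).comp
    (splitting d).measurePreserving).comp h1
  convert this using 1
  funext p
  exact frame_eq_reflection ξ p

/-- The pairs of points of `ℝ^d` with difference `ξ`, described by coordinates of their centre in
the frame of `ξ`. -/
def pairing (q : Space d × (ℝ × Space (d - 1))) : Space d × Space d :=
  (frame q.1 (q.2.1 + ‖q.1‖ / 2, q.2.2), frame q.1 (q.2.1 - ‖q.1‖ / 2, q.2.2))

theorem frame_pair_sub (ξ : Space d) (s r : ℝ) (y : Space (d - 1)) (hr : r = ‖ξ‖) :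
    frame ξ (s + r / 2, y) - frame ξ (s - r / 2, y) = ξ := by
  rw [← frame_sub]
  conv_rhs => rw [← frame_norm ξ]
  rw [hr]
  congr 1
  ext <;> simp

theorem measurePreserving_shift_fst {n : ℕ} (c : ℝ) :
    MeasurePreserving (fun p : ℝ × Space n => (p.1 + c, p.2)) :=
  (measurePreserving_add_right (volume : Measure ℝ) c).prod
    (MeasurePreserving.id (volume : Measure (Space n)))

theorem measurePreserving_frame_prod (c : ℝ) :
    MeasurePreserving (fun q : Space d × (ℝ × Space (d - 1)) =>
      (q.1, frame q.1 (q.2.1 - c * ‖q.1‖, q.2.2))) := by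
  have hm : Measurable (Function.uncurry fun (ξ : Space d) (p : ℝ × Space (d - 1)) =>
      frame ξ (p.1 - c * ‖ξ‖, p.2)) := by unfold Function.uncurry; fun_prop
  have hg : ∀ ξ : Space d, Measure.map (fun p : ℝ × Space (d - 1) => frame ξ (p.1 - c * ‖ξ‖, p.2))
      volume = volume := fun ξ => by
    have h := ((measurePreserving_frame ξ).comp (measurePreserving_shift_fst (-(c * ‖ξ‖)))).map_eq
    simpa only [Function.comp_def, ← sub_eq_add_neg] using h
  exact (MeasurePreserving.id (volume : Measure (Space d))).skew_product hm
    (Filter.Eventually.of_forall hg)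

/-- The pair is (ξ + η, η), a shear of (ξ, η), and η arises from its coordinates by a translation
and an isometry that depend only on ξ. -/
theorem measurePreserving_pairing : MeasurePreserving (pairing (d := d)) := by
  have h3 : MeasurePreserving (fun q : Space d × Space d => (q.1 + q.2, q.2)) :=
    measurePreserving_add_prod (volume : Measure (Space d)) (volume : Measure (Space d))
  have h := h3.comp (measurePreserving_frame_prod (d := d) (1 / 2))
  have h2 : pairing (d := d) = (fun q : Space d × Space d => (q.1 + q.2, q.2)) ∘
      fun q : Space d × (ℝ × Space (d - 1)) => (q.1, frame q.1 (q.2.1 - 1 / 2 * ‖q.1‖, q.2.2)) := by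
    funext q
    have h4 : (1 / 2 : ℝ) * ‖q.1‖ = ‖q.1‖ / 2 := by ring
    simp only [pairing, Function.comp, h4]
    rw [Prod.mk.injEq, ← sub_eq_iff_eq_add]
    exact ⟨frame_pair_sub _ _ _ _ rfl, rfl⟩
  rw [h2]
  exact h

end

/-! ### Integration over rectangles -/

section

variable {d : ℕ} [NeZero d]

theorem lintegral_polar {h : Space d → ℝ≥0∞} (hh : Measurable h) :
    ∫⁻ ξ, h ξ = ∫⁻ e, (∫⁻ r in Ioi (0 : ℝ), ENNReal.ofReal (r ^ (d - 1)) * h (r • (e : Space d)))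
      ∂(volume : Measure (Space d)).toSphere := by
  have h1 := (volume : Measure (Space d)).measurePreserving_homeomorphUnitSphereProd
  have hm : Measurable fun q : Metric.sphere (0 : Space d) 1 × Ioi (0 : ℝ) =>
      h ((q.2 : ℝ) • (q.1 : Space d)) := by
    refine hh.comp ?_
    exact (measurable_subtype_coe.comp measurable_snd).smul
      (measurable_subtype_coe.comp measurable_fst)
  have h2 : ∫⁻ ξ, h ξ = ∫⁻ ξ : ({0}ᶜ : Set (Space d)), h ξ
      ∂((volume : Measure (Space d)).comap (↑)) := by
    rw [lintegral_subtype_comap (measurableSet_singleton _).compl h, Measure.restrict_eq_self_of_ae_mem]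
    have : ({0}ᶜ : Set (Space d)) ∈ ae (volume : Measure (Space d)) :=
      compl_mem_ae_iff.2 (measure_singleton 0)
    exact this
  have h3 : ∀ ξ : ({0}ᶜ : Set (Space d)), h ξ =
      (fun q : Metric.sphere (0 : Space d) 1 × Ioi (0 : ℝ) => h ((q.2 : ℝ) • (q.1 : Space d)))
        (homeomorphUnitSphereProd (Space d) ξ) := by
    intro ξ
    have : ‖(ξ : Space d)‖ ≠ 0 := norm_ne_zero_iff.2 ξ.2
    simp [smul_inv_smul₀ this]
  rw [h2, lintegral_congr h3, h1.lintegral_comp hm, lintegral_prod _ hm.aemeasurable]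
  refine lintegral_congr fun e => ?_
  rw [finrank_euclideanSpace_fin, Measure.volumeIoiPow, lintegral_withDensity_eq_lintegral_mul]
  · exact lintegral_subtype_comap measurableSet_Ioi
      (fun r : ℝ => ENNReal.ofReal (r ^ (d - 1)) * h (r • (e : Space d)))
  · fun_prop
  · refine hh.comp ?_
    fun_prop

/-- The positive part of the power function of exponent `a`, with the value `0` on `(-∞, 0]`. -/
def posPow (a x : ℝ) : ℝ≥0∞ := (Ioi (0 : ℝ)).indicator (fun x => ENNReal.ofReal (x ^ a)) x

@[fun_prop]
theorem measurable_posPow (a : ℝ) : Measurable (posPow a) := by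
  unfold posPow
  exact Measurable.indicator (by fun_prop) measurableSet_Ioi

theorem lintegral_frame {n : Space d} {h : Space d → ℝ≥0∞} (hh : Measurable h) :
    ∫⁻ x, h x = ∫⁻ s : ℝ, ∫⁻ y : Space (d - 1), h (frame n (s, y)) := by
  rw [← (measurePreserving_frame n).lintegral_comp hh]
  exact lintegral_prod _ (hh.comp (measurePreserving_frame n).measurable).aemeasurable

/-- The substitution p = s + r/2, q = s - r/2 has Jacobian one; it is a composition of two
translations. -/
theorem lintegral_pairs_on_lines {X : ℝ → ℝ → ℝ≥0∞} (hX : Measurable (Function.uncurry X)) (a : ℝ) :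
    ∫⁻ r : ℝ, ∫⁻ s : ℝ, posPow a r * X (s + r / 2) (s - r / 2) =
      ∫⁻ p : ℝ, ∫⁻ q : ℝ, posPow a (p - q) * X p q := by
  have h1 : ∀ r : ℝ, ∫⁻ s : ℝ, posPow a r * X (s + r / 2) (s - r / 2) =
      ∫⁻ q : ℝ, posPow a r * X (q + r) q := fun r => by
    rw [← lintegral_add_right_eq_self _ (r / 2)]
    refine lintegral_congr fun q => ?_
    rw [add_assoc, add_halves, add_sub_cancel_right]
  simp_rw [h1]
  have hm : Measurable fun z : ℝ × ℝ => posPow a z.1 * X (z.2 + z.1) z.2 :=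
    (by fun_prop : Measurable fun z : ℝ × ℝ => posPow a z.1).mul
      (hX.comp (by fun_prop : Measurable fun z : ℝ × ℝ => (z.2 + z.1, z.2)))
  have hm2 : Measurable fun z : ℝ × ℝ => posPow a (z.2 - z.1) * X z.2 z.1 :=
    (by fun_prop : Measurable fun z : ℝ × ℝ => posPow a (z.2 - z.1)).mul
      (hX.comp (by fun_prop : Measurable fun z : ℝ × ℝ => (z.2, z.1)))
  have e2 := lintegral_lintegral_swap (μ := (volume : Measure ℝ)) (ν := (volume : Measure ℝ))
    (f := fun q p : ℝ => posPow a (p - q) * X p q) hm2.aemeasurable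
  have e1 := lintegral_lintegral_swap (μ := (volume : Measure ℝ)) (ν := (volume : Measure ℝ))
    (f := fun r q : ℝ => posPow a r * X (q + r) q) hm.aemeasurable
  rw [e1, ← e2]
  refine lintegral_congr fun q => ?_
  rw [← lintegral_sub_right_eq_self _ q]
  refine lintegral_congr fun p => ?_
  rw [add_sub_cancel]

theorem measurable_lintegral_hyperplane {Ψ : Space d × Space d → ℝ≥0∞} (hΨ : Measurable Ψ)
    (e : Space d) : Measurable fun q : (ℝ × ℝ) × Space (d - 1) => ∫⁻ y' : Space (d - 1),
      Ψ (frame e (q.1.1, q.2), frame e (q.1.2, y')) := by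
  refine Measurable.lintegral_prod_right'
    (f := fun q : ((ℝ × ℝ) × Space (d - 1)) × Space (d - 1) =>
      Ψ (frame e (q.1.1.1, q.1.2), frame e (q.1.1.2, q.2))) (hΨ.comp ?_)
  fun_prop

/-- Fubini in the frame of `e` for both points; the weight sees only their coordinates along `e`. -/
theorem lintegral_posPow_inner (a : ℝ) {Ψ : Space d × Space d → ℝ≥0∞} (hΨ : Measurable Ψ)
    {e : Space d} (he : ‖e‖ = 1) :
    ∫⁻ z : Space d × Space d, posPow a ⟪e, z.1 - z.2⟫ * Ψ z =
      ∫⁻ p : ℝ, ∫⁻ q : ℝ, posPow a (p - q) * ∫⁻ y : Space (d - 1), ∫⁻ y' : Space (d - 1),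
        Ψ (frame e (p, y), frame e (q, y')) := by
  have hk : Measurable fun z : Space d × Space d => posPow a ⟪e, z.1 - z.2⟫ * Ψ z := by
    fun_prop
  rw [Measure.volume_eq_prod, lintegral_prod _ hk.aemeasurable,
    lintegral_frame (n := e) hk.lintegral_prod_right']
  refine lintegral_congr fun p => ?_
  have h5 : ∀ y : Space (d - 1), ∫⁻ η : Space d,
      posPow a ⟪e, frame e (p, y) - η⟫ * Ψ (frame e (p, y), η) =
      ∫⁻ q : ℝ, posPow a (p - q) * ∫⁻ y' : Space (d - 1), Ψ (frame e (p, y), frame e (q, y')) := by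
    intro y
    have hk1 : Measurable fun η : Space d =>
        posPow a ⟪e, frame e (p, y) - η⟫ * Ψ (frame e (p, y), η) :=
      Measurable.mul (by fun_prop) (hΨ.comp (by fun_prop))
    rw [lintegral_frame (n := e) hk1]
    refine lintegral_congr fun q => ?_
    have hmm : Measurable fun y' : Space (d - 1) => Ψ (frame e (p, y), frame e (q, y')) :=
      hΨ.comp (by fun_prop)
    rw [← lintegral_const_mul _ hmm]
    refine lintegral_congr fun y' => ?_
    simp only [inner_sub_right, inner_frame, he, one_mul]
  simp_rw [h5]
  have hm2 : Measurable fun z : Space (d - 1) × ℝ => posPow a (p - z.2) *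
      ∫⁻ y' : Space (d - 1), Ψ (frame e (p, z.1), frame e (z.2, y')) := by
    refine Measurable.mul (by fun_prop) ?_
    exact Measurable.lintegral_prod_right' (f := fun z : (Space (d - 1) × ℝ) × Space (d - 1) =>
      Ψ (frame e (p, z.1.1), frame e (z.1.2, z.2))) (hΨ.comp (by fun_prop))
  rw [lintegral_lintegral_swap (f := fun (y : Space (d - 1)) (q : ℝ) => posPow a (p - q) *
      ∫⁻ y' : Space (d - 1), Ψ (frame e (p, y), frame e (q, y'))) hm2.aemeasurable]
  refine lintegral_congr fun q => ?_
  have hm3 : Measurable fun y : Space (d - 1) => ∫⁻ y' : Space (d - 1),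
      Ψ (frame e (p, y), frame e (q, y')) :=
    Measurable.lintegral_prod_right' (f := fun z : Space (d - 1) × Space (d - 1) =>
      Ψ (frame e (p, z.1), frame e (q, z.2))) (hΨ.comp (by fun_prop))
  rw [lintegral_const_mul _ hm3]

/-- The integral over all rectangles, given by one side `ξ` and the two sides parallel to it,
in terms of the diagonals. -/
theorem lintegral_rectangles (a : ℝ) {Φ : Space d → Space d × Space d → ℝ≥0∞}
    (hΦ : Measurable (Function.uncurry Φ)) (hΦ' : ∀ r : ℝ, 0 < r → ∀ e, Φ (r • e) = Φ e) :
    ∫⁻ ξ : Space d, ∫⁻ s : ℝ, ∫⁻ y : Space (d - 1), ∫⁻ y' : Space (d - 1),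
      ENNReal.ofReal (‖ξ‖ ^ (a + 1 - d)) *
        Φ ξ (frame ξ (s + ‖ξ‖ / 2, y), frame ξ (s - ‖ξ‖ / 2, y')) =
    ∫⁻ e, (∫⁻ z : Space d × Space d, posPow a ⟪(e : Space d), z.1 - z.2⟫ * Φ e z)
      ∂(volume : Measure (Space d)).toSphere := by
  rw [lintegral_polar]
  swap
  · refine Measurable.lintegral_prod_right' (f := fun q : Space d × ℝ => ∫⁻ y : Space (d - 1),
      ∫⁻ y' : Space (d - 1), ENNReal.ofReal (‖q.1‖ ^ (a + 1 - d)) *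
        Φ q.1 (frame q.1 (q.2 + ‖q.1‖ / 2, y), frame q.1 (q.2 - ‖q.1‖ / 2, y'))) ?_
    refine Measurable.lintegral_prod_right' (f := fun q : (Space d × ℝ) × Space (d - 1) =>
      ∫⁻ y' : Space (d - 1), ENNReal.ofReal (‖q.1.1‖ ^ (a + 1 - d)) *
        Φ q.1.1 (frame q.1.1 (q.1.2 + ‖q.1.1‖ / 2, q.2),
          frame q.1.1 (q.1.2 - ‖q.1.1‖ / 2, y'))) ?_
    refine Measurable.lintegral_prod_right'
      (f := fun q : ((Space d × ℝ) × Space (d - 1)) × Space (d - 1) =>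
      ENNReal.ofReal (‖q.1.1.1‖ ^ (a + 1 - d)) *
        Φ q.1.1.1 (frame q.1.1.1 (q.1.1.2 + ‖q.1.1.1‖ / 2, q.1.2),
          frame q.1.1.1 (q.1.1.2 - ‖q.1.1.1‖ / 2, q.2))) ?_
    refine Measurable.mul (by fun_prop) (hΦ.comp (g := Function.uncurry Φ)
      (f := fun q : ((Space d × ℝ) × Space (d - 1)) × Space (d - 1) => (q.1.1.1,
        (frame q.1.1.1 (q.1.1.2 + ‖q.1.1.1‖ / 2, q.1.2),
          frame q.1.1.1 (q.1.1.2 - ‖q.1.1.1‖ / 2, q.2)))) ?_)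
    fun_prop
  refine lintegral_congr fun e => ?_
  have he : ‖(e : Space d)‖ = 1 := by simp
  set X : ℝ → ℝ → ℝ≥0∞ := fun p q => ∫⁻ y : Space (d - 1), ∫⁻ y' : Space (d - 1),
    Φ e (frame e (p, y), frame e (q, y')) with hX
  have hΦe : Measurable (Φ e) := hΦ.of_uncurry_left
  have hXm1 := measurable_lintegral_hyperplane hΦe (e : Space d)
  have hXm : Measurable (Function.uncurry X) := hXm1.lintegral_prod_right'
  have h1 : ∀ r : ℝ, r ∈ Ioi (0 : ℝ) → ENNReal.ofReal (r ^ (d - 1)) *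
      ∫⁻ s : ℝ, ∫⁻ y : Space (d - 1), ∫⁻ y' : Space (d - 1),
        ENNReal.ofReal (‖r • (e : Space d)‖ ^ (a + 1 - d)) *
        Φ (r • (e : Space d)) (frame (r • (e : Space d)) (s + ‖r • (e : Space d)‖ / 2, y),
          frame (r • (e : Space d)) (s - ‖r • (e : Space d)‖ / 2, y')) =
      ∫⁻ s : ℝ, posPow a r * X (s + r / 2) (s - r / 2) := by
    intro r hr
    have hr0 : 0 < r := hr
    have hn : ‖r • (e : Space d)‖ = r := by rw [norm_smul, he, mul_one, Real.norm_of_nonneg hr0.le]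
    rw [hn, frame_smul hr0, hΦ' r hr0, ← lintegral_const_mul' _ _ ENNReal.ofReal_ne_top]
    refine lintegral_congr fun s => ?_
    have h2 : ∀ y : Space (d - 1), (∫⁻ y' : Space (d - 1), ENNReal.ofReal (r ^ (a + 1 - d)) *
        Φ e (frame e (s + r / 2, y), frame e (s - r / 2, y'))) =
        ENNReal.ofReal (r ^ (a + 1 - d)) * ∫⁻ y' : Space (d - 1),
        Φ e (frame e (s + r / 2, y), frame e (s - r / 2, y')) := fun y =>
      lintegral_const_mul' _ _ ENNReal.ofReal_ne_top
    simp_rw [h2]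
    rw [lintegral_const_mul' _ _ ENNReal.ofReal_ne_top, ← mul_assoc,
      ← ENNReal.ofReal_mul (by positivity)]
    -- The exponent `a + 1 - d` of the weight is chosen so that, with the polar density, `r ^ a`
    -- remains.
    have h3 : r ^ (d - 1) * r ^ (a + 1 - d) = r ^ a := by
      rw [← Real.rpow_natCast, ← Real.rpow_add hr0, Nat.cast_sub NeZero.one_le]
      congr 1; push_cast; ring
    rw [h3, posPow, indicator_of_mem hr]
  rw [setLIntegral_congr_fun measurableSet_Ioi h1, ← lintegral_indicator measurableSet_Ioi]
  have h4 : ∀ r : ℝ, (Ioi (0 : ℝ)).indicator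
      (fun r => ∫⁻ s : ℝ, posPow a r * X (s + r / 2) (s - r / 2)) r =
      ∫⁻ s : ℝ, posPow a r * X (s + r / 2) (s - r / 2) := by
    intro r
    by_cases hr : r ∈ Ioi (0 : ℝ)
    · rw [indicator_of_mem hr]
    · rw [indicator_of_notMem hr]
      simp [posPow, indicator_of_notMem hr]
  rw [lintegral_congr h4, lintegral_pairs_on_lines hXm, hX]
  exact (lintegral_posPow_inner a hΦe he).symm

end

/-! ### Powers of linear forms on the sphere, and the resulting constant -/

section

variable {d : ℕ} [NeZero d]

theorem posPow_mul {r : ℝ} (hr : 0 < r) (a x : ℝ) :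
    posPow a (r * x) = ENNReal.ofReal (r ^ a) * posPow a x := by
  unfold posPow
  by_cases hx : x ∈ Ioi (0 : ℝ)
  · have hx0 : 0 < x := hx
    rw [indicator_of_mem hx, indicator_of_mem (mem_Ioi.2 (mul_pos hr hx0)),
      Real.mul_rpow hr.le hx0.le, ENNReal.ofReal_mul (by positivity)]
  · have : r * x ∉ Ioi (0 : ℝ) := by
      simp only [mem_Ioi, not_lt] at hx ⊢
      exact mul_nonpos_of_nonneg_of_nonpos hr.le hx
    rw [indicator_of_notMem hx, indicator_of_notMem this, mul_zero]

theorem lintegral_rpow_mul_exp_neg_sq {q : ℝ} (hq : -1 < q) :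
    ∫⁻ x in Ioi (0 : ℝ), ENNReal.ofReal (x ^ q * Real.exp (-x ^ 2)) =
      ENNReal.ofReal (1 / 2 * Real.Gamma ((q + 1) / 2)) := by
  have h1 : ∀ x : ℝ, x ^ q * Real.exp (-x ^ 2) = x ^ q * Real.exp (-x ^ (2 : ℝ)) := fun x => by
    rw [Real.rpow_two]
  simp_rw [h1]
  rw [← integral_rpow_mul_exp_neg_rpow (by norm_num : (0 : ℝ) < 2) hq,
    ofReal_integral_eq_lintegral_ofReal (integrableOn_rpow_mul_exp_neg_rpow hq (by norm_num))]
  filter_upwards [ae_restrict_mem measurableSet_Ioi] with x hx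
  have : (0 : ℝ) < x := hx
  positivity

theorem lintegral_exp_neg_norm_sq (n : ℕ) :
    ∫⁻ y : Space n, ENNReal.ofReal (Real.exp (-‖y‖ ^ 2)) =
      ENNReal.ofReal (Real.pi ^ ((n : ℝ) / 2)) := by
  have h := GaussianFourier.integral_rexp_neg_mul_sq_norm (V := Space n) (b := 1) one_pos
  simp only [neg_mul, one_mul, div_one, finrank_euclideanSpace_fin] at h
  rw [← h, ofReal_integral_eq_lintegral_ofReal]
  · by_contra hc
    rw [integral_undef hc] at h
    have : (0 : ℝ) < Real.pi ^ ((n : ℝ) / 2) := by positivity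
    linarith
  · exact Filter.Eventually.of_forall fun x => (Real.exp_pos _).le

/-- The mean over the sphere of the positive parts of the powers of linear forms. -/
def sphereConst (d : ℕ) (a : ℝ) : ℝ :=
  Real.pi ^ (((d : ℝ) - 1) / 2) * (Real.Gamma ((a + 1) / 2) / Real.Gamma ((a + d) / 2))

theorem sphereConst_pos {a : ℝ} (ha : -1 < a) : 0 < sphereConst d a := by
  have hd : (1 : ℝ) ≤ d := by exact_mod_cast NeZero.one_le
  have h1 := Real.Gamma_pos_of_pos (by linarith : 0 < (a + 1) / 2)
  have h2 := Real.Gamma_pos_of_pos (by linarith : 0 < (a + d) / 2)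
  unfold sphereConst
  positivity

/-- The integral of ⟨ξ, x⟩₊^a exp(-|ξ|²) over the whole space is evaluated twice. In the frame of
`x` it is a one-dimensional Gamma integral times a Gaussian integral over a hyperplane; in polar
coordinates the integral over the sphere splits off. -/
theorem lintegral_sphere_posPow {a : ℝ} (ha : -1 < a) {x : Space d} (hx : x ≠ 0) :
    ∫⁻ e, posPow a ⟪(e : Space d), x⟫ ∂(volume : Measure (Space d)).toSphere =
      ENNReal.ofReal (sphereConst d a * ‖x‖ ^ a) := by
  have hd : (1 : ℝ) ≤ d := by exact_mod_cast NeZero.one_le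
  have hG2 := Real.Gamma_pos_of_pos (by linarith : 0 < (a + d) / 2)
  have hG1 := Real.Gamma_pos_of_pos (by linarith : 0 < (a + 1) / 2)
  have hm : Measurable fun ξ : Space d =>
      posPow a ⟪ξ, x⟫ * ENNReal.ofReal (Real.exp (-‖ξ‖ ^ 2)) := by fun_prop
  have hx0 : 0 < ‖x‖ := norm_pos_iff.2 hx
  have e1 : ∫⁻ ξ : Space d, posPow a ⟪ξ, x⟫ * ENNReal.ofReal (Real.exp (-‖ξ‖ ^ 2)) =
      ENNReal.ofReal (‖x‖ ^ a * (1 / 2 * Real.Gamma ((a + 1) / 2)) *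
        Real.pi ^ (((d : ℝ) - 1) / 2)) := by
    rw [lintegral_frame (n := x) hm]
    have h1 : ∀ s : ℝ, ∫⁻ y : Space (d - 1), posPow a ⟪frame x (s, y), x⟫ *
        ENNReal.ofReal (Real.exp (-‖frame x (s, y)‖ ^ 2)) =
        (Ioi (0 : ℝ)).indicator (fun s => ENNReal.ofReal (s ^ a * Real.exp (-s ^ 2))) s *
        ENNReal.ofReal (‖x‖ ^ a * Real.pi ^ (((d : ℝ) - 1) / 2)) := by
      intro s
      have h2 : ∀ y : Space (d - 1), posPow a ⟪frame x (s, y), x⟫ *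
          ENNReal.ofReal (Real.exp (-‖frame x (s, y)‖ ^ 2)) =
          (ENNReal.ofReal (‖x‖ ^ a) * posPow a s * ENNReal.ofReal (Real.exp (-s ^ 2))) *
            ENNReal.ofReal (Real.exp (-‖y‖ ^ 2)) := fun y => by
        rw [real_inner_comm, inner_frame, posPow_mul hx0, norm_frame_sq, neg_add, Real.exp_add,
          ENNReal.ofReal_mul (Real.exp_pos _).le]
        ring
      simp_rw [h2]
      rw [lintegral_const_mul _ (by fun_prop), lintegral_exp_neg_norm_sq,
        ENNReal.ofReal_mul (by positivity), Nat.cast_sub NeZero.one_le, Nat.cast_one]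
      by_cases hs : s ∈ Ioi (0 : ℝ)
      · have hs0 : 0 < s := hs
        rw [posPow, indicator_of_mem hs, indicator_of_mem hs, ENNReal.ofReal_mul (by positivity)]
        ring
      · rw [posPow, indicator_of_notMem hs, indicator_of_notMem hs]
        ring
    simp_rw [h1]
    rw [lintegral_mul_const' _ _ ENNReal.ofReal_ne_top, lintegral_indicator measurableSet_Ioi,
      lintegral_rpow_mul_exp_neg_sq ha, ← ENNReal.ofReal_mul (by positivity)]
    congr 1; ring
  have e2 : ∫⁻ ξ : Space d, posPow a ⟪ξ, x⟫ * ENNReal.ofReal (Real.exp (-‖ξ‖ ^ 2)) =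
      (∫⁻ e, posPow a ⟪(e : Space d), x⟫ ∂(volume : Measure (Space d)).toSphere) *
        ENNReal.ofReal (1 / 2 * Real.Gamma ((a + d) / 2)) := by
    rw [lintegral_polar hm, ← lintegral_mul_const' _ _ ENNReal.ofReal_ne_top]
    refine lintegral_congr fun e => ?_
    have h3 : ∀ r ∈ Ioi (0 : ℝ), ENNReal.ofReal (r ^ (d - 1)) * (posPow a ⟪r • (e : Space d), x⟫ *
        ENNReal.ofReal (Real.exp (-‖r • (e : Space d)‖ ^ 2))) =
        posPow a ⟪(e : Space d), x⟫ *
          ENNReal.ofReal (r ^ (a + d - 1) * Real.exp (-r ^ 2)) := by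
      intro r hr
      have hr0 : 0 < r := hr
      have h4 : r ^ (a + d - 1) = r ^ (d - 1) * r ^ a := by
        rw [← Real.rpow_natCast, ← Real.rpow_add hr0, Nat.cast_sub NeZero.one_le]
        congr 1; push_cast; ring
      rw [real_inner_smul_left, posPow_mul hr0, norm_smul, norm_eq_of_mem_sphere, mul_one,
        Real.norm_of_nonneg hr0.le, h4, ENNReal.ofReal_mul (by positivity),
        ENNReal.ofReal_mul (by positivity)]
      ring
    rw [setLIntegral_congr_fun measurableSet_Ioi h3, lintegral_const_mul _ (by fun_prop),
      lintegral_rpow_mul_exp_neg_sq (by linarith)]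
    ring_nf
  have hne : ENNReal.ofReal (1 / 2 * Real.Gamma ((a + d) / 2)) ≠ 0 := by
    rw [Ne, ENNReal.ofReal_eq_zero, not_le]; positivity
  rw [← ENNReal.mul_left_inj hne ENNReal.ofReal_ne_top, ← e2, e1,
    ← ENNReal.ofReal_mul (by have := sphereConst_pos (d := d) ha; positivity), sphereConst]
  congr 1
  field_simp

/-- The integral over all rectangles of a function of one diagonal. -/
theorem lintegral_rectangles_diagonal {a : ℝ} (ha : -1 < a) {Ψ : Space d × Space d → ℝ≥0∞}
    (hΨ : Measurable Ψ) :
    ∫⁻ ξ : Space d, ∫⁻ s : ℝ, ∫⁻ y : Space (d - 1), ∫⁻ y' : Space (d - 1),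
      ENNReal.ofReal (‖ξ‖ ^ (a + 1 - d)) *
        Ψ (frame ξ (s + ‖ξ‖ / 2, y), frame ξ (s - ‖ξ‖ / 2, y')) =
    ENNReal.ofReal (sphereConst d a) *
      ∫⁻ z : Space d × Space d, Ψ z * ENNReal.ofReal (‖z.1 - z.2‖ ^ a) := by
  rw [lintegral_rectangles a (Φ := fun _ => Ψ) (by unfold Function.uncurry; fun_prop)
    (fun _ _ _ => rfl)]
  rw [lintegral_lintegral_swap (Measurable.aemeasurable (by unfold Function.uncurry; fun_prop)),
    ← lintegral_const_mul _ (by fun_prop)]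
  refine lintegral_congr_ae ?_
  -- The sphere integral is known only for nonzero vectors; the diagonal is a null set.
  have hne : ∀ᵐ z : Space d × Space d, z.1 - z.2 ≠ 0 := by
    have : ∀ᵐ q : Space d × (Space d), q.1 ≠ 0 :=
      Measure.quasiMeasurePreserving_fst.ae (Measure.ae_ne (volume : Measure (Space d)) 0)
    exact (measurePreserving_sub_prod (volume : Measure (Space d)) volume).quasiMeasurePreserving.ae this
  filter_upwards [hne] with z hz
  rw [lintegral_mul_const _ (by fun_prop), lintegral_sphere_posPow ha hz,
    ENNReal.ofReal_mul (sphereConst_pos ha).le]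
  ring

end

/-! ### A Schur test for differences of points of the paraboloid -/

section

variable {d : ℕ} [NeZero d]

theorem lintegral_inv_one_add_norm_pow_lt_top {E : Type*} [NormedAddCommGroup E]
    [NormedSpace ℝ E] [FiniteDimensional ℝ E] [MeasurableSpace E] [BorelSpace E] (μ : Measure E)
    [μ.IsAddHaarMeasure] {n : ℕ} (hn : Module.finrank ℝ E < n) :
    ∫⁻ x : E, ENNReal.ofReal ((1 + ‖x‖) ^ n)⁻¹ ∂μ < ∞ := by
  have := finite_integral_one_add_norm (μ := μ) (E := E) (r := n) (by exact_mod_cast hn)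
  refine lt_of_eq_of_lt (lintegral_congr fun x => ?_) this
  rw [Real.rpow_neg (by positivity), Real.rpow_natCast]

/-- For |s| < Z/2 the slope of the parabola is at least Z in modulus, so using its value as the
variable gains 1/Z when Z ≥ 1. In all other cases one of the three factors 1 + |s| is at least (1 +
Z)/2. -/
theorem lintegral_parabola_le (Z : ℝ) (hZ : 0 ≤ Z) (c : ℝ) :
    ∫⁻ s : ℝ, ENNReal.ofReal ((1 + |s|) ^ 3 * (1 + |s ^ 2 - 2 * Z * s + c|) ^ 2)⁻¹ ≤
      4 * (∫⁻ s : ℝ, ENNReal.ofReal ((1 + ‖s‖) ^ 2)⁻¹) * ENNReal.ofReal (1 + Z)⁻¹ := by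
  set I := ∫⁻ s : ℝ, ENNReal.ofReal ((1 + ‖s‖) ^ 2)⁻¹ with hI
  set h : ℝ → ℝ := fun s => s ^ 2 - 2 * Z * s + c with hh
  set A : Set ℝ := Ioo (-(Z / 2)) (Z / 2) with hA
  have hinj : InjOn h A := by
    intro s hs t ht hst
    have h1 : (s - t) * (s + t - 2 * Z) = 0 := by simp only [hh] at hst; linarith
    rcases mul_eq_zero.1 h1 with h2 | h2
    · linarith
    · have := hs.1; have := hs.2; have := ht.2; linarith
  have hder : ∀ s ∈ A, HasDerivWithinAt h (2 * s - 2 * Z) A s := by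
    intro s _
    have := (((hasDerivAt_id s).pow 2).sub ((hasDerivAt_id s).const_mul (2 * Z))).add_const c
    refine (this.congr_deriv ?_).hasDerivWithinAt
    simp
  have h1 : ∫⁻ s in A, ENNReal.ofReal |2 * s - 2 * Z| * ENNReal.ofReal ((1 + ‖h s‖) ^ 2)⁻¹ ≤ I := by
    rw [← lintegral_image_eq_lintegral_abs_deriv_mul measurableSet_Ioo hder hinj
      (fun t => ENNReal.ofReal ((1 + ‖t‖) ^ 2)⁻¹)]
    exact setLIntegral_le_lintegral _ _
  have h2 : ∀ s : ℝ, ENNReal.ofReal ((1 + |s|) ^ 3 * (1 + |s ^ 2 - 2 * Z * s + c|) ^ 2)⁻¹ ≤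
      ENNReal.ofReal (2 * (1 + Z)⁻¹) * (ENNReal.ofReal ((1 + ‖s‖) ^ 2)⁻¹ +
        A.indicator (fun s => ENNReal.ofReal |2 * s - 2 * Z| *
          ENNReal.ofReal ((1 + ‖h s‖) ^ 2)⁻¹) s) := by
    intro s
    by_cases hs : s ∈ A ∧ 1 ≤ Z
    · refine le_trans ?_ (mul_le_mul_right le_add_self _)
      rw [indicator_of_mem hs.1, ← ENNReal.ofReal_mul (abs_nonneg _),
        ← ENNReal.ofReal_mul (by positivity)]
      refine ENNReal.ofReal_le_ofReal ?_
      have h3 : Z ≤ |2 * s - 2 * Z| := by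
        rw [abs_of_neg (by have := hs.1.2; linarith [hs.2])]
        have := hs.1.2; linarith
      rw [mul_inv, Real.norm_eq_abs, ← mul_assoc]
      refine mul_le_mul_of_nonneg_right ?_ (by positivity)
      have h4 : ((1 + |s|) ^ 3)⁻¹ ≤ 1 := inv_le_one_of_one_le₀ (one_le_pow₀ (by linarith [abs_nonneg s]))
      refine h4.trans ?_
      have h5 : 2 * (1 + Z)⁻¹ * |2 * s - 2 * Z| = 2 * |2 * s - 2 * Z| / (1 + Z) := by ring
      rw [h5, le_div_iff₀ (by positivity)]
      linarith [hs.2]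
    · refine le_trans ?_ (mul_le_mul_right le_self_add _)
      rw [← ENNReal.ofReal_mul (by positivity)]
      refine ENNReal.ofReal_le_ofReal ?_
      have h3 : 1 + Z ≤ 2 * (1 + |s|) := by
        by_cases hZ1 : 1 ≤ Z
        · have h5 : s ∉ A := fun h => hs ⟨h, hZ1⟩
          have h6 : Z / 2 ≤ |s| := by
            by_contra h7
            exact h5 (abs_lt.1 (not_le.1 h7))
          linarith
        · linarith [abs_nonneg s]
      have h7 : 2 * (1 + Z)⁻¹ * ((1 + |s|) ^ 2)⁻¹ = 2 / ((1 + |s|) ^ 2 * (1 + Z)) := by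
        field_simp
      rw [Real.norm_eq_abs, h7, inv_eq_one_div, div_le_div_iff₀ (by positivity) (by positivity)]
      have h8 : 1 ≤ (1 + |s ^ 2 - 2 * Z * s + c|) ^ 2 :=
        one_le_pow₀ (by linarith [abs_nonneg (s ^ 2 - 2 * Z * s + c)])
      have h9 : (1 + |s|) ^ 3 ≤ (1 + |s|) ^ 3 * (1 + |s ^ 2 - 2 * Z * s + c|) ^ 2 :=
        le_mul_of_one_le_right (by positivity) h8
      have h10 : (1 + |s|) ^ 2 * (1 + Z) ≤ (1 + |s|) ^ 2 * (2 * (1 + |s|)) :=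
        mul_le_mul_of_nonneg_left h3 (by positivity)
      calc _ = (1 + |s|) ^ 2 * (1 + Z) := by ring
        _ ≤ _ := h10
        _ = 2 * (1 + |s|) ^ 3 := by ring
        _ ≤ _ := by linarith
  refine (lintegral_mono h2).trans ?_
  rw [lintegral_const_mul' _ _ ENNReal.ofReal_ne_top, lintegral_add_left (by fun_prop),
    lintegral_indicator measurableSet_Ioo, ENNReal.ofReal_mul (by norm_num)]
  calc _ ≤ ENNReal.ofReal 2 * ENNReal.ofReal (1 + Z)⁻¹ * (I + I) := by gcongr
    _ = _ := by
      rw [ENNReal.ofReal_ofNat]; ring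

/-- The paraboloid, as the graph over `ℝ^d` of the negative frequency function, in Mathlib's
normalisation of the Fourier transform. -/
def paraboloid (ζ : Space d) : SpaceTime d := WithLp.toLp 2 (-(2 * Real.pi * ‖ζ‖ ^ 2), ζ)

theorem continuous_paraboloid {d : ℕ} : Continuous (paraboloid (d := d)) := by
  unfold paraboloid
  exact (WithLp.prod_continuous_toLp 2 _ _).comp (by fun_prop)

/-- A weight of polynomial decay, integrable on space-time and strong enough for the Schur test on
differences of points of the paraboloid. -/
def decay (p : SpaceTime d) : ℝ := ((1 + ‖p‖) ^ (d + 5))⁻¹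

/-- With η = ζ - `frame ζ (s, y)` the time component of the difference is 2π(s² - 2|ζ|s + |y|²), a
parabola in s. Of the d + 5 powers in `decay`, d make the y integral converge, and three plus two
feed `lintegral_parabola_le`, which is uniform in the constant term |y|². -/
theorem lintegral_decay_paraboloid_le : ∃ C : ℝ≥0∞, C < ∞ ∧ ∀ ζ : Space d,
    ∫⁻ η : Space d, ENNReal.ofReal (decay (paraboloid ζ - paraboloid η)) ≤
      C * ENNReal.ofReal (1 + ‖ζ‖)⁻¹ := by
  set I := ∫⁻ s : ℝ, ENNReal.ofReal ((1 + ‖s‖) ^ 2)⁻¹ with hI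
  set J := ∫⁻ y : Space (d - 1), ENNReal.ofReal ((1 + ‖y‖) ^ d)⁻¹ with hJ
  have hIt : I < ∞ := lintegral_inv_one_add_norm_pow_lt_top _ (by simp)
  have hJt : J < ∞ := lintegral_inv_one_add_norm_pow_lt_top _ (by
    rw [finrank_euclideanSpace_fin]
    have := NeZero.one_le (n := d); omega)
  refine ⟨J * (4 * I), ENNReal.mul_lt_top hJt (ENNReal.mul_lt_top (by simp) hIt), fun ζ => ?_⟩
  rw [← lintegral_sub_left_eq_self _ ζ, lintegral_frame (n := ζ)]
  swap
  · unfold decay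
    have := continuous_paraboloid (d := d).measurable
    fun_prop
  have hb : ∀ (s : ℝ) (y : Space (d - 1)),
      ENNReal.ofReal (decay (paraboloid ζ - paraboloid (ζ - frame ζ (s, y)))) ≤
      ENNReal.ofReal ((1 + ‖y‖) ^ d)⁻¹ *
        ENNReal.ofReal ((1 + |s|) ^ 3 * (1 + |s ^ 2 - 2 * ‖ζ‖ * s + ‖y‖ ^ 2|) ^ 2)⁻¹ := by
    intro s y
    rw [← ENNReal.ofReal_mul (by positivity), ← mul_inv]
    refine ENNReal.ofReal_le_ofReal ?_
    unfold decay
    set p := paraboloid ζ - paraboloid (ζ - frame ζ (s, y)) with hp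
    have hsnd : p.snd = frame ζ (s, y) := by simp [hp, paraboloid]
    have hfst : p.fst = 2 * Real.pi * (s ^ 2 - 2 * ‖ζ‖ * s + ‖y‖ ^ 2) := by
      simp only [hp, paraboloid, WithLp.sub_fst, WithLp.toLp_fst]
      rw [norm_sub_sq_real, inner_frame, norm_frame_sq]
      ring
    have h1 : |p.fst| ≤ ‖p‖ := WithLp.norm_fst_le _ p
    have h2 : ‖p.snd‖ ≤ ‖p‖ := WithLp.norm_snd_le _ p
    rw [hsnd] at h2
    have h3 : |s ^ 2 - 2 * ‖ζ‖ * s + ‖y‖ ^ 2| ≤ ‖p‖ := by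
      refine le_trans ?_ h1
      rw [hfst, abs_mul]
      refine le_mul_of_one_le_left (abs_nonneg _) ?_
      rw [abs_of_pos (by positivity)]
      linarith [Real.pi_gt_three]
    have h4 : |s| ≤ ‖p‖ := by
      refine le_trans ?_ h2
      refine abs_le_of_sq_le_sq ?_ (norm_nonneg _)
      rw [norm_frame_sq]; nlinarith [sq_nonneg ‖y‖]
    have h5 : ‖y‖ ≤ ‖p‖ := by
      refine le_trans ?_ h2
      refine le_of_sq_le_sq ?_ (norm_nonneg _)
      rw [norm_frame_sq]; nlinarith [sq_nonneg s]
    refine inv_anti₀ (by positivity) ?_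
    calc (1 + ‖y‖) ^ d * ((1 + |s|) ^ 3 * (1 + |s ^ 2 - 2 * ‖ζ‖ * s + ‖y‖ ^ 2|) ^ 2)
        ≤ (1 + ‖p‖) ^ d * ((1 + ‖p‖) ^ 3 * (1 + ‖p‖) ^ 2) := by gcongr
      _ = (1 + ‖p‖) ^ (d + 5) := by ring
  calc _ ≤ ∫⁻ s : ℝ, ∫⁻ y : Space (d - 1), ENNReal.ofReal ((1 + ‖y‖) ^ d)⁻¹ *
        ENNReal.ofReal ((1 + |s|) ^ 3 * (1 + |s ^ 2 - 2 * ‖ζ‖ * s + ‖y‖ ^ 2|) ^ 2)⁻¹ :=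
      lintegral_mono fun s => lintegral_mono fun y => hb s y
    _ = ∫⁻ y : Space (d - 1), ENNReal.ofReal ((1 + ‖y‖) ^ d)⁻¹ * ∫⁻ s : ℝ,
        ENNReal.ofReal ((1 + |s|) ^ 3 * (1 + |s ^ 2 - 2 * ‖ζ‖ * s + ‖y‖ ^ 2|) ^ 2)⁻¹ := by
      rw [lintegral_lintegral_swap (Measurable.aemeasurable (by unfold Function.uncurry; fun_prop))]
      exact lintegral_congr fun y => lintegral_const_mul' _ _ ENNReal.ofReal_ne_top
    _ ≤ ∫⁻ y : Space (d - 1), ENNReal.ofReal ((1 + ‖y‖) ^ d)⁻¹ *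
        (4 * I * ENNReal.ofReal (1 + ‖ζ‖)⁻¹) := by
      gcongr with y
      exact lintegral_parabola_le _ (norm_nonneg _) _
    _ = _ := by
      rw [lintegral_mul_const _ (by fun_prop)]
      ring

/-- The weighted `L²` norm (squared) adapted to the local smoothing effect. -/
def smoothNorm (f : Space d → ℂ) : ℝ≥0∞ := ∫⁻ ζ, ‖f ζ‖ₑ ^ 2 * ENNReal.ofReal (1 + ‖ζ‖)⁻¹

/-- A form of the Schur test for symmetric kernels. -/
theorem lintegral_schur_le {α : Type*} [MeasurableSpace α] {μ : Measure α} [SFinite μ]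
    {k : α × α → ℝ≥0∞} (hk : Measurable k) (hsym : ∀ x y, k (x, y) = k (y, x)) {w : α → ℝ≥0∞}
    (hw : Measurable w) {C : ℝ≥0∞} (h : ∀ x, ∫⁻ y, k (x, y) ∂μ ≤ C * w x) {F G : α → ℝ≥0∞}
    (hF : Measurable F) (hG : Measurable G) :
    ∫⁻ z : α × α, F z.1 * G z.2 * k z ∂μ.prod μ ≤
      C * ((∫⁻ x, F x ^ 2 * w x ∂μ) + ∫⁻ x, G x ^ 2 * w x ∂μ) := by
  have hone : ∀ F : α → ℝ≥0∞, Measurable F →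
      ∫⁻ z : α × α, F z.1 ^ 2 * k z ∂μ.prod μ ≤ C * ∫⁻ x, F x ^ 2 * w x ∂μ := by
    intro F hF
    rw [lintegral_prod _ (by fun_prop), ← lintegral_const_mul _ (by fun_prop)]
    refine lintegral_mono fun x => ?_
    have hk1 : Measurable fun y => k (x, y) := hk.comp measurable_prodMk_left
    change ∫⁻ y, F x ^ 2 * k (x, y) ∂μ ≤ _
    rw [lintegral_const_mul _ hk1]
    calc _ ≤ F x ^ 2 * (C * w x) := by gcongr; exact h x
      _ = _ := by ring
  have htwo : ∫⁻ z : α × α, G z.2 ^ 2 * k z ∂μ.prod μ ≤ C * ∫⁻ x, G x ^ 2 * w x ∂μ := by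
    refine le_trans (le_of_eq ?_) (hone G hG)
    rw [← lintegral_prod_swap]
    refine lintegral_congr fun z => ?_
    change _ * k (z.2, z.1) = _
    rw [hsym]; rfl
  calc _ ≤ ∫⁻ z : α × α, (F z.1 ^ 2 * k z + G z.2 ^ 2 * k z) ∂μ.prod μ := by
        refine lintegral_mono fun z => ?_
        rw [← add_mul]
        gcongr
        rcases le_total (F z.1) (G z.2) with h1 | h1
        · refine le_trans ?_ le_add_self
          rw [sq]; gcongr
        · refine le_trans ?_ le_self_add
          rw [sq]; gcongr
    _ ≤ _ := by
        rw [lintegral_add_left (by fun_prop), mul_add]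
        exact add_le_add (hone F hF) htwo

@[fun_prop]
theorem measurable_paraboloid {d : ℕ} : Measurable (paraboloid (d := d)) :=
  continuous_paraboloid.measurable

@[fun_prop]
theorem measurable_decay {d : ℕ} : Measurable (decay (d := d)) := by
  unfold decay; fun_prop

theorem exists_lintegral_mul_decay_le : ∃ C : ℝ≥0∞, C < ∞ ∧ ∀ f g : Space d → ℂ, Measurable f →
    Measurable g → ∫⁻ z : Space d × Space d, ‖f z.1‖ₑ * ‖g z.2‖ₑ *
      ENNReal.ofReal (decay (paraboloid z.1 - paraboloid z.2)) ≤
        C * (smoothNorm f + smoothNorm g) := by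
  obtain ⟨C, hC, h⟩ := lintegral_decay_paraboloid_le (d := d)
  refine ⟨C, hC, fun f g hf hg => ?_⟩
  refine lintegral_schur_le (μ := (volume : Measure (Space d)))
    (k := fun z => ENNReal.ofReal (decay (paraboloid z.1 - paraboloid z.2)))
    (F := fun x => ‖f x‖ₑ) (G := fun x => ‖g x‖ₑ) ?_ (fun ζ η => ?_) ?_ h hf.enorm hg.enorm
  · fun_prop
  · unfold decay; rw [norm_sub_rev]
  · fun_prop

end

/-! ### Superpositions of plane waves and local smoothing -/

section

/-- The standard character `exp(2πit)` of the real line. -/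
def character (t : ℝ) : ℂ := Real.fourierChar t

theorem continuous_character : Continuous character :=
  continuous_subtype_val.comp Real.continuous_fourierChar

@[fun_prop]
theorem measurable_character : Measurable character := continuous_character.measurable

theorem character_eq (t : ℝ) : character t = Complex.exp (2 * Real.pi * t * Complex.I) := by
  rw [character, Real.fourierChar_apply]
  push_cast
  ring_nf

@[simp]
theorem norm_character (t : ℝ) : ‖character t‖ = 1 := Circle.norm_coe _

@[simp]
theorem enorm_character (t : ℝ) : ‖character t‖ₑ = 1 := by
  rw [← ofReal_norm, norm_character, ENNReal.ofReal_one]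

theorem character_add (s t : ℝ) : character (s + t) = character s * character t := by
  unfold character
  rw [AddChar.map_add_eq_mul, Circle.coe_mul]

theorem character_neg (t : ℝ) : character (-t) = (starRingEnd ℂ) (character t) := by
  unfold character
  rw [AddChar.map_neg_eq_inv, Circle.coe_inv_eq_conj]


section Waves

variable {α E : Type*} [MeasurableSpace α] {μ : Measure α} [SFinite μ] [NormedAddCommGroup E]
  [InnerProductSpace ℝ E] [FiniteDimensional ℝ E] [MeasurableSpace E] [BorelSpace E]

/-- The superposition of the plane waves with frequencies `Γ x` and amplitudes `f x`. -/
def wave (μ : Measure α) (Γ : α → E) (f : α → ℂ) (p : E) : ℂ :=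
  ∫ x, (character ⟪p, Γ x⟫) * f x ∂μ

theorem measurable_wave_integrand {Γ : α → E} (hΓ : Measurable Γ) {f : α → ℂ} (hf : Measurable f) :
    Measurable fun q : E × α => (character ⟪q.1, Γ q.2⟫) * f q.2 := by
  fun_prop

theorem stronglyMeasurable_wave {Γ : α → E} (hΓ : Measurable Γ) {f : α → ℂ} (hf : Measurable f) :
    StronglyMeasurable (wave μ Γ f) :=
  (measurable_wave_integrand hΓ hf).stronglyMeasurable.integral_prod_right

theorem integrable_wave_integrand {Γ : α → E} (hΓ : Measurable Γ) {f : α → ℂ} (hf : Integrable f μ)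
    (p : E) : Integrable (fun x => (character ⟪p, Γ x⟫) * f x) μ := by
  refine hf.bdd_mul (c := 1) ?_ (Eventually.of_forall fun x => by simp)
  exact Measurable.aestronglyMeasurable (by fun_prop)

theorem wave_sub {Γ : α → E} (hΓ : Measurable Γ) {f g : α → ℂ} (hf : Integrable f μ)
    (hg : Integrable g μ) (p : E) : wave μ Γ (fun x => f x - g x) p = wave μ Γ f p - wave μ Γ g p := by
  unfold wave
  rw [← integral_sub (integrable_wave_integrand hΓ hf p) (integrable_wave_integrand hΓ hg p)]
  congr 1; funext x; ring

theorem wave_add_right (Γ : α → E) (f : α → ℂ) (p q : E) :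
    wave μ Γ f (p + q) = wave μ Γ (fun x => (character ⟪q, Γ x⟫) * f x) p := by
  unfold wave
  congr 1; funext x
  rw [inner_add_left, character_add]
  ring

theorem norm_wave_le (Γ : α → E) (f : α → ℂ) (p : E) : ‖wave μ Γ f p‖ ≤ ∫ x, ‖f x‖ ∂μ := by
  refine (norm_integral_le_integral_norm _).trans (le_of_eq ?_)
  simp

/-- Conjugation reverses frequencies, so the product superposes the differences of frequencies. All
bilinear computations start here. -/
theorem wave_mul_conj (Γ : α → E) (f g : α → ℂ) (p : E) :
    wave μ Γ f p * (starRingEnd ℂ) (wave μ Γ g p) =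
      wave (μ.prod μ) (fun z => Γ z.1 - Γ z.2) (fun z => f z.1 * (starRingEnd ℂ) (g z.2)) p := by
  unfold wave
  rw [← integral_conj, ← integral_prod_mul]
  congr 1; funext z
  rw [map_mul, inner_sub_right, sub_eq_add_neg, character_add, character_neg]
  ring

/-- Fubini; the inverse transform appears because the waves carry the character with a positive
sign. -/
theorem integral_mul_wave {Γ : α → E} (hΓ : Measurable Γ) {f : α → ℂ} (hfm : Measurable f)
    (hf : Integrable f μ) (φ : 𝓢(E, ℂ)) :
    ∫ p, φ p * wave μ Γ f p = ∫ x, f x * (𝓕⁻ φ) (Γ x) ∂μ := by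
  have hint : Integrable (fun q : E × α => φ q.1 * ((character ⟪q.1, Γ q.2⟫) * f q.2))
      ((volume : Measure E).prod μ) := by
    refine (φ.integrable.mul_prod hf).mono ?_ (Eventually.of_forall fun q => by simp)
    exact ((φ.continuous.measurable.comp measurable_fst).mul
      (measurable_wave_integrand hΓ hfm)).aestronglyMeasurable
  calc ∫ p, φ p * wave μ Γ f p
      = ∫ p, ∫ x, φ p * ((character ⟪p, Γ x⟫) * f x) ∂μ := by
        congr 1; funext p
        rw [wave, integral_const_mul]
    _ = ∫ x, ∫ p, φ p * ((character ⟪p, Γ x⟫) * f x) ∂(volume : Measure E) ∂μ := by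
        exact integral_integral_swap hint
    _ = _ := by
        congr 1; funext x
        rw [SchwartzMap.fourierInv_coe, Real.fourierInv_eq, ← integral_const_mul]
        congr 1; funext p
        rw [Circle.smul_def, smul_eq_mul]
        change _ = f x * (character _ * _)
        ring

end Waves

set_option linter.unusedSectionVars false

variable {d : ℕ} [NeZero d]

theorem exists_norm_le_inv_pow {E : Type*} [NormedAddCommGroup E] [NormedSpace ℝ E]
    (ψ : 𝓢(E, ℂ)) (k : ℕ) : ∃ C : ℝ, 0 < C ∧ ∀ x, ‖ψ x‖ ≤ C * ((1 + ‖x‖) ^ k)⁻¹ := by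
  set C := 2 ^ k * (Finset.Iic (k, 0)).sup (fun m : ℕ × ℕ => SchwartzMap.seminorm ℝ m.1 m.2) ψ
  refine ⟨max C 1, by positivity, fun p => ?_⟩
  have h := SchwartzMap.one_add_le_sup_seminorm_apply (𝕜 := ℝ) (m := (k, 0)) (k := k)
    (n := 0) le_rfl le_rfl ψ p
  rw [norm_iteratedFDeriv_zero] at h
  rw [← div_eq_mul_inv, le_div_iff₀ (by positivity), mul_comm]
  exact h.trans (le_max_left _ _)

theorem exists_norm_le_decay (ψ : 𝓢(SpaceTime d, ℂ)) :
    ∃ C : ℝ, 0 < C ∧ ∀ p, ‖ψ p‖ ≤ C * decay p :=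
  exists_norm_le_inv_pow ψ (d + 5)

theorem decay_pos (p : SpaceTime d) : 0 < decay p := by
  unfold decay; positivity

/-- The solution of the Schrödinger equation with Fourier transform `f` of the initial datum. -/
def evolve (f : Space d → ℂ) : SpaceTime d → ℂ := wave volume paraboloid f

/-- By `wave_mul_conj` the left side is a double integral with kernel `𝓕⁻ φ` at differences of
points of the paraboloid, and the decay of this kernel reduces it to the Schur bound. The hypothesis
`hφ` says that `φ` is real and nonnegative. -/
theorem exists_lintegral_evolve_mul_le (φ : 𝓢(SpaceTime d, ℂ)) (hφ : ∀ p, φ p = (‖φ p‖ : ℂ)) :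
    ∃ C : ℝ≥0∞, C < ∞ ∧ ∀ f : Space d → ℂ, Measurable f → Integrable f →
      ∫⁻ p, ‖evolve f p‖ₑ ^ 2 * ‖φ p‖ₑ ≤ C * smoothNorm f := by
  obtain ⟨C, hC, h⟩ := exists_lintegral_mul_decay_le (d := d)
  obtain ⟨B, hB, hB'⟩ := exists_norm_le_decay (𝓕⁻ φ)
  refine ⟨ENNReal.ofReal B * (C * 2), ENNReal.mul_lt_top (by simp)
    (ENNReal.mul_lt_top hC (by simp)), fun f hfm hf => ?_⟩
  have hΓ : Measurable fun z : Space d × Space d => paraboloid z.1 - paraboloid z.2 := by fun_prop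
  have hF : Integrable (fun z : Space d × Space d => f z.1 * (starRingEnd ℂ) (f z.2)) := by
    refine hf.mul_prod (g := fun x => (starRingEnd ℂ) (f x)) ?_
    exact (RCLike.conjCLE (K := ℂ)).toContinuousLinearMap.integrable_comp hf
  have hFm : Measurable (fun z : Space d × Space d => f z.1 * (starRingEnd ℂ) (f z.2)) := by
    have : Measurable fun z : Space d × Space d => (starRingEnd ℂ) (f z.2) :=
      (RCLike.continuous_conj (K := ℂ)).measurable.comp (hfm.comp measurable_snd)
    exact (hfm.comp measurable_fst).mul this
  have key := integral_mul_wave hΓ hFm hF φ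
  have hsq : ∀ p, φ p * wave (volume : Measure (Space d × Space d))
      (fun z => paraboloid z.1 - paraboloid z.2) (fun z => f z.1 * (starRingEnd ℂ) (f z.2)) p =
      ((‖evolve f p‖ ^ 2 * ‖φ p‖ : ℝ) : ℂ) := fun p => by
    rw [Measure.volume_eq_prod, ← wave_mul_conj, RCLike.mul_conj, hφ p]
    simp [evolve]; ring
  simp_rw [hsq] at key
  rw [integral_complex_ofReal] at key
  have hmeas : StronglyMeasurable (evolve f) := stronglyMeasurable_wave measurable_paraboloid hfm
  have hi : Integrable (fun p => ‖evolve f p‖ ^ 2 * ‖φ p‖) := by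
    refine φ.integrable.norm.bdd_mul (c := (∫ x, ‖f x‖) ^ 2)
      (hmeas.norm.pow 2).aestronglyMeasurable (Eventually.of_forall fun p => ?_)
    rw [norm_pow, norm_norm]
    exact pow_le_pow_left₀ (norm_nonneg _) (norm_wave_le _ _ _) 2
  calc ∫⁻ p, ‖evolve f p‖ₑ ^ 2 * ‖φ p‖ₑ = ENNReal.ofReal (∫ p, ‖evolve f p‖ ^ 2 * ‖φ p‖) := by
        rw [ofReal_integral_eq_lintegral_ofReal hi (Eventually.of_forall fun p => by positivity)]
        refine lintegral_congr fun p => ?_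
        rw [ENNReal.ofReal_mul (by positivity), ENNReal.ofReal_pow (norm_nonneg _),
          ofReal_norm, ofReal_norm]
    _ = ‖∫ z : Space d × Space d, f z.1 * (starRingEnd ℂ) (f z.2) *
          (𝓕⁻ φ) (paraboloid z.1 - paraboloid z.2)‖ₑ := by
        rw [← key, ← ofReal_norm, Complex.norm_of_nonneg]
        exact integral_nonneg fun p => by positivity
    _ ≤ ∫⁻ z : Space d × Space d, ‖f z.1 * (starRingEnd ℂ) (f z.2) *
          (𝓕⁻ φ) (paraboloid z.1 - paraboloid z.2)‖ₑ := enorm_integral_le_lintegral_enorm _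
    _ ≤ ∫⁻ z : Space d × Space d, ENNReal.ofReal B * (‖f z.1‖ₑ * ‖f z.2‖ₑ *
          ENNReal.ofReal (decay (paraboloid z.1 - paraboloid z.2))) := by
        refine lintegral_mono fun z => ?_
        rw [enorm_mul, enorm_mul, RCLike.enorm_conj, mul_left_comm, ← ENNReal.ofReal_mul hB.le]
        gcongr
        rw [← ofReal_norm]
        exact ENNReal.ofReal_le_ofReal (hB' _)
    _ ≤ ENNReal.ofReal B * (C * (smoothNorm f + smoothNorm f)) := by
        rw [lintegral_const_mul' _ _ ENNReal.ofReal_ne_top]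
        gcongr
        exact h f f hfm hfm
    _ = _ := by ring

/-- The local smoothing effect. A translation of space-time multiplies `f` by a unimodular factor
and does not change `smoothNorm f`, so a single bump function at the origin serves all balls. -/
theorem exists_lintegral_ball_evolve_le : ∃ C : ℝ≥0∞, C < ∞ ∧ ∀ f : Space d → ℂ, Measurable f →
    Integrable f → ∀ q, ∫⁻ p in Metric.ball q 1, ‖evolve f p‖ₑ ^ 2 ≤ C * smoothNorm f := by
  let χ : ContDiffBump (0 : SpaceTime d) := ⟨1, 2, one_pos, one_lt_two⟩
  have h1 : HasCompactSupport fun p => (χ p : ℂ) :=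
    χ.hasCompactSupport.comp_left (g := fun x : ℝ => (x : ℂ)) (by simp)
  let φ : 𝓢(SpaceTime d, ℂ) := h1.toSchwartzMap (Complex.ofRealCLM.contDiff.comp χ.contDiff)
  have hφ : ∀ p, φ p = (χ p : ℂ) := fun p => rfl
  obtain ⟨C, hC, h⟩ := exists_lintegral_evolve_mul_le φ fun p => by
    rw [hφ, Complex.norm_of_nonneg χ.nonneg]
  refine ⟨C, hC, fun f hfm hf q => ?_⟩
  set g : Space d → ℂ := fun x => (character ⟪q, paraboloid x⟫) * f x with hg
  have hgm : Measurable g := by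
      fun_prop
  have hgn : smoothNorm g = smoothNorm f := by
    unfold smoothNorm
    refine lintegral_congr fun x => ?_
    simp [hg, enorm_mul]
  have hshift : ∀ p, evolve f (p + q) = evolve g p := fun p => wave_add_right _ _ _ _
  rw [← hgn]
  refine le_trans ?_ (h g hgm (integrable_wave_integrand measurable_paraboloid hf q))
  rw [← lintegral_indicator measurableSet_ball, ← lintegral_add_right_eq_self _ q]
  refine lintegral_mono fun p => ?_
  by_cases hp : p + q ∈ Metric.ball q 1
  · rw [indicator_of_mem hp, hshift]
    have hp' : p ∈ Metric.closedBall (0 : SpaceTime d) 1 := by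
      have : ‖p‖ < 1 := by simpa [dist_eq_norm] using hp
      simpa using this.le
    rw [hφ, χ.one_of_mem_closedBall hp']
    simp
  · rw [indicator_of_notMem hp]
    exact zero_le

end

/-! ### Weighted L² spaces -/

section

section Weighted

variable {α : Type*} [MeasurableSpace α] {μ : Measure α}

theorem sq_lintegral_mul_le {F G : α → ℝ≥0∞} (hF : AEMeasurable F μ) (hG : AEMeasurable G μ) :
    (∫⁻ x, F x * G x ∂μ) ^ 2 ≤ (∫⁻ x, F x ^ 2 ∂μ) * ∫⁻ x, G x ^ 2 ∂μ := by
  have h := ENNReal.lintegral_mul_le_Lp_mul_Lq μ Real.HolderConjugate.two_two hF hG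
  simp only [Pi.mul_apply, ENNReal.rpow_two] at h
  refine (pow_le_pow_left' h 2).trans (le_of_eq ?_)
  have hs : ∀ x : ℝ≥0∞, (x ^ (1 / 2 : ℝ)) ^ 2 = x := fun x => by
    rw [← ENNReal.rpow_two, ← ENNReal.rpow_mul]; norm_num
  rw [mul_pow, hs, hs]

theorem sq_lintegral_mul_mul_le {F G W : α → ℝ≥0∞} (hF : AEMeasurable F μ) (hG : AEMeasurable G μ)
    (hW : AEMeasurable W μ) : (∫⁻ x, F x * G x * W x ∂μ) ^ 2 ≤
      (∫⁻ x, F x ^ 2 * W x ∂μ) * ∫⁻ x, G x ^ 2 * W x ∂μ := by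
  have hs : ∀ x : ℝ≥0∞, x ^ (1 / 2 : ℝ) * x ^ (1 / 2 : ℝ) = x := fun x => by
    rw [← ENNReal.rpow_add_of_nonneg _ _ (by norm_num) (by norm_num)]; norm_num
  have h := sq_lintegral_mul_le (hF.mul (hW.pow_const (1 / 2 : ℝ)))
    (hG.mul (hW.pow_const (1 / 2 : ℝ)))
  simp only [Pi.mul_apply, mul_pow, sq (W _ ^ (1 / 2 : ℝ)), hs] at h
  refine le_trans (le_of_eq ?_) h
  congr 1
  refine lintegral_congr fun x => ?_
  rw [mul_mul_mul_comm, hs]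

theorem tendsto_zero_of_sq_le {X Y : ℕ → ℝ≥0∞} (h : ∀ n, X n ^ 2 ≤ Y n)
    (hY : Tendsto Y atTop (𝓝 0)) : Tendsto X atTop (𝓝 0) := by
  have h1 : Tendsto (fun n => Y n ^ (1 / 2 : ℝ)) atTop (𝓝 0) := by
    have := (ENNReal.continuous_rpow_const (y := (1 / 2 : ℝ))).tendsto 0
    rw [ENNReal.zero_rpow_of_pos (by norm_num)] at this
    exact this.comp hY
  refine tendsto_of_tendsto_of_tendsto_of_le_of_le tendsto_const_nhds h1 (fun _ => zero_le) ?_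
  intro n
  have : X n = (X n ^ 2) ^ (1 / 2 : ℝ) := by
    rw [← ENNReal.rpow_two, ← ENNReal.rpow_mul]; norm_num
  rw [this]
  exact ENNReal.rpow_le_rpow (h n) (by norm_num)

/-- Completeness of weighted `L²` spaces. -/
theorem exists_limit_of_weighted_cauchy {W : α → ℝ≥0∞} (hW : Measurable W)
    {u : ℕ → α → ℂ} (hu : ∀ n, StronglyMeasurable (u n))
    (hfin : ∀ n, ∫⁻ x, ‖u n x‖ₑ ^ 2 * W x ∂μ < ∞) {r : ℕ → ℝ≥0∞} (hr : Tendsto r atTop (𝓝 0))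
    (hrt : ∀ n, r n ≠ ∞)
    (hc : ∀ n m, n ≤ m → ∫⁻ x, ‖u n x - u m x‖ₑ ^ 2 * W x ∂μ ≤ r n) :
    ∃ U : α → ℂ, StronglyMeasurable U ∧ ∫⁻ x, ‖U x‖ₑ ^ 2 * W x ∂μ < ∞ ∧
      Tendsto (fun n => ∫⁻ x, ‖u n x - U x‖ₑ ^ 2 * W x ∂μ) atTop (𝓝 0) := by
  set ν := μ.withDensity W with hν
  have hint : ∀ F : α → ℂ, StronglyMeasurable F →
      ∫⁻ x, ‖F x‖ₑ ^ 2 * W x ∂μ = eLpNorm F 2 ν ^ 2 := by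
    intro F hF
    rw [eLpNorm_eq_lintegral_rpow_enorm_toReal (by norm_num) (by norm_num),
      lintegral_withDensity_eq_lintegral_mul₀ hW.aemeasurable (by fun_prop), ← ENNReal.rpow_two,
      ← ENNReal.rpow_mul]
    simp only [ENNReal.toReal_ofNat, ENNReal.rpow_two, Pi.mul_apply, one_div, ne_eq,
      OfNat.ofNat_ne_zero, not_false_eq_true, inv_mul_cancel₀, ENNReal.rpow_one]
    simp_rw [mul_comm (W _)]
  have hmem : ∀ n, MemLp (u n) 2 ν := fun n => by
    refine ⟨(hu n).aestronglyMeasurable, ?_⟩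
    have := hfin n
    rw [hint _ (hu n)] at this
    by_contra h
    rw [not_lt, top_le_iff] at h
    rw [h] at this
    simp at this
  have hcauchy : CauchySeq fun n => (hmem n).toLp := by
    refine cauchySeq_of_le_tendsto_0' (fun n => Real.sqrt (r n).toReal) ?_ ?_
    · intro n m hnm
      rw [Lp.dist_def]
      refine Real.le_sqrt_of_sq_le ?_
      have h1 : eLpNorm (⇑(hmem n).toLp - ⇑(hmem m).toLp) 2 ν = eLpNorm (u n - u m) 2 ν :=
        eLpNorm_congr_ae ((hmem n).coeFn_toLp.sub (hmem m).coeFn_toLp)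
      rw [h1, ← ENNReal.toReal_pow, ← hint _ ((hu n).sub (hu m))]
      exact ENNReal.toReal_mono (hrt n) (hc n m hnm)
    · have h2 : Tendsto (fun n => (r n).toReal) atTop (𝓝 0) :=
        (ENNReal.tendsto_toReal (ENNReal.zero_ne_top)).comp hr
      simpa using h2.sqrt
  obtain ⟨U, hU⟩ := cauchySeq_tendsto_of_complete hcauchy
  have hUm : StronglyMeasurable U := Lp.stronglyMeasurable U
  refine ⟨U, hUm, ?_, ?_⟩
  · rw [hint _ hUm]
    exact ENNReal.pow_lt_top (Lp.memLp U).2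
  · have h1 := (Lp.tendsto_Lp_iff_tendsto_eLpNorm' _ _).1 hU
    have h2 : ∀ n, ∫⁻ x, ‖u n x - U x‖ₑ ^ 2 * W x ∂μ = eLpNorm (⇑(hmem n).toLp - ⇑U) 2 ν ^ 2 := by
      intro n
      rw [← eLpNorm_congr_ae ((hmem n).coeFn_toLp.symm.sub (EventuallyEq.refl _ _))]
      exact hint _ ((hu n).sub hUm)
    simp_rw [h2]
    have := ((ENNReal.continuous_pow 2).tendsto 0).comp h1
    simpa [Function.comp_def] using this

/-- Products of sequences that converge in a weighted `L²` space converge in weighted `L¹`. -/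
theorem tendsto_lintegral_enorm_mul_conj_sub {W : α → ℝ≥0∞} (hW : Measurable W)
    {u v : ℕ → α → ℂ} {U V : α → ℂ} (hu : ∀ n, AEStronglyMeasurable (u n) μ)
    (hv : ∀ n, AEStronglyMeasurable (v n) μ) (hU : AEStronglyMeasurable U μ)
    (hV : AEStronglyMeasurable V μ) (hUf : ∫⁻ x, ‖U x‖ₑ ^ 2 * W x ∂μ < ∞)
    (hVf : ∫⁻ x, ‖V x‖ₑ ^ 2 * W x ∂μ < ∞)
    (huU : Tendsto (fun n => ∫⁻ x, ‖u n x - U x‖ₑ ^ 2 * W x ∂μ) atTop (𝓝 0))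
    (hvV : Tendsto (fun n => ∫⁻ x, ‖v n x - V x‖ₑ ^ 2 * W x ∂μ) atTop (𝓝 0)) :
    Tendsto (fun n => ∫⁻ x, ‖u n x * (starRingEnd ℂ) (v n x) - U x * (starRingEnd ℂ) (V x)‖ₑ *
      W x ∂μ) atTop (𝓝 0) := by
  have hpt : ∀ n x, ‖u n x * (starRingEnd ℂ) (v n x) - U x * (starRingEnd ℂ) (V x)‖ₑ * W x ≤
      ‖u n x - U x‖ₑ * ‖v n x - V x‖ₑ * W x + ‖u n x - U x‖ₑ * ‖V x‖ₑ * W x +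
        ‖U x‖ₑ * ‖v n x - V x‖ₑ * W x := by
    intro n x
    rw [← add_mul, ← add_mul]
    gcongr
    have : u n x * (starRingEnd ℂ) (v n x) - U x * (starRingEnd ℂ) (V x) =
        (u n x - U x) * (starRingEnd ℂ) (v n x - V x) + (u n x - U x) * (starRingEnd ℂ) (V x) +
          U x * (starRingEnd ℂ) (v n x - V x) := by
      rw [map_sub]; ring
    rw [this]
    refine (enorm_add_le _ _).trans (add_le_add ((enorm_add_le _ _).trans ?_) ?_)
    · simp only [enorm_mul, RCLike.enorm_conj, le_refl]
    · simp only [enorm_mul, RCLike.enorm_conj, le_refl]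
  have t1 : Tendsto (fun n => ∫⁻ x, ‖u n x - U x‖ₑ * ‖v n x - V x‖ₑ * W x ∂μ) atTop (𝓝 0) := by
    refine tendsto_zero_of_sq_le (fun n => sq_lintegral_mul_mul_le (by fun_prop) (by fun_prop)
      (by fun_prop)) ?_
    simpa using ENNReal.Tendsto.mul huU (Or.inr (by simp)) hvV (Or.inr (by simp))
  have t2 : Tendsto (fun n => ∫⁻ x, ‖u n x - U x‖ₑ * ‖V x‖ₑ * W x ∂μ) atTop (𝓝 0) := by
    refine tendsto_zero_of_sq_le (fun n => sq_lintegral_mul_mul_le (by fun_prop) (by fun_prop)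
      (by fun_prop)) ?_
    simpa using ENNReal.Tendsto.mul_const huU (Or.inr hVf.ne)
  have t3 : Tendsto (fun n => ∫⁻ x, ‖U x‖ₑ * ‖v n x - V x‖ₑ * W x ∂μ) atTop (𝓝 0) := by
    refine tendsto_zero_of_sq_le (fun n => sq_lintegral_mul_mul_le (by fun_prop) (by fun_prop)
      (by fun_prop)) ?_
    simpa using ENNReal.Tendsto.const_mul hvV (Or.inr hUf.ne)
  have t := (t1.add t2).add t3
  simp only [add_zero] at t
  refine tendsto_of_tendsto_of_tendsto_of_le_of_le tendsto_const_nhds t (fun _ => zero_le) ?_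
  intro n
  refine (lintegral_mono (hpt n)).trans (le_of_eq ?_)
  rw [lintegral_add_left' (by fun_prop), lintegral_add_left' (by fun_prop)]

/-- A uniform bound on unit balls gives a bound with respect to a slowly varying weight. -/
theorem lintegral_mul_le_of_ball {E : Type*} [NormedAddCommGroup E] [NormedSpace ℝ E]
    [FiniteDimensional ℝ E] [MeasurableSpace E] [BorelSpace E] (μ : Measure E) [μ.IsAddHaarMeasure]
    {w h : E → ℝ≥0∞} (hw : Measurable w) (hh : Measurable h) {K S : ℝ≥0∞}
    (hK : ∀ p q, p ∈ Metric.ball q 1 → w p ≤ K * w q)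
    (hS : ∀ q, ∫⁻ p in Metric.ball q 1, h p ∂μ ≤ S) :
    ∫⁻ p, h p * w p ∂μ ≤ (μ (Metric.ball 0 1))⁻¹ * (K * ∫⁻ p, w p ∂μ) * S := by
  have hB0 : μ (Metric.ball 0 1) ≠ 0 := (Metric.measure_ball_pos _ _ one_pos).ne'
  have hBt : μ (Metric.ball 0 1) ≠ ∞ := measure_ball_lt_top.ne
  rw [mul_assoc, ← ENNReal.div_eq_inv_mul, ENNReal.le_div_iff_mul_le (Or.inl hB0) (Or.inl hBt)]
  have hmeas : MeasurableSet {z : E × E | z.1 ∈ Metric.ball z.2 1} := by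
    simp only [Metric.mem_ball]
    exact measurableSet_lt (by fun_prop) measurable_const
  have hone : Measurable fun z : E × E => (Metric.ball z.2 1).indicator (fun _ => (1 : ℝ≥0∞)) z.1 :=
    (measurable_const (a := (1 : ℝ≥0∞))).indicator hmeas
  have hind : Measurable fun z : E × E =>
      h z.1 * w z.1 * (Metric.ball z.2 1).indicator (fun _ => 1) z.1 :=
    Measurable.mul (by fun_prop) hone
  -- The volume of the unit ball is written as an integral over the centres `q` within distance one
  -- of `p`; exchanging the integrals makes the inner one local, where `w` is comparable to `w q`.
  calc (∫⁻ p, h p * w p ∂μ) * μ (Metric.ball 0 1)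
      = ∫⁻ p, ∫⁻ q, h p * w p * (Metric.ball q 1).indicator (fun _ => 1) p ∂μ ∂μ := by
        rw [← lintegral_mul_const' _ _ hBt]
        refine lintegral_congr fun p => ?_
        have hone' : Measurable fun q => (Metric.ball q 1).indicator (fun _ => (1 : ℝ≥0∞)) p :=
          hone.comp measurable_prodMk_left
        rw [lintegral_const_mul _ hone']
        congr 1
        have : ∀ q, (Metric.ball q 1).indicator (fun _ => (1 : ℝ≥0∞)) p =
            (Metric.ball p 1).indicator (fun _ => 1) q := fun q => by
          by_cases hp : p ∈ Metric.ball q 1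
          · rw [indicator_of_mem hp, indicator_of_mem (Metric.mem_ball_comm.1 hp)]
          · rw [indicator_of_notMem hp, indicator_of_notMem fun h => hp (Metric.mem_ball_comm.1 h)]
        simp_rw [this]
        rw [lintegral_indicator measurableSet_ball, lintegral_one, Measure.restrict_apply_univ,
          Measure.addHaar_ball_center μ p 1]
    _ = ∫⁻ q, ∫⁻ p in Metric.ball q 1, h p * w p ∂μ ∂μ := by
        rw [lintegral_lintegral_swap hind.aemeasurable]
        refine lintegral_congr fun q => ?_
        rw [← lintegral_indicator measurableSet_ball]
        refine lintegral_congr fun p => ?_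
        by_cases hp : p ∈ Metric.ball q 1
        · rw [indicator_of_mem hp, indicator_of_mem hp, mul_one]
        · rw [indicator_of_notMem hp, indicator_of_notMem hp, mul_zero]
    _ ≤ ∫⁻ q, K * w q * S ∂μ := by
        refine lintegral_mono fun q => ?_
        refine le_trans ?_ (mul_le_mul_right (hS q) _)
        rw [← lintegral_const_mul _ hh]
        refine setLIntegral_mono' measurableSet_ball fun p hp => ?_
        rw [mul_comm]
        gcongr
        exact hK p q hp
    _ = K * (∫⁻ p, w p ∂μ) * S := by
        rw [lintegral_mul_const _ (by fun_prop), lintegral_const_mul _ (by fun_prop)]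

end Weighted

variable {d : ℕ} [NeZero d]

theorem lintegral_decay_lt_top : ∫⁻ p : SpaceTime d, ENNReal.ofReal (decay p) < ∞ := by
  refine lintegral_inv_one_add_norm_pow_lt_top _ ?_
  have h : Module.finrank ℝ (SpaceTime d) = Module.finrank ℝ (ℝ × Space d) :=
    (WithLp.linearEquiv 2 ℝ (ℝ × Space d)).finrank_eq
  rw [h, Module.finrank_prod, finrank_euclideanSpace_fin, Module.finrank_self]
  omega

theorem decay_le_of_mem_ball {p q : SpaceTime d} (h : p ∈ Metric.ball q 1) :
    decay p ≤ 2 ^ (d + 5) * decay q := by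
  have h1 : ‖q‖ ≤ ‖p‖ + 1 := by
    have h2 : ‖q - p‖ < 1 := by rw [Metric.mem_ball, dist_eq_norm] at h; rwa [norm_sub_rev]
    linarith [norm_sub_norm_le q p]
  unfold decay
  rw [← div_eq_mul_inv, inv_eq_one_div, div_le_div_iff₀ (by positivity) (by positivity), one_mul,
    ← mul_pow]
  exact pow_le_pow_left₀ (by positivity) (by linarith [norm_nonneg p]) _

theorem exists_lintegral_mul_decay_le_of_ball : ∃ C : ℝ≥0∞, C < ∞ ∧
    ∀ (h : SpaceTime d → ℝ≥0∞) (S : ℝ≥0∞), Measurable h →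
      (∀ q, ∫⁻ p in Metric.ball q 1, h p ≤ S) → ∫⁻ p, h p * ENNReal.ofReal (decay p) ≤ C * S := by
  refine ⟨(volume (Metric.ball (0 : SpaceTime d) 1))⁻¹ *
    (2 ^ (d + 5) * ∫⁻ p : SpaceTime d, ENNReal.ofReal (decay p)), ?_, fun h S hh hS => ?_⟩
  · exact ENNReal.mul_lt_top (ENNReal.inv_lt_top.2 (Metric.measure_ball_pos _ _ one_pos))
      (ENNReal.mul_lt_top (by simp) lintegral_decay_lt_top)
  · refine lintegral_mul_le_of_ball _ (by fun_prop) hh (fun p q hp => ?_) hS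
    have := ENNReal.ofReal_le_ofReal (decay_le_of_mem_ball hp)
    rwa [ENNReal.ofReal_mul (by positivity), ENNReal.ofReal_pow (by norm_num),
      ENNReal.ofReal_ofNat] at this

theorem exists_lintegral_evolve_mul_decay_le : ∃ C : ℝ≥0∞, C < ∞ ∧ ∀ f : Space d → ℂ,
    Measurable f → Integrable f →
      ∫⁻ p, ‖evolve f p‖ₑ ^ 2 * ENNReal.ofReal (decay p) ≤ C * smoothNorm f := by
  obtain ⟨C₁, hC₁, h₁⟩ := exists_lintegral_ball_evolve_le (d := d)
  obtain ⟨C₂, hC₂, h₂⟩ := exists_lintegral_mul_decay_le_of_ball (d := d)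
  refine ⟨C₂ * C₁, ENNReal.mul_lt_top hC₂ hC₁, fun f hfm hf => ?_⟩
  rw [mul_assoc]
  have hm : StronglyMeasurable (evolve f) := stronglyMeasurable_wave measurable_paraboloid hfm
  exact h₂ _ _ (hm.measurable.enorm.pow_const 2) (h₁ f hfm hf)

end

/-! ### The evolution of data in the weighted space -/

section

variable {d : ℕ} [NeZero d]

/-- Truncation of a function to a ball. -/
def trunc (n : ℕ) (f : Space d → ℂ) : Space d → ℂ := (Metric.closedBall 0 n).indicator f

theorem measurable_trunc (n : ℕ) {f : Space d → ℂ} (hf : Measurable f) : Measurable (trunc n f) :=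
  hf.indicator measurableSet_closedBall

theorem norm_trunc_le (n : ℕ) (f : Space d → ℂ) (x : Space d) : ‖trunc n f x‖ ≤ ‖f x‖ :=
  norm_indicator_le_norm_self _ _

theorem norm_sub_trunc_le (n : ℕ) (f : Space d → ℂ) (x : Space d) : ‖f x - trunc n f x‖ ≤ ‖f x‖ := by
  unfold trunc
  by_cases hx : x ∈ Metric.closedBall (0 : Space d) n
  · rw [indicator_of_mem hx]; simp
  · rw [indicator_of_notMem hx]; simp

theorem norm_trunc_sub_trunc_le {n m : ℕ} (hnm : n ≤ m) (f : Space d → ℂ) (x : Space d) :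
    ‖trunc n f x - trunc m f x‖ ≤ ‖f x - trunc n f x‖ := by
  unfold trunc
  by_cases hx : x ∈ Metric.closedBall (0 : Space d) n
  · have hx' : x ∈ Metric.closedBall (0 : Space d) m :=
      Metric.closedBall_subset_closedBall (Nat.cast_le.2 hnm) hx
    rw [indicator_of_mem hx, indicator_of_mem hx']
  · rw [indicator_of_notMem hx, zero_sub, norm_neg, sub_zero]
    exact norm_indicator_le_norm_self _ _

theorem smoothNorm_mono {f g : Space d → ℂ} (h : ∀ x, ‖f x‖ ≤ ‖g x‖) :
    smoothNorm f ≤ smoothNorm g := by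
  refine lintegral_mono fun x => ?_
  gcongr
  exact enorm_le_iff_norm_le.2 (h x)

theorem tendsto_trunc (f : Space d → ℂ) (x : Space d) :
    Tendsto (fun n => trunc n f x) atTop (𝓝 (f x)) := by
  refine tendsto_const_nhds.congr' ?_
  filter_upwards [eventually_ge_atTop ⌈‖x‖⌉₊] with n hn
  rw [trunc, indicator_of_mem]
  simpa using (Nat.le_ceil _).trans (Nat.cast_le.2 hn)

/-- On the ball the weight is at least `(1 + n)⁻¹`, so `f` is square integrable there, and |f| ≤ 1 +
|f|² on a set of finite measure. -/
theorem integrable_trunc (n : ℕ) {f : Space d → ℂ} (hf : Measurable f) (h : smoothNorm f < ∞) :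
    Integrable (trunc n f) := by
  refine ⟨(measurable_trunc n hf).aestronglyMeasurable, ?_⟩
  rw [hasFiniteIntegral_iff_enorm]
  have hb : ∀ x, ‖trunc n f x‖ₑ ≤ (Metric.closedBall (0 : Space d) n).indicator (fun _ => 1) x +
      ENNReal.ofReal (1 + n) * (‖f x‖ₑ ^ 2 * ENNReal.ofReal (1 + ‖x‖)⁻¹) := by
    intro x
    by_cases hx : x ∈ Metric.closedBall (0 : Space d) n
    · rw [trunc, indicator_of_mem hx, indicator_of_mem hx]
      have hx' : ‖x‖ ≤ n := by simpa using hx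
      have h1 : ‖f x‖ₑ ^ 2 ≤ ENNReal.ofReal (1 + n) * (‖f x‖ₑ ^ 2 * ENNReal.ofReal (1 + ‖x‖)⁻¹) := by
        rw [mul_left_comm, ← ENNReal.ofReal_mul (by positivity)]
        refine le_mul_of_one_le_right' ?_
        rw [← ENNReal.ofReal_one]
        refine ENNReal.ofReal_le_ofReal ?_
        rw [← div_eq_mul_inv, le_div_iff₀ (by positivity)]
        linarith
      refine le_trans ?_ (add_le_add_right h1 _)
      rcases le_total ‖f x‖ₑ 1 with h2 | h2
      · exact h2.trans le_self_add
      · exact (le_self_pow₀ h2 two_ne_zero).trans le_add_self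
    · rw [trunc, indicator_of_notMem hx]
      simp
  refine (lintegral_mono hb).trans_lt ?_
  rw [lintegral_add_left (measurable_const.indicator measurableSet_closedBall),
    lintegral_indicator measurableSet_closedBall, lintegral_one, Measure.restrict_apply_univ,
    lintegral_const_mul' _ _ ENNReal.ofReal_ne_top]
  exact ENNReal.add_lt_top.2 ⟨measure_closedBall_lt_top, ENNReal.mul_lt_top (by simp) h⟩

theorem tendsto_smoothNorm_sub_trunc {f : Space d → ℂ} (hf : Measurable f) (h : smoothNorm f < ∞) :
    Tendsto (fun n => smoothNorm fun x => f x - trunc n f x) atTop (𝓝 0) := by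
  unfold smoothNorm
  have h0 : ∫⁻ x : Space d, (0 : ℝ≥0∞) = 0 := lintegral_zero
  rw [← h0]
  have hm : ∀ n, Measurable fun x => ‖f x - trunc n f x‖ₑ ^ 2 * ENNReal.ofReal (1 + ‖x‖)⁻¹ := by
    intro n
    have := measurable_trunc n hf
    fun_prop
  refine tendsto_lintegral_of_dominated_convergence _ hm
    (fun n => Eventually.of_forall fun x => ?_) h.ne (Eventually.of_forall fun x => ?_)
  · exact mul_le_mul' (pow_le_pow_left' (enorm_le_iff_norm_le.2 (norm_sub_trunc_le n f x)) 2) le_rfl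
  · refine tendsto_const_nhds.congr' ?_
    filter_upwards [eventually_ge_atTop ⌈‖x‖⌉₊] with n hn
    rw [trunc, indicator_of_mem]
    · simp
    · simpa using (Nat.le_ceil _).trans (Nat.cast_le.2 hn)

/-- The function `U` is the limit in a weighted `L²` space of the solutions of the Schrödinger
equation whose initial data have the truncations of `f` as Fourier transforms. -/
structure IsEvolution (f : Space d → ℂ) (U : SpaceTime d → ℂ) : Prop where
  aestronglyMeasurable : AEStronglyMeasurable U
  lintegral_lt_top : ∫⁻ p, ‖U p‖ₑ ^ 2 * ENNReal.ofReal (decay p) < ∞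
  tendsto : Tendsto (fun n => ∫⁻ p, ‖evolve (trunc n f) p - U p‖ₑ ^ 2 * ENNReal.ofReal (decay p))
    atTop (𝓝 0)

theorem IsEvolution.congr {f : Space d → ℂ} {U V : SpaceTime d → ℂ} (h : IsEvolution f U)
    (hUV : U =ᵐ[volume] V) : IsEvolution f V := by
  refine ⟨h.1.congr hUV, ?_, ?_⟩
  · refine lt_of_eq_of_lt (lintegral_congr_ae ?_) h.2
    filter_upwards [hUV] with p hp
    rw [hp]
  · refine h.3.congr fun n => lintegral_congr_ae ?_
    filter_upwards [hUV] with p hp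
    rw [hp]

theorem stronglyMeasurable_evolve {f : Space d → ℂ} (hf : Measurable f) :
    StronglyMeasurable (evolve f) := stronglyMeasurable_wave measurable_paraboloid hf

/-- The truncations are Cauchy for `smoothNorm`; local smoothing transfers this to their evolutions,
and the weighted `L²` space is complete. -/
theorem exists_isEvolution {f : Space d → ℂ} (hf : Measurable f) (h : smoothNorm f < ∞) :
    ∃ U, StronglyMeasurable U ∧ IsEvolution f U := by
  obtain ⟨C, hC, hle⟩ := exists_lintegral_evolve_mul_decay_le (d := d)
  obtain ⟨U, hU, hU1, hU2⟩ := exists_limit_of_weighted_cauchy (μ := (volume : Measure (SpaceTime d)))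
    (W := fun p => ENNReal.ofReal (decay p)) (by fun_prop) (u := fun n => evolve (trunc n f))
    (fun n => stronglyMeasurable_evolve (measurable_trunc n hf))
    (fun n => (hle _ (measurable_trunc n hf) (integrable_trunc n hf h)).trans_lt
      (ENNReal.mul_lt_top hC ((smoothNorm_mono (norm_trunc_le n f)).trans_lt h)))
    (r := fun n => C * smoothNorm fun x => f x - trunc n f x)
    (by simpa using ENNReal.Tendsto.const_mul (tendsto_smoothNorm_sub_trunc hf h) (Or.inr hC.ne))
    (fun n => (ENNReal.mul_lt_top hC ((smoothNorm_mono (norm_sub_trunc_le n f)).trans_lt h)).ne)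
    (fun n m hnm => by
      have hs : ∀ p, evolve (trunc n f) p - evolve (trunc m f) p =
          evolve (fun x => trunc n f x - trunc m f x) p := fun p =>
        (wave_sub measurable_paraboloid (integrable_trunc n hf h) (integrable_trunc m hf h) p).symm
      simp_rw [hs]
      refine (hle _ ((measurable_trunc n hf).sub (measurable_trunc m hf))
        ((integrable_trunc n hf h).sub (integrable_trunc m hf h))).trans ?_
      exact mul_le_mul_right (smoothNorm_mono (norm_trunc_sub_trunc_le hnm f)) _)
  exact ⟨U, hU, hU.aestronglyMeasurable, hU1, hU2⟩

theorem conj_integrable {α : Type*} [MeasurableSpace α] {μ : Measure α} {f : α → ℂ}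
    (hf : Integrable f μ) : Integrable (fun x => (starRingEnd ℂ) (f x)) μ :=
  (RCLike.conjCLE (K := ℂ)).toContinuousLinearMap.integrable_comp hf

@[fun_prop]
theorem measurable_conj_comp {α : Type*} [MeasurableSpace α] {f : α → ℂ} (hf : Measurable f) :
    Measurable fun x => (starRingEnd ℂ) (f x) :=
  (RCLike.continuous_conj (K := ℂ)).measurable.comp hf

theorem integrable_mul_conj_mul_schwartz {f g : Space d → ℂ} (hf : Measurable f) (hg : Measurable g)
    (hfs : smoothNorm f < ∞) (hgs : smoothNorm g < ∞) (φ : 𝓢(SpaceTime d, ℂ)) :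
    Integrable fun z : Space d × Space d => f z.1 * (starRingEnd ℂ) (g z.2) *
      φ (paraboloid z.1 - paraboloid z.2) := by
  obtain ⟨C, hC, h⟩ := exists_lintegral_mul_decay_le (d := d)
  obtain ⟨B, hB, hB'⟩ := exists_norm_le_decay φ
  refine ⟨Measurable.aestronglyMeasurable ?_, ?_⟩
  · have := φ.continuous.measurable
    fun_prop
  rw [hasFiniteIntegral_iff_enorm]
  refine lt_of_le_of_lt (b := ENNReal.ofReal B * (C * (smoothNorm f + smoothNorm g))) ?_
    (ENNReal.mul_lt_top (by simp) (ENNReal.mul_lt_top hC (ENNReal.add_lt_top.2 ⟨hfs, hgs⟩)))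
  refine le_trans ?_ (mul_le_mul_right (h f g hf hg) _)
  rw [← lintegral_const_mul' _ _ ENNReal.ofReal_ne_top]
  refine lintegral_mono fun z => ?_
  rw [enorm_mul, enorm_mul, RCLike.enorm_conj, mul_left_comm, ← ENNReal.ofReal_mul hB.le]
  gcongr
  rw [← ofReal_norm]
  exact ENNReal.ofReal_le_ofReal (hB' _)

theorem lintegral_mul_conj_decay_lt_top {f g : Space d → ℂ} {U V : SpaceTime d → ℂ}
    (hU : IsEvolution f U) (hV : IsEvolution g V) :
    ∫⁻ p, ‖U p * (starRingEnd ℂ) (V p)‖ₑ * ENNReal.ofReal (decay p) < ∞ := by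
  have h1 := hU.1
  have h2 := hV.1
  have h := sq_lintegral_mul_mul_le (W := fun p : SpaceTime d => ENNReal.ofReal (decay p))
    h1.enorm h2.enorm (by fun_prop)
  have h3 := h.trans_lt (ENNReal.mul_lt_top hU.2 hV.2)
  simp_rw [enorm_mul, RCLike.enorm_conj]
  by_contra h4
  rw [not_lt, top_le_iff] at h4
  rw [h4] at h3
  simp at h3

theorem integrable_schwartz_mul_of_decay {F : SpaceTime d → ℂ} (hF : AEStronglyMeasurable F)
    (h : ∫⁻ p, ‖F p‖ₑ * ENNReal.ofReal (decay p) < ∞) (φ : 𝓢(SpaceTime d, ℂ)) :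
    Integrable fun p => φ p * F p := by
  obtain ⟨B, hB, hB'⟩ := exists_norm_le_decay φ
  refine ⟨φ.continuous.aestronglyMeasurable.mul hF, ?_⟩
  rw [hasFiniteIntegral_iff_enorm]
  refine lt_of_le_of_lt ?_ (ENNReal.mul_lt_top (ENNReal.ofReal_lt_top (r := B)) h)
  rw [← lintegral_const_mul' _ _ ENNReal.ofReal_ne_top]
  refine lintegral_mono fun z => ?_
  rw [enorm_mul, mul_left_comm, ← ENNReal.ofReal_mul hB.le, mul_comm]
  gcongr
  rw [← ofReal_norm]
  exact ENNReal.ofReal_le_ofReal (hB' _)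

/-- The product of a solution and the conjugate of a solution, tested against a Schwartz
function. -/
theorem integral_schwartz_mul_evolution {f g : Space d → ℂ} (hf : Measurable f) (hg : Measurable g)
    (hfs : smoothNorm f < ∞) (hgs : smoothNorm g < ∞) {U V : SpaceTime d → ℂ}
    (hU : IsEvolution f U) (hV : IsEvolution g V) (φ : 𝓢(SpaceTime d, ℂ)) :
    ∫ p, φ p * (U p * (starRingEnd ℂ) (V p)) =
      ∫ z : Space d × Space d, f z.1 * (starRingEnd ℂ) (g z.2) *
        (𝓕⁻ φ) (paraboloid z.1 - paraboloid z.2) := by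
  have hmf := fun n => measurable_trunc n hf
  have hmg := fun n => measurable_trunc n hg
  have hif := fun n => integrable_trunc n hf hfs
  have hig := fun n => integrable_trunc n hg hgs
  have key : ∀ n, ∫ p, φ p * (evolve (trunc n f) p * (starRingEnd ℂ) (evolve (trunc n g) p)) =
      ∫ z : Space d × Space d, trunc n f z.1 * (starRingEnd ℂ) (trunc n g z.2) *
        (𝓕⁻ φ) (paraboloid z.1 - paraboloid z.2) := fun n => by
    simp_rw [evolve, wave_mul_conj]
    refine integral_mul_wave (by fun_prop) ?_ ((hif n).mul_prod (conj_integrable (hig n))) φ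
    have h1 := hmf n
    have h2 := hmg n
    fun_prop
  have hUV : AEStronglyMeasurable (fun p => U p * (starRingEnd ℂ) (V p)) :=
    hU.1.mul (RCLike.continuous_conj.comp_aestronglyMeasurable hV.1)
  have hint := integrable_schwartz_mul_of_decay hUV (lintegral_mul_conj_decay_lt_top hU hV) φ
  obtain ⟨B, hB, hB'⟩ := exists_norm_le_decay φ
  -- Space-time side: weighted `L²` convergence of both factors gives weighted `L¹` convergence of
  -- the product.
  have lim1 : Tendsto (fun n => ∫ p, φ p * (evolve (trunc n f) p *
      (starRingEnd ℂ) (evolve (trunc n g) p))) atTop (𝓝 (∫ p, φ p * (U p * (starRingEnd ℂ) (V p)))) := by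
    refine tendsto_integral_of_L1 _ hint.aestronglyMeasurable (Eventually.of_forall fun n => ?_) ?_
    · refine (φ.integrable).mul_bdd (c := (∫ x, ‖trunc n f x‖) * ∫ x, ‖trunc n g x‖) ?_ ?_
      · exact ((stronglyMeasurable_evolve (hmf n)).mul
          (RCLike.continuous_conj.comp_stronglyMeasurable
            (stronglyMeasurable_evolve (hmg n)))).aestronglyMeasurable
      · refine Eventually.of_forall fun p => ?_
        rw [norm_mul, RCLike.norm_conj]
        exact mul_le_mul (norm_wave_le _ _ _) (norm_wave_le _ _ _) (norm_nonneg _)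
          (integral_nonneg fun _ => norm_nonneg _)
    · have t := tendsto_lintegral_enorm_mul_conj_sub (μ := (volume : Measure (SpaceTime d)))
        (W := fun p => ENNReal.ofReal (decay p)) (by fun_prop)
        (fun n => (stronglyMeasurable_evolve (hmf n)).aestronglyMeasurable)
        (fun n => (stronglyMeasurable_evolve (hmg n)).aestronglyMeasurable)
        hU.1 hV.1 hU.2 hV.2 hU.3 hV.3
      have t' := ENNReal.Tendsto.const_mul (a := ENNReal.ofReal B) t (Or.inr ENNReal.ofReal_ne_top)
      rw [mul_zero] at t'
      refine tendsto_of_tendsto_of_tendsto_of_le_of_le tendsto_const_nhds t' (fun _ => zero_le) ?_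
      intro n
      simp only
      rw [← lintegral_const_mul' _ _ ENNReal.ofReal_ne_top]
      refine lintegral_mono fun p => ?_
      rw [← mul_sub, enorm_mul, mul_left_comm, ← ENNReal.ofReal_mul hB.le, mul_comm]
      gcongr
      rw [← ofReal_norm]
      exact ENNReal.ofReal_le_ofReal (hB' _)
  -- Frequency side: dominated convergence, with the untruncated integrand as majorant.
  have lim2 : Tendsto (fun n => ∫ z : Space d × Space d,
      trunc n f z.1 * (starRingEnd ℂ) (trunc n g z.2) * (𝓕⁻ φ) (paraboloid z.1 - paraboloid z.2))
      atTop (𝓝 (∫ z : Space d × Space d, f z.1 * (starRingEnd ℂ) (g z.2) *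
        (𝓕⁻ φ) (paraboloid z.1 - paraboloid z.2))) := by
    refine tendsto_integral_of_dominated_convergence _ (fun n => ?_)
      (integrable_mul_conj_mul_schwartz hf hg hfs hgs (𝓕⁻ φ)).norm
      (fun n => Eventually.of_forall fun z => ?_) (Eventually.of_forall fun z => ?_)
    · have h1 := hmf n
      have h2 := hmg n
      have := (𝓕⁻ φ).continuous.measurable
      exact Measurable.aestronglyMeasurable (by fun_prop)
    · simp only [norm_mul, RCLike.norm_conj]
      gcongr
      · exact norm_trunc_le _ _ _
      · exact norm_trunc_le _ _ _
    · refine Tendsto.mul_const _ ((tendsto_trunc f z.1).mul ?_)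
      exact (RCLike.continuous_conj.tendsto _).comp (tendsto_trunc g z.2)
  simp_rw [key] at lim1
  exact tendsto_nhds_unique lim1 lim2

end

/-! ### Time slices of the evolution -/

section

variable {d : ℕ} [NeZero d]

theorem lintegral_spaceTime {h : SpaceTime d → ℝ≥0∞} (hh : AEMeasurable h) :
    ∫⁻ p, h p = ∫⁻ t : ℝ, ∫⁻ x : Space d, h (WithLp.toLp 2 (t, x)) := by
  have hp : MeasurePreserving (WithLp.toLp 2 : ℝ × Space d → SpaceTime d) :=
    WithLp.volume_preserving_toLp ..
  rw [← hp.lintegral_comp_emb (MeasurableEquiv.toLp 2 (ℝ × Space d)).measurableEmbedding h,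
    Measure.volume_eq_prod, lintegral_prod]
  exact hh.comp_quasiMeasurePreserving hp.quasiMeasurePreserving

theorem ae_spaceTime_of_slices {P : SpaceTime d → Prop} (hP : NullMeasurableSet {p | P p})
    (h : ∀ᵐ t : ℝ, ∀ᵐ x : Space d, P (WithLp.toLp 2 (t, x))) : ∀ᵐ p, P p := by
  have h1 : ∫⁻ p, {p | P p}ᶜ.indicator (fun _ => (1 : ℝ≥0∞)) p = 0 := by
    rw [lintegral_spaceTime (aemeasurable_const.indicator₀ hP.compl)]
    rw [lintegral_eq_zero_of_ae_eq_zero]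
    filter_upwards [h] with t ht
    rw [Pi.zero_apply, lintegral_eq_zero_of_ae_eq_zero]
    filter_upwards [ht] with x hx
    rw [indicator_of_notMem (by simpa using hx)]; rfl
  rw [lintegral_indicator_const₀ hP.compl, one_mul] at h1
  exact h1

theorem schrodingerSymbol_eq (t : ℝ) (ζ : Space d) :
    schrodingerSymbol d t ζ = character (t * -(2 * Real.pi * ‖ζ‖ ^ 2)) := by
  rw [schrodingerSymbol, character_eq]
  congr 1
  push_cast
  ring

theorem evolve_toLp (f : Space d → ℂ) (t : ℝ) (x : Space d) :
    evolve f (WithLp.toLp 2 (t, x)) =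
      wave volume id (fun ζ => schrodingerSymbol d t ζ * f ζ) x := by
  unfold evolve wave
  congr 1; funext ζ
  simp only [schrodingerSymbol_eq, ← mul_assoc, ← character_add]
  congr 2
  simp only [paraboloid, WithLp.prod_inner_apply, id]
  simp
  ring

theorem continuous_schrodingerSymbol (t : ℝ) : Continuous (schrodingerSymbol d t) := by
  unfold schrodingerSymbol
  fun_prop

theorem norm_schrodingerSymbol (t : ℝ) (ζ : Space d) : ‖schrodingerSymbol d t ζ‖ = 1 := by
  rw [schrodingerSymbol_eq, norm_character]

theorem integral_schwartz_mul_evolve_slice {f : Space d → ℂ} (hfm : Measurable f)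
    (hf : Integrable f) (t : ℝ) (φ : 𝓢(Space d, ℂ)) :
    ∫ x, φ x * evolve f (WithLp.toLp 2 (t, x)) =
      ∫ ζ, schrodingerSymbol d t ζ * f ζ * (𝓕⁻ φ) ζ := by
  simp_rw [evolve_toLp]
  have h1 := (continuous_schrodingerSymbol (d := d) t)
  refine integral_mul_wave (Γ := id) measurable_id (h1.measurable.mul hfm) ?_ φ
  exact hf.bdd_mul (c := 1) h1.aestronglyMeasurable
    (Eventually.of_forall fun x => (norm_schrodingerSymbol t x).le)

/-- On a fixed slice `decay` decreases only polynomially, so |φ|² divided by it is still integrable.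
This is the second factor in the Cauchy-Schwarz inequality on slices. -/
theorem lintegral_schwartz_sq_div_decay_lt_top (t : ℝ) (φ : 𝓢(Space d, ℂ)) :
    ∫⁻ x, (‖φ x‖ₑ * (ENNReal.ofReal (decay (WithLp.toLp 2 (t, x))))⁻¹) ^ 2 *
      ENNReal.ofReal (decay (WithLp.toLp 2 (t, x))) < ∞ := by
  obtain ⟨B, hB, hB'⟩ := exists_norm_le_inv_pow φ (d + 5)
  have hfin : ∫⁻ x : Space d, ENNReal.ofReal ((1 + ‖x‖) ^ (d + 5))⁻¹ < ∞ :=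
    lintegral_inv_one_add_norm_pow_lt_top _ (by rw [finrank_euclideanSpace_fin]; omega)
  refine lt_of_le_of_lt ?_ (ENNReal.mul_lt_top
    (ENNReal.ofReal_lt_top (r := B ^ 2 * (1 + |t|) ^ (d + 5))) hfin)
  rw [← lintegral_const_mul' _ _ ENNReal.ofReal_ne_top]
  refine lintegral_mono fun x => ?_
  have hd := decay_pos (WithLp.toLp 2 (t, x) : SpaceTime d)
  rw [← ENNReal.ofReal_inv_of_pos hd, ← ofReal_norm, ← ENNReal.ofReal_mul (norm_nonneg _),
    ← ENNReal.ofReal_pow (by positivity), ← ENNReal.ofReal_mul (by positivity),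
    ← ENNReal.ofReal_mul (by positivity)]
  refine ENNReal.ofReal_le_ofReal ?_
  have h1 : ‖(WithLp.toLp 2 (t, x) : SpaceTime d)‖ ≤ |t| + ‖x‖ := by
    rw [WithLp.prod_norm_eq_of_L2]
    refine Real.sqrt_le_iff.2 ⟨by positivity, ?_⟩
    simp only [Real.norm_eq_abs, WithLp.toLp_fst, WithLp.toLp_snd]
    nlinarith [abs_nonneg t, norm_nonneg x]
  have h2 : (decay (WithLp.toLp 2 (t, x) : SpaceTime d))⁻¹ ≤
      (1 + |t|) ^ (d + 5) * (1 + ‖x‖) ^ (d + 5) := by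
    unfold decay
    rw [inv_inv, ← mul_pow]
    refine pow_le_pow_left₀ (by positivity) ?_ _
    nlinarith [abs_nonneg t, norm_nonneg x, mul_nonneg (abs_nonneg t) (norm_nonneg x)]
  calc (‖φ x‖ * (decay (WithLp.toLp 2 (t, x) : SpaceTime d))⁻¹) ^ 2 *
      decay (WithLp.toLp 2 (t, x) : SpaceTime d)
      = ‖φ x‖ ^ 2 * (decay (WithLp.toLp 2 (t, x) : SpaceTime d))⁻¹ := by field_simp
    _ ≤ (B * ((1 + ‖x‖) ^ (d + 5))⁻¹) ^ 2 * ((1 + |t|) ^ (d + 5) * (1 + ‖x‖) ^ (d + 5)) := by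
      gcongr
      exact hB' x
    _ = _ := by field_simp

/-- Convergence in the space-time norm need not give convergence on a given slice. Along a
subsequence with summable errors almost every slice converges, and there the identity for the
truncated data passes to the limit, with one exceptional null set of times for all `φ`. -/
theorem IsEvolution.slices {f : Space d → ℂ} (hf : Measurable f) (hfs : smoothNorm f < ∞)
    (hft : ∀ φ : 𝓢(Space d, ℂ), Integrable fun x => φ x * f x)
    {U : SpaceTime d → ℂ} (hUm : StronglyMeasurable U) (hU : IsEvolution f U) :
    ∀ᵐ t : ℝ, ∀ φ : 𝓢(Space d, ℂ), Integrable (fun x => φ x * U (WithLp.toLp 2 (t, x))) ∧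
      ∫ x, φ x * U (WithLp.toLp 2 (t, x)) = ∫ ζ, schrodingerSymbol d t ζ * f ζ * (𝓕⁻ φ) ζ := by
  have hmf := fun n => measurable_trunc n hf
  have hme := fun n => stronglyMeasurable_evolve (hmf n)
  obtain ⟨k, hkm, hk⟩ := extraction_forall_of_eventually' (P := fun n m =>
    ∫⁻ p, ‖evolve (trunc m f) p - U p‖ₑ ^ 2 * ENNReal.ofReal (decay p) ≤ 2⁻¹ ^ n)
    (fun n => by
      have := hU.3.eventually_le_const (u := (2⁻¹ : ℝ≥0∞) ^ n)
        (pos_iff_ne_zero.2 (by simp))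
      obtain ⟨N, hN⟩ := eventually_atTop.1 this
      exact ⟨N, hN⟩)
  set A : ℕ → ℝ → ℝ≥0∞ := fun n t => ∫⁻ x : Space d,
    ‖evolve (trunc (k n) f) (WithLp.toLp 2 (t, x)) - U (WithLp.toLp 2 (t, x))‖ₑ ^ 2 *
      ENNReal.ofReal (decay (WithLp.toLp 2 (t, x))) with hA
  have hmeas : ∀ n, Measurable fun p =>
      ‖evolve (trunc (k n) f) p - U p‖ₑ ^ 2 * ENNReal.ofReal (decay p) := fun n => by
    have h1 := (hme (k n)).measurable
    have h2 := hUm.measurable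
    fun_prop
  have htoLp : Measurable (WithLp.toLp 2 : ℝ × Space d → SpaceTime d) := WithLp.measurable_toLp 2 _
  have hAm : ∀ n, Measurable (A n) := fun n =>
    ((hmeas n).comp htoLp).lintegral_prod_right'
  have hAint : ∀ n, ∫⁻ t, A n t ≤ 2⁻¹ ^ n := fun n => by
    rw [← lintegral_spaceTime (hmeas n).aemeasurable]
    exact hk n
  have hsum : ∫⁻ t, ∑' n, A n t ≠ ∞ := by
    rw [lintegral_tsum fun n => (hAm n).aemeasurable]
    refine ((ENNReal.tsum_le_tsum hAint).trans_lt ?_).ne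
    rw [ENNReal.tsum_geometric]
    simp
  have hUmeas : Measurable fun p => ‖U p‖ₑ ^ 2 * ENNReal.ofReal (decay p) := by
    have h2 := hUm.measurable
    fun_prop
  have hUfin : ∀ᵐ t : ℝ, ∫⁻ x : Space d, ‖U (WithLp.toLp 2 (t, x))‖ₑ ^ 2 *
      ENNReal.ofReal (decay (WithLp.toLp 2 (t, x))) < ∞ := by
    refine ae_lt_top ((hUmeas.comp htoLp).lintegral_prod_right') ?_
    have := hU.2
    rw [lintegral_spaceTime hUmeas.aemeasurable] at this
    exact this.ne
  filter_upwards [ae_lt_top (Measurable.tsum hAm) hsum, hUfin] with t ht hUt φ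
  have hAt : Tendsto (fun n => A n t) atTop (𝓝 0) := ENNReal.tendsto_atTop_zero_of_tsum_ne_top ht.ne
  have hslice : Measurable fun x : Space d => (WithLp.toLp 2 (t, x) : SpaceTime d) :=
    htoLp.comp measurable_prodMk_left
  have hw : Measurable fun x : Space d => ENNReal.ofReal (decay (WithLp.toLp 2 (t, x))) :=
    ENNReal.measurable_ofReal.comp (measurable_decay.comp hslice)
  have hUs : Measurable fun x : Space d => U (WithLp.toLp 2 (t, x)) := hUm.measurable.comp hslice
  have hes : ∀ n, Measurable fun x : Space d => evolve (trunc (k n) f) (WithLp.toLp 2 (t, x)) :=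
    fun n => (hme (k n)).measurable.comp hslice
  have hφ := φ.continuous.measurable
  have hcs : ∀ G : Space d → ℂ, Measurable G → (∫⁻ x, ‖φ x * G x‖ₑ) ^ 2 ≤
      (∫⁻ x, (‖φ x‖ₑ * (ENNReal.ofReal (decay (WithLp.toLp 2 (t, x))))⁻¹) ^ 2 *
        ENNReal.ofReal (decay (WithLp.toLp 2 (t, x)))) *
      ∫⁻ x, ‖G x‖ₑ ^ 2 * ENNReal.ofReal (decay (WithLp.toLp 2 (t, x))) := by
    intro G hG
    refine le_trans (le_of_eq ?_) (sq_lintegral_mul_mul_le (by fun_prop) (by fun_prop) (by fun_prop))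
    congr 1
    refine lintegral_congr fun x => ?_
    have h0 : ENNReal.ofReal (decay (WithLp.toLp 2 (t, x) : SpaceTime d)) ≠ 0 := by
      rw [Ne, ENNReal.ofReal_eq_zero, not_le]; exact decay_pos _
    rw [enorm_mul, mul_right_comm, mul_assoc ‖φ x‖ₑ,
      ENNReal.inv_mul_cancel h0 ENNReal.ofReal_ne_top, mul_one]
  have hφw := lintegral_schwartz_sq_div_decay_lt_top t φ
  have hint : Integrable fun x => φ x * U (WithLp.toLp 2 (t, x)) := by
    refine ⟨(hφ.mul hUs).aestronglyMeasurable, ?_⟩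
    rw [hasFiniteIntegral_iff_enorm]
    have h1 := (hcs _ hUs).trans_lt (ENNReal.mul_lt_top hφw hUt)
    by_contra h4
    rw [not_lt, top_le_iff] at h4
    rw [h4] at h1
    simp at h1
  refine ⟨hint, ?_⟩
  have lim1 : Tendsto (fun n => ∫ x, φ x * evolve (trunc (k n) f) (WithLp.toLp 2 (t, x))) atTop
      (𝓝 (∫ x, φ x * U (WithLp.toLp 2 (t, x)))) := by
    refine tendsto_integral_of_L1 _ hint.aestronglyMeasurable (Eventually.of_forall fun n => ?_) ?_
    · exact φ.integrable.mul_bdd (c := ∫ x, ‖trunc (k n) f x‖) (hes n).aestronglyMeasurable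
        (Eventually.of_forall fun x => norm_wave_le _ _ _)
    · simp_rw [← mul_sub]
      refine tendsto_zero_of_sq_le (fun n => hcs _ ((hes n).sub hUs)) ?_
      simpa using ENNReal.Tendsto.const_mul hAt (Or.inr hφw.ne)
  have lim2 : Tendsto (fun n => ∫ ζ, schrodingerSymbol d t ζ * trunc (k n) f ζ * (𝓕⁻ φ) ζ) atTop
      (𝓝 (∫ ζ, schrodingerSymbol d t ζ * f ζ * (𝓕⁻ φ) ζ)) := by
    have hfi : Integrable fun ζ => ‖(𝓕⁻ φ) ζ * f ζ‖ := (hft (𝓕⁻ φ)).norm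
    refine tendsto_integral_of_dominated_convergence _ (fun n => ?_) hfi
      (fun n => Eventually.of_forall fun ζ => ?_) (Eventually.of_forall fun ζ => ?_)
    · have h1 := (continuous_schrodingerSymbol (d := d) t).measurable
      have h2 := hmf (k n)
      have h3 := (𝓕⁻ φ).continuous.measurable
      exact Measurable.aestronglyMeasurable (by fun_prop)
    · rw [norm_mul, norm_mul, norm_schrodingerSymbol, one_mul, norm_mul, mul_comm]
      gcongr
      exact norm_trunc_le _ _ _
    · exact (((tendsto_trunc f ζ).comp hkm.tendsto_atTop).const_mul _).mul_const _
  simp_rw [integral_schwartz_mul_evolve_slice (hmf _) (integrable_trunc _ hf hfs)] at lim1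
  exact tendsto_nhds_unique lim1 lim2

end

/-! ### Functions as distributions, uniqueness of solutions, and the norm of the fractional
Laplacian -/

section

section Functions

variable {E : Type*} [NormedAddCommGroup E] [InnerProductSpace ℝ E] [FiniteDimensional ℝ E]
  [MeasurableSpace E] [BorelSpace E] {S T : 𝓢'(E, ℂ)} {f g : E → ℂ}

theorem IsFunction.congr (h : IsFunction T f) (hfg : f =ᵐ[volume] g) : IsFunction T g := by
  intro φ
  have h1 : (fun x => φ x * f x) =ᵐ[volume] fun x => φ x * g x := by
    filter_upwards [hfg] with x hx
    rw [hx]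
  exact ⟨(h φ).1.congr h1, (h φ).2.trans (integral_congr_ae h1)⟩

theorem IsFunction.distribution_eq (hS : IsFunction S f) (hT : IsFunction T f) : S = T := by
  ext φ
  rw [(hS φ).2, (hT φ).2]

theorem IsFunction.locallyIntegrable (h : IsFunction T f) : LocallyIntegrable f := by
  intro x
  let χ : ContDiffBump x := ⟨1, 2, one_pos, one_lt_two⟩
  have h1 : HasCompactSupport fun p => (χ p : ℂ) :=
    χ.hasCompactSupport.comp_left (g := fun x : ℝ => (x : ℂ)) (by simp)
  let φ : 𝓢(E, ℂ) := h1.toSchwartzMap (Complex.ofRealCLM.contDiff.comp χ.contDiff)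
  refine ⟨Metric.closedBall x 1, Metric.closedBall_mem_nhds x one_pos, ?_⟩
  refine ((h φ).1.integrableOn (s := Metric.closedBall x 1)).congr_fun (fun y hy => ?_)
    measurableSet_closedBall
  have h2 : φ y = 1 := by
    change ((χ y : ℝ) : ℂ) = 1
    rw [χ.one_of_mem_closedBall hy, Complex.ofReal_one]
  simp only [h2, one_mul]

theorem IsFunction.ae_eq (hf : IsFunction T f) (hg : IsFunction T g) : f =ᵐ[volume] g := by
  refine ae_eq_of_integral_contDiff_smul_eq hf.locallyIntegrable hg.locallyIntegrable
    fun χ hχ hχc => ?_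
  have h1 : HasCompactSupport fun p => (χ p : ℂ) :=
    hχc.comp_left (g := fun x : ℝ => (x : ℂ)) (by simp)
  let φ : 𝓢(E, ℂ) := h1.toSchwartzMap (Complex.ofRealCLM.contDiff.comp hχ)
  have h2 := (hf φ).2.symm.trans (hg φ).2
  simp only [Complex.real_smul]
  exact h2

theorem isFunction_toTemperedDistribution {p : ℝ≥0∞} [Fact (1 ≤ p)] (h : Lp ℂ p (volume : Measure E)) :
    IsFunction (h : 𝓢'(E, ℂ)) h := by
  intro φ
  refine ⟨?_, by simp [Lp.toTemperedDistribution_apply]⟩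
  have hp := ENNReal.HolderConjugate.inv_one_sub_inv' (Fact.out : 1 ≤ p)
  exact (Lp.memLp h).integrable_mul (φ.memLp (1 - p⁻¹)⁻¹) |>.congr
    (Eventually.of_forall fun x => mul_comm _ _)

theorem isFunction_zero : IsFunction (0 : 𝓢'(E, ℂ)) 0 := fun φ => by simp

theorem eq_of_fourier_eq (h : 𝓕 S = 𝓕 T) : S = T := by
  ext φ
  have h1 := DFunLike.congr_fun h (𝓕⁻ φ)
  rwa [TemperedDistribution.fourier_apply, TemperedDistribution.fourier_apply,
    FourierTransform.fourier_fourierInv_eq] at h1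

theorem IsFunction.eq_zero (h : IsFunction T f) (hf : f =ᵐ[volume] 0) : T = 0 :=
  (h.congr hf).distribution_eq isFunction_zero

/-- Functions that are integrable against a power weight are tempered distributions. -/
theorem exists_isFunction_of_integrable_inv_pow (k : ℕ) {F : E → ℂ}
    (hF : Integrable fun x => (((1 + ‖x‖ ^ 2) ^ k : ℝ) : ℂ)⁻¹ * F x) :
    ∃ T : 𝓢'(E, ℂ), IsFunction T F := by
  set w : E → ℂ := fun x => (((1 + ‖x‖ ^ 2) ^ k : ℝ) : ℂ) with hw
  have hwt : w.HasTemperateGrowth := by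
    have : (fun x : E => (1 + ‖x‖ ^ 2) ^ k).HasTemperateGrowth := by fun_prop
    exact Function.Complex.hasTemperateGrowth_ofReal.comp this
  have hm : MemLp (fun x => (w x)⁻¹ * F x) 1 := memLp_one_iff_integrable.2 hF
  refine ⟨TemperedDistribution.smulLeftCLM ℂ w (hm.toLp : Lp ℂ 1 (volume : Measure E)), fun φ => ?_⟩
  have h1 := isFunction_toTemperedDistribution hm.toLp (SchwartzMap.smulLeftCLM ℂ w φ)
  have h2 : (fun x => SchwartzMap.smulLeftCLM ℂ w φ x * (hm.toLp : Lp ℂ 1 (volume : Measure E)) x) =ᵐ[volume]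
      fun x => φ x * F x := by
    filter_upwards [hm.coeFn_toLp] with x hx
    have h0 : w x ≠ 0 := by
      have : (0 : ℝ) < (1 + ‖x‖ ^ 2) ^ k := by positivity
      exact Complex.ofReal_ne_zero.2 this.ne'
    rw [hx, SchwartzMap.smulLeftCLM_apply_apply hwt, smul_eq_mul]
    field_simp
  refine ⟨h1.1.congr h2, ?_⟩
  rw [TemperedDistribution.smulLeftCLM_apply_apply, h1.2]
  exact integral_congr_ae h2

end Functions

variable {d : ℕ} [NeZero d]

theorem exists_isFunction_of_decay {F : SpaceTime d → ℂ} (hF : AEStronglyMeasurable F)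
    (h : ∫⁻ p, ‖F p‖ₑ * ENNReal.ofReal (decay p) < ∞) : ∃ T : 𝓢'(SpaceTime d, ℂ), IsFunction T F := by
  refine exists_isFunction_of_integrable_inv_pow (d + 5) ⟨?_, ?_⟩
  · refine AEStronglyMeasurable.mul (Measurable.aestronglyMeasurable ?_) hF
    fun_prop
  rw [hasFiniteIntegral_iff_enorm]
  refine lt_of_le_of_lt ?_ (ENNReal.mul_lt_top (a := ENNReal.ofReal (2 ^ (d + 5)))
    ENNReal.ofReal_lt_top h)
  rw [← lintegral_const_mul' _ _ ENNReal.ofReal_ne_top]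
  refine lintegral_mono fun p => ?_
  rw [enorm_mul, mul_left_comm, ← ENNReal.ofReal_mul (by positivity), mul_comm]
  gcongr
  rw [← ofReal_norm]
  refine ENNReal.ofReal_le_ofReal ?_
  rw [norm_inv, Complex.norm_of_nonneg (by positivity), decay, ← div_eq_mul_inv, inv_eq_one_div,
    div_le_div_iff₀ (by positivity) (by positivity), one_mul, ← mul_pow]
  refine pow_le_pow_left₀ (by positivity) ?_ _
  nlinarith [norm_nonneg p, sq_nonneg (‖p‖ - 1)]

theorem propagator_apply {u₀ : 𝓢'(Space d, ℂ)} {f : Space d → ℂ} (hf : IsFunction (𝓕 u₀) f) (t : ℝ)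
    (φ : 𝓢(Space d, ℂ)) :
    propagator d t u₀ φ = ∫ ζ, schrodingerSymbol d t ζ * f ζ * (𝓕⁻ φ) ζ := by
  rw [propagator, TemperedDistribution.fourierMultiplierCLM_apply_apply,
    ← TemperedDistribution.fourier_apply, (hf _).2]
  congr 1; funext ζ
  rw [SchwartzMap.smulLeftCLM_apply_apply (schrodingerSymbol_hasTemperateGrowth d t), smul_eq_mul]
  ring

theorem IsSolution.ae_eq {u₀ : 𝓢'(Space d, ℂ)} {u v : SpaceTime d → ℂ} (hu : IsSolution u₀ u)
    (hv : IsSolution u₀ v) : u =ᵐ[volume] v := by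
  refine ae_spaceTime_of_slices (P := fun p => u p = v p)
    (nullMeasurableSet_eq_fun hu.1.aemeasurable hv.1.aemeasurable) ?_
  filter_upwards [hu.2, hv.2] with t h1 h2
  exact h1.ae_eq h2

theorem exists_solution {u₀ : 𝓢'(Space d, ℂ)} {f : Space d → ℂ} (hfm : Measurable f)
    (hf : IsFunction (𝓕 u₀) f) (hfs : smoothNorm f < ∞) :
    ∃ U, IsSolution u₀ U ∧ IsEvolution f U := by
  obtain ⟨U, hUm, hU⟩ := exists_isEvolution hfm hfs
  refine ⟨U, ⟨hU.1, ?_⟩, hU⟩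
  filter_upwards [hU.slices hfm hfs (fun φ => (hf φ).1) hUm] with t ht φ
  exact ⟨(ht φ).1, (propagator_apply hf t φ).trans (ht φ).2.symm⟩

/-- Two solutions agree on almost every slice, so an arbitrary solution is the constructed one up to
a null set and inherits its approximation by truncated data. -/
theorem IsSolution.isEvolution {u₀ : 𝓢'(Space d, ℂ)} {f : Space d → ℂ} (hfm : Measurable f)
    (hf : IsFunction (𝓕 u₀) f) (hfs : smoothNorm f < ∞) {u : SpaceTime d → ℂ}
    (hu : IsSolution u₀ u) : IsEvolution f u := by
  obtain ⟨U, h1, h2⟩ := exists_solution hfm hf hfs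
  exact h2.congr (h1.ae_eq hu)

theorem isSolution_zero : IsSolution (0 : 𝓢'(Space d, ℂ)) 0 :=
  ⟨aestronglyMeasurable_const, Eventually.of_forall fun t => by
    rw [map_zero]; exact isFunction_zero⟩

/-- The multiplier of `(-Δ)^σ` in Mathlib's normalisation of the Fourier transform. -/
def laplacianSymbol (d : ℕ) (σ : ℝ) (p : SpaceTime d) : ℂ :=
  ((‖((2 * Real.pi) • p).snd‖ ^ (2 * σ) : ℝ) : ℂ)

/-- Plancherel provides an `L²` function with the required transform. Injectivity of the Fourier
transform makes every competitor agree with it almost everywhere, so the infimum has only one value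
to range over. -/
theorem fracLaplacianNorm_eq {σ : ℝ} {T : 𝓢'(SpaceTime d, ℂ)} {F G : SpaceTime d → ℂ}
    (hT : IsFunction T F) (hG : IsFunction (𝓕 T) G)
    (hm : MemLp (fun p => laplacianSymbol d σ p * G p) 2) :
    fracLaplacianNorm σ F = eLpNorm (fun p => laplacianSymbol d σ p * G p) 2 := by
  set h : Lp ℂ 2 (volume : Measure (SpaceTime d)) := hm.toLp with hh
  set w : Lp ℂ 2 (volume : Measure (SpaceTime d)) := 𝓕⁻ h with hw
  have hnorm : eLpNorm w 2 volume = eLpNorm (fun p => laplacianSymbol d σ p * G p) 2 := by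
    have h1 : ‖w‖ = ‖h‖ := by
      rw [← Lp.norm_fourier_eq w, hw, FourierTransform.fourier_fourierInv_eq]
    rw [Lp.norm_def, Lp.norm_def, ENNReal.toReal_eq_toReal_iff' (Lp.eLpNorm_ne_top _)
      (Lp.eLpNorm_ne_top _)] at h1
    rw [h1]
    exact eLpNorm_congr_ae hm.coeFn_toLp
  have hFS : 𝓕 (w : 𝓢'(SpaceTime d, ℂ)) = (h : 𝓢'(SpaceTime d, ℂ)) := by
    rw [Lp.fourier_toTemperedDistribution_eq, hw, FourierTransform.fourier_fourierInv_eq]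
  have hSm : IsFunction (𝓕 (w : 𝓢'(SpaceTime d, ℂ))) fun p => laplacianSymbol d σ p * G p := by
    rw [hFS]
    exact (isFunction_toTemperedDistribution h).congr hm.coeFn_toLp
  have hpi : (2 * Real.pi) ≠ 0 := by positivity
  refine le_antisymm ?_ ?_
  · rw [← hnorm]
    refine iInf₂_le_of_le w ?_ le_rfl
    -- Rescaling `G` undoes the factor `2 π` in `HasFourierTransform`.
    refine ⟨T, w, fun p => G ((2 * Real.pi)⁻¹ • p), hT, ?_, isFunction_toTemperedDistribution w, ?_⟩
    · simp only [HasFourierTransform, inv_smul_smul₀ hpi]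
      exact hG
    · simp only [HasFourierTransform, inv_smul_smul₀ hpi]
      exact hSm
  · refine le_iInf₂ fun w' hw' => ?_
    obtain ⟨T', S', G', hT', hG', hS', hS''⟩ := hw'
    have h1 : T' = T := hT'.distribution_eq hT
    rw [h1] at hG'
    have h2 := IsFunction.ae_eq hG' hG
    have h3 : IsFunction (𝓕 S') fun p => laplacianSymbol d σ p * G p := by
      refine IsFunction.congr hS'' ?_
      filter_upwards [h2] with p hp
      simp only [laplacianSymbol, hp]
    have h4 := h3.distribution_eq hSm
    have h5 : S' = (w : 𝓢'(SpaceTime d, ℂ)) := eq_of_fourier_eq h4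
    rw [h5] at hS'
    rw [← hnorm, eLpNorm_congr_ae (hS'.ae_eq (isFunction_toTemperedDistribution w))]

theorem fracLaplacianNorm_zero (σ : ℝ) {F : SpaceTime d → ℂ} (hF : F =ᵐ[volume] 0) :
    fracLaplacianNorm σ F = 0 := by
  have h0 : (fun p : SpaceTime d => laplacianSymbol d σ p * (0 : SpaceTime d → ℂ) p) = 0 := by
    funext p; simp
  rw [fracLaplacianNorm_eq (T := 0) (G := 0) (isFunction_zero.congr hF.symm)
    (by rw [FourierTransform.fourier_zero]; exact isFunction_zero) (by rw [h0]; exact MemLp.zero), h0]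
  simp

end

/-! ### The space-time Fourier transform of the product -/

section

variable {d : ℕ} [NeZero d]

/-- The integral of `f` times the conjugate of `g` over the pairs of points with difference `ξ` and
with prescribed component of the centre along `ξ`. -/
def hyperplaneIntegral (f g : Space d → ℂ) (q : Space d × ℝ) : ℂ :=
  ∫ y : Space (d - 1), f (frame q.1 (q.2 + ‖q.1‖ / 2, y)) *
    (starRingEnd ℂ) (g (frame q.1 (q.2 - ‖q.1‖ / 2, y)))

/-- The space-time Fourier transform of the product of a solution and the conjugate of a solution,
in Mathlib's normalisation. -/
def bilinearTransform (f g : Space d → ℂ) (p : SpaceTime d) : ℂ :=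
  ((4 * Real.pi * ‖p.snd‖ : ℝ) : ℂ)⁻¹ *
    hyperplaneIntegral f g (p.snd, -p.fst / (4 * Real.pi * ‖p.snd‖))

theorem measurable_hyperplaneIntegral {f g : Space d → ℂ} (hf : Measurable f) (hg : Measurable g) :
    Measurable (hyperplaneIntegral f g) := by
  have h : StronglyMeasurable fun q : (Space d × ℝ) × Space (d - 1) =>
      f (frame q.1.1 (q.1.2 + ‖q.1.1‖ / 2, q.2)) *
        (starRingEnd ℂ) (g (frame q.1.1 (q.1.2 - ‖q.1.1‖ / 2, q.2))) :=
    Measurable.stronglyMeasurable (by fun_prop)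
  exact h.integral_prod_right'.measurable

theorem measurable_fst_spaceTime : Measurable fun p : SpaceTime d => p.fst :=
  measurable_fst.comp (WithLp.measurable_ofLp 2 _)

theorem measurable_snd_spaceTime : Measurable fun p : SpaceTime d => p.snd :=
  measurable_snd.comp (WithLp.measurable_ofLp 2 _)

theorem measurable_bilinearTransform {f g : Space d → ℂ} (hf : Measurable f) (hg : Measurable g) :
    Measurable (bilinearTransform f g) := by
  have h1 := measurable_hyperplaneIntegral hf hg
  have h2 := measurable_fst_spaceTime (d := d)
  have h3 := measurable_snd_spaceTime (d := d)
  unfold bilinearTransform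
  fun_prop

theorem bilinearTransform_toLp (f g : Space d → ℂ) {ξ : Space d} (hξ : ξ ≠ 0) (s : ℝ) :
    bilinearTransform f g (WithLp.toLp 2 (-(4 * Real.pi * ‖ξ‖ * s), ξ)) =
      ((4 * Real.pi * ‖ξ‖ : ℝ) : ℂ)⁻¹ * hyperplaneIntegral f g (ξ, s) := by
  have h : 4 * Real.pi * ‖ξ‖ ≠ 0 := by have := norm_pos_iff.2 hξ; positivity
  simp only [bilinearTransform, WithLp.toLp_fst, WithLp.toLp_snd, neg_neg]
  rw [mul_div_cancel_left₀ _ h]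


/-- The parametrisation of the space-time frequencies by the difference of two points and the
component of their centre along it. -/
def frequency (q : Space d × ℝ) : SpaceTime d := WithLp.toLp 2 (-(4 * Real.pi * ‖q.1‖ * q.2), q.1)

theorem measurable_frequency : Measurable (frequency (d := d)) := by
  have h : Measurable fun q : Space d × ℝ => (-(4 * Real.pi * ‖q.1‖ * q.2), q.1) := by fun_prop
  exact (WithLp.measurable_toLp 2 _).comp h

theorem lintegral_mul_left (a : ℝ) (ha : a ≠ 0) {h : ℝ → ℝ≥0∞} (hh : Measurable h) :
    ∫⁻ t, h t = ∫⁻ s, ENNReal.ofReal |a| * h (a * s) := by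
  have hm : Measurable fun s => h (a * s) := hh.comp (measurable_const_mul a)
  conv_lhs => rw [← Real.smul_map_volume_mul_left ha]
  rw [lintegral_smul_measure, lintegral_map hh (measurable_const_mul a), lintegral_const_mul _ hm]
  rfl

/-- For each ξ ≠ 0 the time frequency is substituted by -4π|ξ|s. -/
theorem lintegral_spaceTime_frequency {h : SpaceTime d → ℝ≥0∞} (hh : Measurable h) :
    ∫⁻ p, h p = ∫⁻ q : Space d × ℝ, ENNReal.ofReal (4 * Real.pi * ‖q.1‖) * h (frequency q) := by
  have htoLp : Measurable (WithLp.toLp 2 : ℝ × Space d → SpaceTime d) := WithLp.measurable_toLp 2 _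
  have hm : Measurable (Function.uncurry fun (t : ℝ) (x : Space d) => h (WithLp.toLp 2 (t, x))) :=
    hh.comp htoLp
  have hm2 : Measurable fun q : Space d × ℝ =>
      ENNReal.ofReal (4 * Real.pi * ‖q.1‖) * h (frequency q) := by
    have := hh.comp (measurable_frequency (d := d))
    exact Measurable.mul (by fun_prop) this
  rw [lintegral_spaceTime hh.aemeasurable, lintegral_lintegral_swap hm.aemeasurable,
    Measure.volume_eq_prod, lintegral_prod _ hm2.aemeasurable]
  refine lintegral_congr_ae ?_
  filter_upwards [Measure.ae_ne (volume : Measure (Space d)) 0] with ξ hξ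
  have h0 : 0 < 4 * Real.pi * ‖ξ‖ := by have := norm_pos_iff.2 hξ; positivity
  have hs : Measurable fun t : ℝ => h (WithLp.toLp 2 (t, ξ)) :=
    hh.comp (htoLp.comp measurable_prodMk_right)
  rw [lintegral_mul_left (-(4 * Real.pi * ‖ξ‖)) (by linarith : _ ≠ _) hs, abs_neg, abs_of_pos h0]
  simp only [frequency, neg_mul]

theorem measurePreserving_frequency : MeasurePreserving (frequency (d := d))
    (volume.withDensity fun q => ENNReal.ofReal (4 * Real.pi * ‖q.1‖)) volume := by
  refine ⟨measurable_frequency, ?_⟩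
  refine Measure.ext_of_lintegral _ fun h hh => ?_
  have hw : Measurable fun q : Space d × ℝ => ENNReal.ofReal (4 * Real.pi * ‖q.1‖) := by fun_prop
  have hc : Measurable fun q : Space d × ℝ => h (frequency q) := hh.comp measurable_frequency
  rw [lintegral_map hh measurable_frequency, lintegral_withDensity_eq_lintegral_mul _ hw hc,
    lintegral_spaceTime_frequency hh]
  rfl

/-- The squared norms of the two points differ by 2|ξ|s whatever their common transverse coordinate
`y`. The fibres of the difference map on the paraboloid are therefore hyperplanes. -/
theorem paraboloid_sub_frame (q : Space d × ℝ) (y : Space (d - 1)) :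
    paraboloid (frame q.1 (q.2 + ‖q.1‖ / 2, y)) - paraboloid (frame q.1 (q.2 - ‖q.1‖ / 2, y)) =
      frequency q := by
  have h1 := norm_frame_sq q.1 (q.2 + ‖q.1‖ / 2, y)
  have h2 := norm_frame_sq q.1 (q.2 - ‖q.1‖ / 2, y)
  have h3 := frame_pair_sub q.1 q.2 ‖q.1‖ y rfl
  simp only [paraboloid, frequency, h1, h2, ← WithLp.toLp_sub, Prod.mk_sub_mk, h3]
  congr 2
  ring

theorem measurePreserving_pairing_assoc :
    MeasurePreserving fun q : (Space d × ℝ) × Space (d - 1) =>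
      (frame q.1.1 (q.1.2 + ‖q.1.1‖ / 2, q.2), frame q.1.1 (q.1.2 - ‖q.1.1‖ / 2, q.2)) := by
  have h := measurePreserving_pairing.comp (volume_preserving_prodAssoc (α₁ := Space d)
    (β₁ := ℝ) (γ₁ := Space (d - 1)))
  exact h

theorem ae_fst_ne_zero : ∀ᵐ q : Space d × ℝ, q.1 ≠ 0 :=
  Measure.quasiMeasurePreserving_fst.ae (Measure.ae_ne (volume : Measure (Space d)) 0)

/-- The coordinates (ξ, s, y) preserve the measure and the test function is constant in y, which
leaves `hyperplaneIntegral`. The density 4π|ξ| of the passage to space-time frequencies cancels the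
prefactor of `bilinearTransform`. -/
theorem integral_schwartz_mul_bilinearTransform {f g : Space d → ℂ} (hf : Measurable f) (hg : Measurable g)
    (hfs : smoothNorm f < ∞) (hgs : smoothNorm g < ∞) (φ : 𝓢(SpaceTime d, ℂ)) :
    Integrable (fun p => φ p * bilinearTransform f g p) ∧
    ∫ p, φ p * bilinearTransform f g p =
      ∫ z : Space d × Space d, f z.1 * (starRingEnd ℂ) (g z.2) *
        φ (paraboloid z.1 - paraboloid z.2) := by
  set K : Space d × Space d → ℂ := fun z => f z.1 * (starRingEnd ℂ) (g z.2) *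
        φ (paraboloid z.1 - paraboloid z.2) with hK
  have hKi : Integrable K := integrable_mul_conj_mul_schwartz hf hg hfs hgs φ
  have hJ := measurePreserving_pairing_assoc (d := d)
  have hKJ := hJ.integrable_comp_of_integrable hKi
  have hKJ' : ∀ q : Space d × ℝ, ∫ y : Space (d - 1),
      K (frame q.1 (q.2 + ‖q.1‖ / 2, y), frame q.1 (q.2 - ‖q.1‖ / 2, y)) =
      φ (frequency q) * hyperplaneIntegral f g q := fun q => by
    simp only [hK, paraboloid_sub_frame, hyperplaneIntegral]
    rw [integral_mul_const, mul_comm]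
  have h1 : Integrable (fun q => φ (frequency q) * hyperplaneIntegral f g q) := by
    refine (hKJ.integral_prod_left).congr (Eventually.of_forall fun q => ?_)
    exact hKJ' q
  have h2 : ∫ q, φ (frequency q) * hyperplaneIntegral f g q = ∫ z, K z := by
    have hint : ∫ z, K z = ∫ q : (Space d × ℝ) × Space (d - 1),
        K (frame q.1.1 (q.1.2 + ‖q.1.1‖ / 2, q.2), frame q.1.1 (q.1.2 - ‖q.1.1‖ / 2, q.2)) := by
      conv_lhs => rw [← hJ.map_eq]
      rw [integral_map hJ.measurable.aemeasurable]
      rw [hJ.map_eq]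
      exact hKi.1
    rw [hint]
    refine Eq.trans ?_ (integral_prod _ hKJ).symm
    exact integral_congr_ae (Eventually.of_forall fun q => (hKJ' q).symm)
  have hw : Measurable fun q : Space d × ℝ => ENNReal.ofReal (4 * Real.pi * ‖q.1‖) := by fun_prop
  have hwt : ∀ᵐ q : Space d × ℝ, ENNReal.ofReal (4 * Real.pi * ‖q.1‖) < ∞ :=
    Eventually.of_forall fun _ => ENNReal.ofReal_lt_top
  have h3 : (fun q : Space d × ℝ => (ENNReal.ofReal (4 * Real.pi * ‖q.1‖)).toReal •
      (φ (frequency q) * bilinearTransform f g (frequency q))) =ᵐ[volume]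
      fun q => φ (frequency q) * hyperplaneIntegral f g q := by
    filter_upwards [ae_fst_ne_zero (d := d)] with q hq
    have h0 : 0 < 4 * Real.pi * ‖q.1‖ := by have := norm_pos_iff.2 hq; positivity
    have hb : bilinearTransform f g (frequency q) = _ := bilinearTransform_toLp f g hq q.2
    rw [hb, ENNReal.toReal_ofReal h0.le, Complex.real_smul]
    have := Complex.ofReal_ne_zero.2 h0.ne'
    field_simp
  have hF := measurePreserving_frequency (d := d)
  have hm : AEStronglyMeasurable (fun p => φ p * bilinearTransform f g p) volume := by
    have h5 := measurable_bilinearTransform hf hg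
    have h6 := φ.continuous.measurable
    exact (h6.mul h5).aestronglyMeasurable
  constructor
  · rw [← hF.integrable_comp hm, integrable_withDensity_iff_integrable_smul' hw hwt]
    exact h1.congr h3.symm
  · rw [← h2, ← integral_congr_ae h3, ← integral_withDensity_eq_integral_toReal_smul hw hwt]
    conv_lhs => rw [← hF.map_eq]
    rw [integral_map hF.measurable.aemeasurable]
    rw [hF.map_eq]
    exact hm

theorem exists_isFunction_fourier_product {f g : Space d → ℂ} (hf : Measurable f)
    (hg : Measurable g) (hfs : smoothNorm f < ∞) (hgs : smoothNorm g < ∞) {U V : SpaceTime d → ℂ}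
    (hU : IsEvolution f U) (hV : IsEvolution g V) :
    ∃ T : 𝓢'(SpaceTime d, ℂ), IsFunction T (fun p => U p * (starRingEnd ℂ) (V p)) ∧
      IsFunction (𝓕 T) (bilinearTransform f g) := by
  have hm : AEStronglyMeasurable fun p => U p * (starRingEnd ℂ) (V p) :=
    hU.1.mul ((RCLike.continuous_conj (K := ℂ)).comp_aestronglyMeasurable hV.1)
  obtain ⟨T, hT⟩ := exists_isFunction_of_decay hm (lintegral_mul_conj_decay_lt_top hU hV)
  refine ⟨T, hT, fun φ => ⟨(integral_schwartz_mul_bilinearTransform hf hg hfs hgs φ).1, ?_⟩⟩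
  rw [(integral_schwartz_mul_bilinearTransform hf hg hfs hgs φ).2, TemperedDistribution.fourier_apply,
    (hT _).2, integral_schwartz_mul_evolution hf hg hfs hgs hU hV]
  simp

theorem enorm_ofReal_of_nonneg {x : ℝ} (hx : 0 ≤ x) : ‖(x : ℂ)‖ₑ = ENNReal.ofReal x := by
  rw [← ofReal_norm, Complex.norm_real, Real.norm_of_nonneg hx]

theorem lintegral_laplacianSymbol_mul_bilinearTransform (σ : ℝ) {f g : Space d → ℂ}
    (hf : Measurable f) (hg : Measurable g) :
    ∫⁻ p, ‖laplacianSymbol d σ p * bilinearTransform f g p‖ₑ ^ 2 =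
      ENNReal.ofReal ((2 * Real.pi) ^ (4 * σ) / (4 * Real.pi)) *
        ∫⁻ q : Space d × ℝ, ENNReal.ofReal (‖q.1‖ ^ (4 * σ - 1)) * ‖hyperplaneIntegral f g q‖ₑ ^ 2 := by
  have hL : Measurable (laplacianSymbol d σ) := by
    have : Measurable fun p : SpaceTime d => ((2 * Real.pi) • p).snd :=
      measurable_snd_spaceTime.comp (measurable_const_smul _)
    unfold laplacianSymbol
    fun_prop
  have hB := measurable_bilinearTransform hf hg
  have hH := measurable_hyperplaneIntegral hf hg
  have hLB : Measurable fun p => ‖laplacianSymbol d σ p * bilinearTransform f g p‖ₑ ^ 2 :=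
    ((hL.mul hB).enorm).pow_const 2
  have hR : Measurable fun q : Space d × ℝ =>
      ENNReal.ofReal (‖q.1‖ ^ (4 * σ - 1)) * ‖hyperplaneIntegral f g q‖ₑ ^ 2 := by fun_prop
  rw [lintegral_spaceTime_frequency hLB, ← lintegral_const_mul _ hR]
  refine lintegral_congr_ae ?_
  filter_upwards [ae_fst_ne_zero (d := d)] with q hq
  have hq0 := norm_pos_iff.2 hq
  have hb : bilinearTransform f g (frequency q) = _ := bilinearTransform_toLp f g hq q.2
  have hl : laplacianSymbol d σ (frequency q) =
      (((2 * Real.pi) ^ (2 * σ) * ‖q.1‖ ^ (2 * σ) : ℝ) : ℂ) := by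
    have : ((2 * Real.pi) • frequency q).snd = (2 * Real.pi) • q.1 := rfl
    rw [laplacianSymbol, this, norm_smul, Real.norm_of_nonneg (by positivity),
      Real.mul_rpow (by positivity) (by positivity)]
  have hπ : (0:ℝ) < 2 * Real.pi := by positivity
  rw [hb, hl, ← mul_assoc, enorm_mul, mul_pow, ← Complex.ofReal_inv, ← Complex.ofReal_mul,
    enorm_ofReal_of_nonneg (by positivity), ← mul_assoc, ← mul_assoc,
    ← ENNReal.ofReal_pow (by positivity), ← ENNReal.ofReal_mul (by positivity),
    ← ENNReal.ofReal_mul (by positivity)]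
  congr 2
  have e1 : (2 * Real.pi) ^ (4 * σ) = ((2 * Real.pi) ^ (2 * σ)) ^ 2 := by
    rw [← Real.rpow_natCast, ← Real.rpow_mul hπ.le]; congr 1; push_cast; ring
  -- Two inverse powers of |ξ| from the squared prefactor and one power from the density leave the
  -- -1 in the exponent.
  have e2 : ‖q.1‖ ^ (4 * σ - 1) = (‖q.1‖ ^ (2 * σ)) ^ 2 / ‖q.1‖ := by
    rw [← Real.rpow_natCast, ← Real.rpow_mul hq0.le, Real.rpow_sub_one hq0.ne']
    congr 2; push_cast; ring
  rw [e1, e2]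
  have := Real.pi_pos
  field_simp

end

/-! ### Lagrange's identity and the exchange defect -/

section

theorem enorm_sq_eq_ofReal (z : ℂ) : ‖z‖ₑ ^ 2 = ENNReal.ofReal (‖z‖ ^ 2) := by
  rw [← ofReal_norm, ENNReal.ofReal_pow (norm_nonneg _)]

section Lagrange

variable {Y : Type*} [MeasurableSpace Y] {μ : Measure Y} [SFinite μ] {φ ψ : Y → ℂ}

theorem integrable_norm_sq (hφ : Measurable φ) (h : ∫⁻ y, ‖φ y‖ₑ ^ 2 ∂μ < ∞) :
    Integrable (fun y => ‖φ y‖ ^ 2) μ := by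
  refine ⟨by fun_prop, ?_⟩
  rw [hasFiniteIntegral_iff_ofReal (Eventually.of_forall fun y => by positivity)]
  simpa only [← enorm_sq_eq_ofReal] using h

/-- Expand the square: with R = φ conj ψ the cross term is 2 Re R(y) conj R(y'), whose double
integral is 2|∫ R|². -/
theorem lagrange_identity_of_lt_top (hφ : Measurable φ) (hψ : Measurable ψ)
    (h1 : ∫⁻ y, ‖φ y‖ₑ ^ 2 ∂μ < ∞) (h2 : ∫⁻ y, ‖ψ y‖ₑ ^ 2 ∂μ < ∞) :
    2 * ‖∫ y, φ y * (starRingEnd ℂ) (ψ y) ∂μ‖ₑ ^ 2 +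
      ∫⁻ y, ∫⁻ y', ‖φ y * ψ y' - φ y' * ψ y‖ₑ ^ 2 ∂μ ∂μ =
      2 * ∫⁻ y, ∫⁻ y', ‖φ y‖ₑ ^ 2 * ‖ψ y'‖ₑ ^ 2 ∂μ ∂μ := by
  have hP := integrable_norm_sq hφ h1
  have hQ := integrable_norm_sq hψ h2
  have hR : Integrable (fun y => φ y * (starRingEnd ℂ) (ψ y)) μ := by
    refine (hP.add hQ).mono' (by fun_prop) (Eventually.of_forall fun y => ?_)
    simp only [norm_mul, RCLike.norm_conj, Pi.add_apply]
    nlinarith [sq_nonneg (‖φ y‖ - ‖ψ y‖), norm_nonneg (φ y), norm_nonneg (ψ y)]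
  set R : Y → ℂ := fun y => φ y * (starRingEnd ℂ) (ψ y) with hRd
  have hPQ := hP.mul_prod hQ
  have hQP := hQ.mul_prod hP
  have hRR := hR.mul_prod (conj_integrable hR)
  have hRRre : Integrable (fun z : Y × Y => (R z.1 * (starRingEnd ℂ) (R z.2)).re) (μ.prod μ) :=
    hRR.re
  have hsum : Integrable (fun z : Y × Y => ‖φ z.1‖ ^ 2 * ‖ψ z.2‖ ^ 2 + ‖ψ z.1‖ ^ 2 * ‖φ z.2‖ ^ 2)
    (μ.prod μ) := hPQ.add hQP
  have hid : ∀ y y', ‖φ y * ψ y' - φ y' * ψ y‖ ^ 2 = ‖φ y‖ ^ 2 * ‖ψ y'‖ ^ 2 + ‖ψ y‖ ^ 2 * ‖φ y'‖ ^ 2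
      - 2 * (R y * (starRingEnd ℂ) (R y')).re := fun y y' => by
    simp only [← Complex.normSq_eq_norm_sq, hRd, Complex.normSq_apply, Complex.mul_re,
      Complex.mul_im, Complex.sub_re, Complex.sub_im, Complex.conj_re, Complex.conj_im]
    ring
  have hD : ∫⁻ y, ∫⁻ y', ‖φ y * ψ y' - φ y' * ψ y‖ₑ ^ 2 ∂μ ∂μ =
      ENNReal.ofReal (∫ z : Y × Y, ‖φ z.1 * ψ z.2 - φ z.2 * ψ z.1‖ ^ 2 ∂(μ.prod μ)) := by
    rw [ofReal_integral_eq_lintegral_ofReal, lintegral_prod]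
    · simp only [enorm_sq_eq_ofReal]
    · fun_prop
    · simp only [hid]
      exact hsum.sub (hRRre.const_mul 2)
    · exact Eventually.of_forall fun z => by positivity
  have hDv : ∫ z : Y × Y, ‖φ z.1 * ψ z.2 - φ z.2 * ψ z.1‖ ^ 2 ∂(μ.prod μ) =
      2 * ((∫ y, ‖φ y‖ ^ 2 ∂μ) * ∫ y, ‖ψ y‖ ^ 2 ∂μ) - 2 * ‖∫ y, R y ∂μ‖ ^ 2 := by
    have e1 : ∫ z : Y × Y, (R z.1 * (starRingEnd ℂ) (R z.2)).re ∂(μ.prod μ) =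
        ‖∫ y, R y ∂μ‖ ^ 2 := by
      have := integral_re (𝕜 := ℂ) hRR
      refine this.trans ?_
      rw [integral_prod_mul R (fun y => (starRingEnd ℂ) (R y)), integral_conj, Complex.mul_conj,
        Complex.normSq_eq_norm_sq]
      exact Complex.ofReal_re _
    simp only [hid]
    rw [integral_sub hsum (hRRre.const_mul 2), integral_add hPQ hQP, integral_const_mul,
      e1, integral_prod_mul (fun y => ‖φ y‖ ^ 2) (fun y => ‖ψ y‖ ^ 2),
      integral_prod_mul (fun y => ‖ψ y‖ ^ 2) (fun y => ‖φ y‖ ^ 2)]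
    ring
  have hAB : ∫⁻ y, ∫⁻ y', ‖φ y‖ₑ ^ 2 * ‖ψ y'‖ₑ ^ 2 ∂μ ∂μ =
      ENNReal.ofReal ((∫ y, ‖φ y‖ ^ 2 ∂μ) * ∫ y, ‖ψ y‖ ^ 2 ∂μ) := by
    have : ∀ y, ∫⁻ y', ‖φ y‖ₑ ^ 2 * ‖ψ y'‖ₑ ^ 2 ∂μ = ‖φ y‖ₑ ^ 2 * ∫⁻ y', ‖ψ y'‖ₑ ^ 2 ∂μ :=
      fun y => lintegral_const_mul _ (by fun_prop)
    simp only [this]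
    rw [lintegral_mul_const _ (by fun_prop), ENNReal.ofReal_mul (by positivity),
      ofReal_integral_eq_lintegral_ofReal hP (Eventually.of_forall fun y => by positivity),
      ofReal_integral_eq_lintegral_ofReal hQ (Eventually.of_forall fun y => by positivity)]
    simp only [enorm_sq_eq_ofReal]
  have hD0 : 0 ≤ ∫ z : Y × Y, ‖φ z.1 * ψ z.2 - φ z.2 * ψ z.1‖ ^ 2 ∂(μ.prod μ) :=
    integral_nonneg fun z => by positivity
  have e2 : (2 : ℝ≥0∞) = ENNReal.ofReal 2 := by simp
  rw [hD, hAB, enorm_sq_eq_ofReal, e2, ← ENNReal.ofReal_mul (by norm_num),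
    ← ENNReal.ofReal_mul (by norm_num), ← ENNReal.ofReal_add (by positivity) hD0, hDv]
  congr 1
  ring

/-- A finite product of the two norms has finite factors unless one of them is zero; in that case
every term vanishes, the other norm possibly being infinite. -/
theorem lagrange_identity (hφ : Measurable φ) (hψ : Measurable ψ)
    (h : ∫⁻ y, ∫⁻ y', ‖φ y‖ₑ ^ 2 * ‖ψ y'‖ₑ ^ 2 ∂μ ∂μ < ∞) :
    2 * ‖∫ y, φ y * (starRingEnd ℂ) (ψ y) ∂μ‖ₑ ^ 2 +
      ∫⁻ y, ∫⁻ y', ‖φ y * ψ y' - φ y' * ψ y‖ₑ ^ 2 ∂μ ∂μ =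
      2 * ∫⁻ y, ∫⁻ y', ‖φ y‖ₑ ^ 2 * ‖ψ y'‖ₑ ^ 2 ∂μ ∂μ := by
  have hAB : ∫⁻ y, ∫⁻ y', ‖φ y‖ₑ ^ 2 * ‖ψ y'‖ₑ ^ 2 ∂μ ∂μ =
      (∫⁻ y, ‖φ y‖ₑ ^ 2 ∂μ) * ∫⁻ y', ‖ψ y'‖ₑ ^ 2 ∂μ := by
    have : ∀ y, ∫⁻ y', ‖φ y‖ₑ ^ 2 * ‖ψ y'‖ₑ ^ 2 ∂μ = ‖φ y‖ₑ ^ 2 * ∫⁻ y', ‖ψ y'‖ₑ ^ 2 ∂μ :=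
      fun y => lintegral_const_mul _ (by fun_prop)
    simp only [this]
    rw [lintegral_mul_const _ (by fun_prop)]
  have hz : ∀ {θ : Y → ℂ}, Measurable θ → ∫⁻ y, ‖θ y‖ₑ ^ 2 ∂μ = 0 → ∀ᵐ y ∂μ, θ y = 0 := by
    intro θ hθ h0
    rw [lintegral_eq_zero_iff (by fun_prop)] at h0
    filter_upwards [h0] with y hy
    simpa using hy
  have key : ((∀ᵐ y ∂μ, φ y = 0) ∨ (∀ᵐ y ∂μ, ψ y = 0)) →
      ∫ y, φ y * (starRingEnd ℂ) (ψ y) ∂μ = 0 ∧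
      ∫⁻ y, ∫⁻ y', ‖φ y * ψ y' - φ y' * ψ y‖ₑ ^ 2 ∂μ ∂μ = 0 := by
    intro h
    constructor
    · refine integral_eq_zero_of_ae ?_
      rcases h with h | h <;> filter_upwards [h] with y hy <;> simp [hy]
    · rw [lintegral_eq_zero_of_ae_eq_zero]
      rcases h with h | h <;> filter_upwards [h] with y hy <;>
        refine lintegral_eq_zero_of_ae_eq_zero ?_ <;> filter_upwards [h] with y' hy' <;>
        simp [hy, hy']
  by_cases hA0 : ∫⁻ y, ‖φ y‖ₑ ^ 2 ∂μ = 0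
  · rw [hAB, (key (Or.inl (hz hφ hA0))).1, (key (Or.inl (hz hφ hA0))).2, hA0]
    simp
  by_cases hB0 : ∫⁻ y, ‖ψ y‖ₑ ^ 2 ∂μ = 0
  · rw [hAB, (key (Or.inr (hz hψ hB0))).1, (key (Or.inr (hz hψ hB0))).2, hB0]
    simp
  rw [hAB] at h
  refine lagrange_identity_of_lt_top hφ hψ ?_ ?_
  · exact ENNReal.lt_top_of_mul_ne_top_left h.ne hB0
  · exact ENNReal.lt_top_of_mul_ne_top_right h.ne hA0

end Lagrange

variable {d : ℕ} [NeZero d]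

/-- The exchange of the two points `z.1`, `z.2` along the hyperplanes orthogonal to `ξ`. -/
def exchange (ξ : Space d) (z : Space d × Space d) : Space d × Space d :=
  (z.2 + (⟪ξ, z.1 - z.2⟫ / ‖ξ‖ ^ 2) • ξ, z.1 - (⟪ξ, z.1 - z.2⟫ / ‖ξ‖ ^ 2) • ξ)

theorem measurable_exchange :
    Measurable fun q : Space d × (Space d × Space d) => exchange q.1 q.2 := by
  unfold exchange; fun_prop

theorem exchange_smul {r : ℝ} (hr : 0 < r) (ξ : Space d) : exchange (r • ξ) = exchange ξ := by
  funext z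
  have : (⟪r • ξ, z.1 - z.2⟫ / ‖r • ξ‖ ^ 2) • r • ξ = (⟪ξ, z.1 - z.2⟫ / ‖ξ‖ ^ 2) • ξ := by
    rw [smul_smul, norm_smul, real_inner_smul_left, Real.norm_of_nonneg hr.le]
    congr 1
    by_cases h : ‖ξ‖ = 0
    · simp [h]
    · field_simp
  simp only [exchange, this]

/-- In the frame of `ξ` the exchange swaps the transverse coordinates, turning one diagonal of the
rectangle into the other. -/
theorem exchange_frame {ξ : Space d} (hξ : ξ ≠ 0) (s : ℝ) (y y' : Space (d - 1)) :
    exchange ξ (frame ξ (s + ‖ξ‖ / 2, y), frame ξ (s - ‖ξ‖ / 2, y')) =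
      (frame ξ (s + ‖ξ‖ / 2, y'), frame ξ (s - ‖ξ‖ / 2, y)) := by
  have h0 : ‖ξ‖ ≠ 0 := norm_ne_zero_iff.2 hξ
  have h1 : ⟪ξ, frame ξ (s + ‖ξ‖ / 2, y) - frame ξ (s - ‖ξ‖ / 2, y')⟫ / ‖ξ‖ ^ 2 = 1 := by
    rw [← frame_sub, inner_frame]
    simp only [Prod.fst_sub]
    field_simp
    ring
  simp only [exchange, h1, one_smul]
  have h2 := frame_pair_sub ξ s ‖ξ‖ y' rfl
  have h3 := frame_pair_sub ξ s ‖ξ‖ y rfl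
  rw [sub_eq_iff_eq_add] at h2 h3
  ext1
  · rw [h2, add_comm]
  · simp only; rw [h3, add_sub_cancel_left]

/-- The squared distance from `f ⊗ g` to its exchange. -/
def exchangeDefect (f g : Space d → ℂ) (ξ : Space d) (z : Space d × Space d) : ℝ≥0∞ :=
  ‖f z.1 * g z.2 - f (exchange ξ z).1 * g (exchange ξ z).2‖ₑ ^ 2

theorem measurable_exchangeDefect {f g : Space d → ℂ} (hf : Measurable f) (hg : Measurable g) :
    Measurable (Function.uncurry (exchangeDefect f g)) := by
  have h1 : Measurable fun q : Space d × (Space d × Space d) => (exchange q.1 q.2).1 :=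
    measurable_exchange.fst
  have h2 : Measurable fun q : Space d × (Space d × Space d) => (exchange q.1 q.2).2 :=
    measurable_exchange.snd
  unfold exchangeDefect Function.uncurry
  fun_prop

/-- The integral of the defect over all directions, with the weight of the estimate. -/
def totalDefect (a : ℝ) (f g : Space d → ℂ) : ℝ≥0∞ :=
  ∫⁻ e, (∫⁻ z : Space d × Space d, posPow a ⟪(e : Space d), z.1 - z.2⟫ * exchangeDefect f g e z)
    ∂(volume : Measure (Space d)).toSphere

/-- Lagrange's identity on each hyperplane, integrated with the weight over ξ and s. The right side
involves one diagonal of each rectangle and is computed by `lintegral_rectangles_diagonal`; the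
remainder becomes an integral over directions by `lintegral_rectangles`. -/
theorem lintegral_hyperplaneIntegral_add_defect {a : ℝ} (ha : -1 < a) {f g : Space d → ℂ}
    (hf : Measurable f) (hg : Measurable g)
    (h : ∫⁻ z : Space d × Space d, ‖f z.1‖ₑ ^ 2 * ‖g z.2‖ₑ ^ 2 *
      ENNReal.ofReal (‖z.1 - z.2‖ ^ a) < ∞) :
    2 * (∫⁻ q : Space d × ℝ, ENNReal.ofReal (‖q.1‖ ^ (a + 1 - d)) * ‖hyperplaneIntegral f g q‖ₑ ^ 2) +
      totalDefect a f g =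
    2 * (ENNReal.ofReal (sphereConst d a) * ∫⁻ z : Space d × Space d, ‖f z.1‖ₑ ^ 2 * ‖g z.2‖ₑ ^ 2 *
      ENNReal.ofReal (‖z.1 - z.2‖ ^ a)) := by
  have hΨ : Measurable fun z : Space d × Space d => ‖f z.1‖ₑ ^ 2 * ‖g z.2‖ₑ ^ 2 := by fun_prop
  have hH := measurable_hyperplaneIntegral hf hg
  set w : Space d → ℝ≥0∞ := fun ξ => ENNReal.ofReal (‖ξ‖ ^ (a + 1 - d)) with hw
  have hwm : Measurable w := by fun_prop
  have hdiag := lintegral_rectangles_diagonal (d := d) ha hΨ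
  have hdef := lintegral_rectangles (d := d) a (measurable_exchangeDefect hf hg)
    (fun r hr e => by funext z; simp only [exchangeDefect, exchange_smul hr])
  set A : Space d × ℝ → ℝ≥0∞ := fun q => ∫⁻ y : Space (d - 1), ∫⁻ y' : Space (d - 1),
    ‖f (frame q.1 (q.2 + ‖q.1‖ / 2, y))‖ₑ ^ 2 * ‖g (frame q.1 (q.2 - ‖q.1‖ / 2, y'))‖ₑ ^ 2 with hA
  set D : Space d × ℝ → ℝ≥0∞ := fun q => ∫⁻ y : Space (d - 1), ∫⁻ y' : Space (d - 1),
    exchangeDefect f g q.1 (frame q.1 (q.2 + ‖q.1‖ / 2, y), frame q.1 (q.2 - ‖q.1‖ / 2, y')) with hD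
  have hAm : Measurable A := by
    have h1 : Measurable fun q : ((Space d × ℝ) × Space (d - 1)) × Space (d - 1) =>
        ‖f (frame q.1.1.1 (q.1.1.2 + ‖q.1.1.1‖ / 2, q.1.2))‖ₑ ^ 2 *
          ‖g (frame q.1.1.1 (q.1.1.2 - ‖q.1.1.1‖ / 2, q.2))‖ₑ ^ 2 := by fun_prop
    exact h1.lintegral_prod_right'.lintegral_prod_right'
  have hDm : Measurable D := by
    have h1 : Measurable fun q : ((Space d × ℝ) × Space (d - 1)) × Space (d - 1) =>
        (q.1.1.1, (frame q.1.1.1 (q.1.1.2 + ‖q.1.1.1‖ / 2, q.1.2),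
          frame q.1.1.1 (q.1.1.2 - ‖q.1.1.1‖ / 2, q.2))) := by fun_prop
    have h2 := (measurable_exchangeDefect hf hg).comp h1
    exact h2.lintegral_prod_right'.lintegral_prod_right'
  have hAe : ∫⁻ q, w q.1 * A q = ENNReal.ofReal (sphereConst d a) *
      ∫⁻ z : Space d × Space d, ‖f z.1‖ₑ ^ 2 * ‖g z.2‖ₑ ^ 2 *
      ENNReal.ofReal (‖z.1 - z.2‖ ^ a) := by
    have hm : Measurable fun q : Space d × ℝ => w q.1 * A q := by fun_prop
    rw [← hdiag, Measure.volume_eq_prod, lintegral_prod _ hm.aemeasurable]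
    refine lintegral_congr fun ξ => lintegral_congr fun s => ?_
    simp only [hA, hw]
    rw [← lintegral_const_mul' _ _ ENNReal.ofReal_ne_top]
    refine lintegral_congr fun y => ?_
    rw [← lintegral_const_mul' _ _ ENNReal.ofReal_ne_top]
  have hDe : ∫⁻ q, w q.1 * D q = totalDefect a f g := by
    have hm : Measurable fun q : Space d × ℝ => w q.1 * D q := by fun_prop
    rw [totalDefect, ← hdef, Measure.volume_eq_prod, lintegral_prod _ hm.aemeasurable]
    refine lintegral_congr fun ξ => lintegral_congr fun s => ?_
    simp only [hD, hw]
    rw [← lintegral_const_mul' _ _ ENNReal.ofReal_ne_top]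
    refine lintegral_congr fun y => ?_
    rw [← lintegral_const_mul' _ _ ENNReal.ofReal_ne_top]
  have hm1 : Measurable fun q : Space d × ℝ => w q.1 * ‖hyperplaneIntegral f g q‖ₑ ^ 2 := by fun_prop
  have hfin : ∫⁻ q, w q.1 * A q < ∞ := by
    rw [hAe]; exact ENNReal.mul_lt_top ENNReal.ofReal_lt_top h
  have hae := ae_lt_top (by fun_prop : Measurable fun q : Space d × ℝ => w q.1 * A q) hfin.ne
  rw [← hAe, ← hDe, ← lintegral_const_mul _ hm1, ← lintegral_const_mul _ (by fun_prop),
    ← lintegral_add_left (by fun_prop)]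
  refine lintegral_congr_ae ?_
  filter_upwards [hae, ae_fst_ne_zero (d := d)] with q hq hq0
  -- As the weight does not vanish, finiteness of `w q.1 * A q` gives that of `A q`, which
  -- Lagrange's identity requires.
  have hwq : w q.1 ≠ 0 := by
    have := norm_pos_iff.2 hq0
    simp only [hw, ne_eq, ENNReal.ofReal_eq_zero, not_le]
    positivity
  have hAq : A q < ∞ := ENNReal.lt_top_of_mul_ne_top_right hq.ne hwq
  have hl := lagrange_identity (μ := (volume : Measure (Space (d - 1))))
    (φ := fun y => f (frame q.1 (q.2 + ‖q.1‖ / 2, y)))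
    (ψ := fun y => g (frame q.1 (q.2 - ‖q.1‖ / 2, y))) (by fun_prop) (by fun_prop) hAq
  have hDq : D q = ∫⁻ y : Space (d - 1), ∫⁻ y' : Space (d - 1),
      ‖f (frame q.1 (q.2 + ‖q.1‖ / 2, y)) * g (frame q.1 (q.2 - ‖q.1‖ / 2, y')) -
        f (frame q.1 (q.2 + ‖q.1‖ / 2, y')) * g (frame q.1 (q.2 - ‖q.1‖ / 2, y))‖ₑ ^ 2 := by
    simp only [hD, exchangeDefect, exchange_frame hq0]
  rw [← hDq] at hl
  calc _ = w q.1 * (2 * ‖hyperplaneIntegral f g q‖ₑ ^ 2 + D q) := by ring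
    _ = w q.1 * (2 * A q) := by rw [← hl]; rfl
    _ = _ := by ring

end

/-! ### The sharp identity, and what finite energy implies for the data -/

section

theorem lintegral_comp_smul {E : Type*} [NormedAddCommGroup E] [NormedSpace ℝ E]
    [FiniteDimensional ℝ E] [MeasurableSpace E] [BorelSpace E] (μ : Measure E) [μ.IsAddHaarMeasure]
    {r : ℝ} (hr : 0 < r) (h : E → ℝ≥0∞) :
    ∫⁻ x, h x ∂μ = ENNReal.ofReal (r ^ Module.finrank ℝ E) * ∫⁻ x, h (r • x) ∂μ := by
  have h1 := Measure.map_addHaar_smul μ hr.ne'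
  have h2 : ∫⁻ x, h (r • x) ∂μ = ∫⁻ x, h x ∂(Measure.map (r • ·) μ) :=
    (lintegral_map_equiv h (Homeomorph.smulOfNeZero r hr.ne').toMeasurableEquiv).symm
  rw [h2, h1, lintegral_smul_measure, smul_eq_mul, ← mul_assoc,
    ← ENNReal.ofReal_mul (by positivity), abs_of_pos (by positivity), mul_inv_cancel₀ (by positivity)]
  simp

variable {d : ℕ} [NeZero d]

theorem energy_congr {σ : ℝ} {f f' g g' : Space d → ℂ} (hf : f =ᵐ[volume] f')
    (hg : g =ᵐ[volume] g') : energy σ f g = energy σ f' g' := by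
  have h1 : ∀ᵐ z : Space d × Space d, f z.1 = f' z.1 :=
    Measure.quasiMeasurePreserving_fst.ae hf
  have h2 : ∀ᵐ z : Space d × Space d, g z.2 = g' z.2 :=
    Measure.quasiMeasurePreserving_snd.ae hg
  refine lintegral_congr_ae ?_
  filter_upwards [h1, h2] with z hz1 hz2
  rw [hz1, hz2]

theorem energy_comm {σ : ℝ} {f g : Space d → ℂ} (hf : Measurable f) (hg : Measurable g) :
    energy σ f g = energy σ g f := by
  have h : Measurable fun z : Space d × Space d => ‖f z.1‖ₑ ^ 2 * ‖g z.2‖ₑ ^ 2 *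
      ENNReal.ofReal (‖z.1 - z.2‖ ^ (4 * σ + (d : ℝ) - 2)) := by fun_prop
  rw [energy, energy, Measure.volume_eq_prod, ← lintegral_prod_swap]
  refine lintegral_congr fun z => ?_
  simp only [Prod.fst_swap, Prod.snd_swap, norm_sub_rev z.2 z.1]
  ring

/-- The exponent adds `2d` from the measure to `4σ + d - 2` from the kernel. -/
theorem energy_rescale (σ : ℝ) (f g : Space d → ℂ) : energy σ f g =
    ENNReal.ofReal ((2 * Real.pi) ^ (3 * (d : ℝ) + 4 * σ - 2)) *
      energy σ (fun x => f ((2 * Real.pi) • x)) (fun x => g ((2 * Real.pi) • x)) := by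
  have hπ : 0 < 2 * Real.pi := by positivity
  have hfin : Module.finrank ℝ (Space d × Space d) = d + d := by simp
  have : (volume : Measure (Space d × Space d)).IsAddHaarMeasure := by
    rw [Measure.volume_eq_prod]; infer_instance
  rw [energy, energy, lintegral_comp_smul volume hπ, hfin,
    ← lintegral_const_mul' _ _ ENNReal.ofReal_ne_top,
    ← lintegral_const_mul' _ _ ENNReal.ofReal_ne_top]
  refine lintegral_congr fun z => ?_
  rw [Prod.smul_fst, Prod.smul_snd, ← smul_sub, norm_smul, Real.norm_of_nonneg hπ.le,
    Real.mul_rpow hπ.le (norm_nonneg _), ENNReal.ofReal_mul (by positivity)]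
  have e : (2 * Real.pi) ^ (3 * (d : ℝ) + 4 * σ - 2) =
      (2 * Real.pi) ^ (d + d) * (2 * Real.pi) ^ (4 * σ + d - 2) := by
    rw [← Real.rpow_natCast, ← Real.rpow_add hπ]
    congr 1; push_cast; ring
  rw [e, ENNReal.ofReal_mul (by positivity)]
  ring

/-- On the left stands the constant with the cost of changing the normalisation of the transform; on
the right the multiplier and the frequency density, as in
`lintegral_laplacianSymbol_mul_bilinearTransform`, times the sphere integral. -/
theorem OT_mul_rpow (d : ℕ) (σ : ℝ) :
    OT d σ * (2 * Real.pi) ^ (3 * (d : ℝ) + 4 * σ - 2) =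
      (2 * Real.pi) ^ (4 * σ) / (4 * Real.pi) * sphereConst d (4 * σ + d - 2) := by
  have hπ := Real.pi_pos
  have e1 : (4 * σ + d - 2 + 1) / 2 = 2 * σ + ((d : ℝ) - 1) / 2 := by ring
  have e2 : (4 * σ + d - 2 + d) / 2 = 2 * σ + (d : ℝ) - 1 := by ring
  have e3 : (4 : ℝ) = 2 ^ (2 : ℝ) := by norm_num
  have key : (2 : ℝ) ^ (-(3 * (d : ℝ))) * Real.pi ^ ((1 - 5 * (d : ℝ)) / 2) *
      (2 * Real.pi) ^ (3 * (d : ℝ) + 4 * σ - 2) =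
      (2 * Real.pi) ^ (4 * σ) / (4 * Real.pi) * Real.pi ^ (((d : ℝ) - 1) / 2) := by
    have h4 : (4 * Real.pi)⁻¹ = 2 ^ (-2 : ℝ) * Real.pi ^ (-1 : ℝ) := by
      rw [mul_inv, Real.rpow_neg_one, Real.rpow_neg (by norm_num), ← e3]
    rw [div_eq_mul_inv ((2 * Real.pi) ^ (4 * σ)), h4, Real.mul_rpow (by norm_num) hπ.le, Real.mul_rpow (by norm_num) hπ.le]
    calc _ = ((2 : ℝ) ^ (-(3 * (d : ℝ))) * 2 ^ (3 * (d : ℝ) + 4 * σ - 2)) *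
          (Real.pi ^ ((1 - 5 * (d : ℝ)) / 2) * Real.pi ^ (3 * (d : ℝ) + 4 * σ - 2)) := by ring
      _ = ((2 : ℝ) ^ (4 * σ) * 2 ^ (-2 : ℝ)) *
          (Real.pi ^ (4 * σ) * Real.pi ^ (-1 : ℝ) * Real.pi ^ (((d : ℝ) - 1) / 2)) := by
        rw [← Real.rpow_add (by norm_num), ← Real.rpow_add hπ, ← Real.rpow_add (by norm_num),
          ← Real.rpow_add hπ, ← Real.rpow_add hπ]
        congr 2 <;> ring
      _ = _ := by ring
  rw [OT, sphereConst, e1, e2]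
  linear_combination (Real.Gamma (2 * σ + ((d : ℝ) - 1) / 2) / Real.Gamma (2 * σ + (d : ℝ) - 1)) * key

theorem fracLaplacianNorm_sq_add_defect {σ : ℝ} (hσ : (1 - (d : ℝ)) / 4 < σ) {f g : Space d → ℂ}
    (hf : Measurable f) (hg : Measurable g) (hfs : smoothNorm f < ∞) (hgs : smoothNorm g < ∞)
    {U V : SpaceTime d → ℂ} (hU : IsEvolution f U) (hV : IsEvolution g V)
    (h : energy σ f g < ∞) :
    2 * fracLaplacianNorm σ (fun p => U p * (starRingEnd ℂ) (V p)) ^ 2 +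
      ENNReal.ofReal ((2 * Real.pi) ^ (4 * σ) / (4 * Real.pi)) *
        totalDefect (4 * σ + d - 2) f g =
    2 * (ENNReal.ofReal (OT d σ * (2 * Real.pi) ^ (3 * (d : ℝ) + 4 * σ - 2)) * energy σ f g) := by
  obtain ⟨T, hT1, hT2⟩ := exists_isFunction_fourier_product hf hg hfs hgs hU hV
  have ha : -1 < 4 * σ + d - 2 := by linarith
  have h1 := lintegral_hyperplaneIntegral_add_defect ha hf hg h
  have h2 := lintegral_laplacianSymbol_mul_bilinearTransform σ hf hg
  have e : 4 * σ + d - 2 + 1 - d = 4 * σ - 1 := by ring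
  rw [e] at h1
  set c : ℝ := (2 * Real.pi) ^ (4 * σ) / (4 * Real.pi) with hc
  have hc0 : 0 ≤ c := by have := Real.pi_pos; positivity
  have h3 : 2 * (∫⁻ p, ‖laplacianSymbol d σ p * bilinearTransform f g p‖ₑ ^ 2) +
      ENNReal.ofReal c * totalDefect (4 * σ + d - 2) f g =
      2 * (ENNReal.ofReal (OT d σ * (2 * Real.pi) ^ (3 * (d : ℝ) + 4 * σ - 2)) *
        energy σ f g) := by
    rw [OT_mul_rpow, ← hc, ENNReal.ofReal_mul hc0, h2]
    calc _ = ENNReal.ofReal c * (2 * (∫⁻ q : Space d × ℝ, ENNReal.ofReal (‖q.1‖ ^ (4 * σ - 1)) *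
          ‖hyperplaneIntegral f g q‖ₑ ^ 2) + totalDefect (4 * σ + d - 2) f g) := by ring
      _ = _ := by rw [h1, energy]; ring
  have hfin : ∫⁻ p, ‖laplacianSymbol d σ p * bilinearTransform f g p‖ₑ ^ 2 < ∞ := by
    have : 2 * (∫⁻ p, ‖laplacianSymbol d σ p * bilinearTransform f g p‖ₑ ^ 2) < ∞ := by
      refine (le_self_add.trans h3.le).trans_lt ?_
      exact ENNReal.mul_lt_top (by simp) (ENNReal.mul_lt_top ENNReal.ofReal_lt_top h)
    exact ENNReal.lt_top_of_mul_ne_top_right this.ne (by simp)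
  have hm : AEStronglyMeasurable (fun p => laplacianSymbol d σ p * bilinearTransform f g p)
      volume := by
    have hL : Measurable (laplacianSymbol d σ) := by
      have : Measurable fun p : SpaceTime d => ((2 * Real.pi) • p).snd :=
        measurable_snd_spaceTime.comp (measurable_const_smul _)
      unfold laplacianSymbol
      fun_prop
    exact (hL.mul (measurable_bilinearTransform hf hg)).aestronglyMeasurable
  have hn : eLpNorm (fun p => laplacianSymbol d σ p * bilinearTransform f g p) 2 volume ^ 2 =
      ∫⁻ p, ‖laplacianSymbol d σ p * bilinearTransform f g p‖ₑ ^ 2 := by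
    have := eLpNorm_nnreal_pow_eq_lintegral (f := fun p => laplacianSymbol d σ p *
      bilinearTransform f g p) (μ := volume) (p := 2) two_ne_zero
    simpa using this
  have hmem : MemLp (fun p => laplacianSymbol d σ p * bilinearTransform f g p) 2 := by
    refine ⟨hm, ?_⟩
    rw [← hn] at hfin
    by_contra hcon
    rw [not_lt, top_le_iff] at hcon
    simp [hcon] at hfin
  rw [fracLaplacianNorm_eq hT1 hT2 hmem, hn, h3]

/-- Tonelli gives a finite inner integral at almost every η with g(η) ≠ 0, a set of positive
measure. The conclusion "frequently" makes it possible to pick two different η. -/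
theorem lintegral_lt_top_of_energy {σ : ℝ} {f g : Space d → ℂ} (hf : Measurable f)
    (hg : Measurable g) (h : energy σ f g < ∞) (hg0 : ¬ g =ᵐ[volume] 0) :
    ∃ᶠ η in ae (volume : Measure (Space d)),
      ∫⁻ ζ, ‖f ζ‖ₑ ^ 2 * ENNReal.ofReal (‖ζ - η‖ ^ (4 * σ + (d : ℝ) - 2)) < ∞ := by
  rw [energy_comm hf hg, energy, Measure.volume_eq_prod, lintegral_prod _ (by fun_prop)] at h
  have h1 := ae_lt_top' (by
    refine Measurable.aemeasurable ?_
    have : Measurable fun z : Space d × Space d => ‖g z.1‖ₑ ^ 2 * ‖f z.2‖ₑ ^ 2 *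
      ENNReal.ofReal (‖z.1 - z.2‖ ^ (4 * σ + (d : ℝ) - 2)) := by fun_prop
    exact this.lintegral_prod_right') h.ne
  have h2 : ∃ᶠ η in ae (volume : Measure (Space d)), g η ≠ 0 :=
    fun hc => hg0 (hc.mono fun x hx => not_not.1 hx)
  refine (h2.and_eventually h1).mono fun η hη => ?_
  have h3 := hη.2
  have h4 : ∫⁻ y, ‖g η‖ₑ ^ 2 * ‖f y‖ₑ ^ 2 *
      ENNReal.ofReal (‖η - y‖ ^ (4 * σ + (d : ℝ) - 2)) = ‖g η‖ₑ ^ 2 *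
      ∫⁻ ζ, ‖f ζ‖ₑ ^ 2 * ENNReal.ofReal (‖ζ - η‖ ^ (4 * σ + (d : ℝ) - 2)) := by
    rw [← lintegral_const_mul _ (by fun_prop)]
    refine lintegral_congr fun y => ?_
    rw [norm_sub_rev, mul_assoc]
  simp only [h4] at h3
  exact ENNReal.lt_top_of_mul_ne_top_right h3.ne (by simpa using hη.1)

/-- For -1 < a < 0 the kernel |ζ - η|^a at one fixed η dominates a multiple of (1 + |ζ|)⁻¹. For a ≥
0 it may degenerate at ζ = η, so two centres are used: every ζ is at least half their distance away
from one of them. -/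
theorem smoothNorm_lt_top_of_energy {σ : ℝ} (hσ : (1 - (d : ℝ)) / 4 < σ) {f g : Space d → ℂ}
    (hf : Measurable f) (hg : Measurable g) (h : energy σ f g < ∞) (hg0 : ¬ g =ᵐ[volume] 0) :
    smoothNorm f < ∞ := by
  have hJ := lintegral_lt_top_of_energy hf hg h hg0
  set a : ℝ := 4 * σ + (d : ℝ) - 2 with ha
  have ha1 : -1 < a := by rw [ha]; linarith
  obtain ⟨η, hη⟩ := hJ.exists
  rcases le_or_gt 0 a with ha0 | ha0
  · obtain ⟨η', hη', hne⟩ := (hJ.and_eventually (Measure.ae_ne volume η)).exists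
    set δ : ℝ := (‖η' - η‖ / 2) ^ a with hδ
    have hδ0 : 0 < δ := by
      have := norm_pos_iff.2 (sub_ne_zero.2 hne)
      positivity
    have hle : ENNReal.ofReal δ * smoothNorm f ≤
        (∫⁻ ζ, ‖f ζ‖ₑ ^ 2 * ENNReal.ofReal (‖ζ - η‖ ^ a)) +
          ∫⁻ ζ, ‖f ζ‖ₑ ^ 2 * ENNReal.ofReal (‖ζ - η'‖ ^ a) := by
      rw [smoothNorm, ← lintegral_const_mul' _ _ ENNReal.ofReal_ne_top,
        ← lintegral_add_left (by fun_prop)]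
      refine lintegral_mono fun ζ => ?_
      rw [← mul_add, mul_left_comm, ← ENNReal.ofReal_add (by positivity) (by positivity),
        ← ENNReal.ofReal_mul hδ0.le]
      gcongr
      have h1 : (1 + ‖ζ‖)⁻¹ ≤ 1 := inv_le_one_of_one_le₀ (by linarith [norm_nonneg ζ])
      have h2 : ‖η' - η‖ ≤ ‖ζ - η‖ + ‖ζ - η'‖ := by
        have := norm_sub_le (ζ - η) (ζ - η')
        simpa using this
      have h3 : δ ≤ ‖ζ - η‖ ^ a + ‖ζ - η'‖ ^ a := by
        rcases le_total (‖ζ - η‖) (‖ζ - η'‖) with h4 | h4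
        · have : δ ≤ ‖ζ - η'‖ ^ a := Real.rpow_le_rpow (by positivity) (by linarith) ha0
          have : 0 ≤ ‖ζ - η‖ ^ a := by positivity
          linarith
        · have : δ ≤ ‖ζ - η‖ ^ a := Real.rpow_le_rpow (by positivity) (by linarith) ha0
          have : 0 ≤ ‖ζ - η'‖ ^ a := by positivity
          linarith
      calc δ * (1 + ‖ζ‖)⁻¹ ≤ δ * 1 := by gcongr
        _ ≤ _ := by linarith
    have h5 := hle.trans_lt (ENNReal.add_lt_top.2 ⟨hη, hη'⟩)
    exact ENNReal.lt_top_of_mul_ne_top_right h5.ne (by simpa using hδ0)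
  · have hle : ENNReal.ofReal (1 + ‖η‖)⁻¹ * smoothNorm f ≤
        ∫⁻ ζ, ‖f ζ‖ₑ ^ 2 * ENNReal.ofReal (‖ζ - η‖ ^ a) := by
      rw [smoothNorm, ← lintegral_const_mul' _ _ ENNReal.ofReal_ne_top]
      refine lintegral_mono_ae ?_
      filter_upwards [Measure.ae_ne volume η] with ζ hζ
      rw [mul_left_comm, ← ENNReal.ofReal_mul (by positivity)]
      gcongr
      have h0 := norm_pos_iff.2 (sub_ne_zero.2 hζ)
      have h1 : ‖ζ - η‖ ≤ (1 + ‖η‖) * (1 + ‖ζ‖) := by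
        have := norm_sub_le ζ η
        nlinarith [norm_nonneg ζ, norm_nonneg η]
      have h2 : 1 ≤ (1 + ‖η‖) * (1 + ‖ζ‖) := by nlinarith [norm_nonneg ζ, norm_nonneg η]
      calc (1 + ‖η‖)⁻¹ * (1 + ‖ζ‖)⁻¹ = ((1 + ‖η‖) * (1 + ‖ζ‖)) ^ (-1 : ℝ) := by
            rw [Real.rpow_neg_one, mul_inv]
        _ ≤ ((1 + ‖η‖) * (1 + ‖ζ‖)) ^ a := Real.rpow_le_rpow_of_exponent_le h2 ha1.le
        _ ≤ ‖ζ - η‖ ^ a := Real.rpow_le_rpow_of_nonpos h0 h1 ha0.le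
    exact ENNReal.lt_top_of_mul_ne_top_right (hle.trans_lt hη).ne (by simp; positivity)

end

/-! ### Vanishing defect and the exchange symmetry -/

section

variable {d : ℕ} [NeZero d]

theorem lintegral_norm_rpow_mul_exp_lt_top {a b : ℝ} (ha : -(d : ℝ) < a) (hb : 0 < b) :
    ∫⁻ x : Space d, ENNReal.ofReal (‖x‖ ^ a * Real.exp (-b * ‖x‖ ^ 2)) < ∞ := by
  rw [lintegral_polar (by fun_prop)]
  have h1 : ∀ e : Metric.sphere (0 : Space d) 1, (∫⁻ r in Ioi (0 : ℝ), ENNReal.ofReal (r ^ (d - 1)) *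
      ENNReal.ofReal (‖r • (e : Space d)‖ ^ a * Real.exp (-b * ‖r • (e : Space d)‖ ^ 2))) =
      ∫⁻ r in Ioi (0 : ℝ), ENNReal.ofReal (r ^ (d - 1 + a) * Real.exp (-b * r ^ 2)) := fun e => by
    refine setLIntegral_congr_fun measurableSet_Ioi fun r hr => ?_
    have hr : 0 < r := hr
    have he : ‖r • (e : Space d)‖ = r := by
      rw [norm_smul, norm_eq_of_mem_sphere e, Real.norm_of_nonneg hr.le, mul_one]
    have hd : ((d - 1 : ℕ) : ℝ) = d - 1 := by
      rw [Nat.cast_sub NeZero.one_le]; simp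
    rw [he, ← ENNReal.ofReal_mul (by positivity), Real.rpow_add hr, ← hd, Real.rpow_natCast,
      mul_assoc]
  simp only [h1, lintegral_const]
  refine ENNReal.mul_lt_top ?_ (measure_lt_top _ _)
  exact (integrableOn_rpow_mul_exp_neg_mul_sq hb (by linarith : -1 < d - 1 + a)).lintegral_lt_top

theorem measurable_totalDefect_integrand (a : ℝ) {f g : Space d → ℂ} (hf : Measurable f)
    (hg : Measurable g) : Measurable fun q : Space d × (Space d × Space d) =>
      posPow a ⟪q.1, q.2.1 - q.2.2⟫ * exchangeDefect f g q.1 q.2 := by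
  have h1 : Measurable fun q : Space d × (Space d × Space d) => exchangeDefect f g q.1 q.2 :=
    measurable_exchangeDefect hf hg
  have h2 : Measurable fun q : Space d × (Space d × Space d) => posPow a ⟪q.1, q.2.1 - q.2.2⟫ := by
    fun_prop
  exact h2.mul h1

theorem exchange_neg (ξ : Space d) : exchange (-ξ) = exchange ξ := by
  funext z
  simp [exchange, neg_div]

/-- The weight is homogeneous in ξ and the exchange depends only on the line of ξ, so vanishing over
the sphere extends along rays. -/
theorem lintegral_defect_eq_zero {a : ℝ} {f g : Space d → ℂ} (hf : Measurable f)
    (hg : Measurable g) (h : totalDefect a f g = 0) :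
    ∫⁻ ξ : Space d, ∫⁻ z : Space d × Space d,
      posPow a ⟪ξ, z.1 - z.2⟫ * exchangeDefect f g ξ z = 0 := by
  have hm := (measurable_totalDefect_integrand a hf hg).lintegral_prod_right'
    (ν := (volume : Measure (Space d × Space d)))
  rw [lintegral_polar hm]
  have hms : Measurable fun e : Metric.sphere (0 : Space d) 1 => ∫⁻ z : Space d × Space d,
      posPow a ⟪(e : Space d), z.1 - z.2⟫ * exchangeDefect f g e z := hm.comp measurable_subtype_coe
  have h0 := (lintegral_eq_zero_iff hms).1 h
  refine lintegral_eq_zero_of_ae_eq_zero ?_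
  filter_upwards [h0] with e he
  have he : ∫⁻ z : Space d × Space d,
      posPow a ⟪(e : Space d), z.1 - z.2⟫ * exchangeDefect f g e z = 0 := he
  refine setLIntegral_eq_zero measurableSet_Ioi fun r hr => ?_
  have hr : 0 < r := hr
  have h1 : ∀ z : Space d × Space d, posPow a ⟪r • (e : Space d), z.1 - z.2⟫ *
      exchangeDefect f g (r • (e : Space d)) z = ENNReal.ofReal (r ^ a) *
      (posPow a ⟪(e : Space d), z.1 - z.2⟫ * exchangeDefect f g e z) := fun z => by
    rw [real_inner_smul_left, posPow_mul hr, mul_assoc]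
    simp only [exchangeDefect, exchange_smul hr]
  simp only [h1]
  rw [lintegral_const_mul' _ _ ENNReal.ofReal_ne_top, he]
  simp

theorem ae_inner_sub_ne_zero {ξ : Space d} (hξ : ξ ≠ 0) :
    ∀ᵐ z : Space d × Space d, ⟪ξ, z.1 - z.2⟫ ≠ 0 := by
  have h2 : MeasurableSet {z : Space d × Space d | ⟪ξ, z.1 - z.2⟫ ≠ 0} :=
    (measurableSet_eq_fun (by fun_prop) measurable_const).compl
  rw [Measure.volume_eq_prod, Measure.ae_prod_iff_ae_ae h2]
  refine Eventually.of_forall fun x => ?_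
  have h3 : (LinearMap.ker (innerSL ℝ ξ).toLinearMap : Submodule ℝ (Space d)) ≠ ⊤ := by
    intro h
    have : ξ ∈ LinearMap.ker (innerSL ℝ ξ).toLinearMap := h ▸ Submodule.mem_top
    simp at this
    exact hξ this
  have h4 := Measure.addHaar_submodule (volume : Measure (Space d)) _ h3
  have h5 : ∀ᵐ y : Space d, y ∉ (LinearMap.ker (innerSL ℝ ξ).toLinearMap : Submodule ℝ (Space d)) :=
    measure_eq_zero_iff_ae_notMem.1 h4
  have h6 := (quasiMeasurePreserving_sub_left (volume : Measure (Space d)) x).ae h5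
  filter_upwards [h6] with y hy
  simpa using hy

/-- The weight sees only the pairs with ⟨ξ, z.1 - z.2⟩ > 0. Since `-ξ` defines the same exchange, it
covers the opposite half-space, and the hyperplane in between is null. -/
theorem ae_exchange_eq {a : ℝ} {f g : Space d → ℂ} (hf : Measurable f)
    (hg : Measurable g) (h : totalDefect a f g = 0) :
    ∀ᵐ ξ : Space d, ∀ᵐ z : Space d × Space d,
      f z.1 * g z.2 = f (exchange ξ z).1 * g (exchange ξ z).2 := by
  have hm := (measurable_totalDefect_integrand a hf hg).lintegral_prod_right'
    (ν := (volume : Measure (Space d × Space d)))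
  have h0 := (lintegral_eq_zero_iff hm).1 (lintegral_defect_eq_zero hf hg h)
  have h1 : ∀ᵐ ξ : Space d, ∀ᵐ z : Space d × Space d, 0 < ⟪ξ, z.1 - z.2⟫ →
      f z.1 * g z.2 = f (exchange ξ z).1 * g (exchange ξ z).2 := by
    filter_upwards [h0] with ξ hξ
    have hms := (measurable_totalDefect_integrand a hf hg).comp (measurable_prodMk_left (x := ξ))
    filter_upwards [(lintegral_eq_zero_iff hms).1 hξ] with z hz hpos
    have hz : posPow a ⟪ξ, z.1 - z.2⟫ * exchangeDefect f g ξ z = 0 := hz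
    have hp : posPow a ⟪ξ, z.1 - z.2⟫ ≠ 0 := by
      rw [posPow, indicator_of_mem (mem_Ioi.2 hpos)]
      simp only [ne_eq, ENNReal.ofReal_eq_zero, not_le]
      positivity
    have h2 := (mul_eq_zero.1 hz).resolve_left hp
    rw [exchangeDefect] at h2
    simpa [sub_eq_zero] using h2
  have h2 : ∀ᵐ ξ : Space d, ∀ᵐ z : Space d × Space d, 0 < ⟪-ξ, z.1 - z.2⟫ →
      f z.1 * g z.2 = f (exchange (-ξ) z).1 * g (exchange (-ξ) z).2 :=
    (Measure.measurePreserving_neg (volume : Measure (Space d))).quasiMeasurePreserving.ae h1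
  filter_upwards [h1, h2, Measure.ae_ne (volume : Measure (Space d)) 0] with ξ hξ1 hξ2 hξ0
  filter_upwards [hξ1, hξ2, ae_inner_sub_ne_zero hξ0] with z hz1 hz2 hz0
  rcases lt_or_gt_of_ne hz0 with h3 | h3
  · rw [exchange_neg] at hz2
    exact hz2 (by rw [inner_neg_left]; linarith)
  · exact hz1 h3

theorem exchange_exchange {ξ : Space d} (hξ : ξ ≠ 0) (z : Space d × Space d) :
    exchange ξ (exchange ξ z) = z := by
  have h0 : ‖ξ‖ ^ 2 ≠ 0 := by have := norm_pos_iff.2 hξ; positivity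
  set c := ⟪ξ, z.1 - z.2⟫ / ‖ξ‖ ^ 2 with hc
  have h1 : ⟪ξ, (exchange ξ z).1 - (exchange ξ z).2⟫ / ‖ξ‖ ^ 2 = c := by
    simp only [exchange, ← hc]
    have e : z.2 + c • ξ - (z.1 - c • ξ) = -(z.1 - z.2) + (2 * c) • ξ := by
      rw [two_mul, add_smul]; abel
    have hc' : ⟪ξ, z.1 - z.2⟫ = c * ‖ξ‖ ^ 2 := by rw [hc]; field_simp
    rw [e, inner_add_right, inner_neg_right, inner_smul_right, real_inner_self_eq_norm_sq, hc']
    field_simp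
    ring
  rw [exchange, h1]
  simp only [exchange, ← hc]
  simp

theorem norm_exchange_sq {ξ : Space d} (hξ : ξ ≠ 0) (z : Space d × Space d) :
    ‖(exchange ξ z).1‖ ^ 2 + ‖(exchange ξ z).2‖ ^ 2 = ‖z.1‖ ^ 2 + ‖z.2‖ ^ 2 := by
  have h0 : ‖ξ‖ ^ 2 ≠ 0 := by have := norm_pos_iff.2 hξ; positivity
  simp only [exchange]
  set c := ⟪ξ, z.1 - z.2⟫ / ‖ξ‖ ^ 2 with hc
  have hc' : ⟪ξ, z.1⟫ - ⟪ξ, z.2⟫ = c * ‖ξ‖ ^ 2 := by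
    rw [← inner_sub_right, hc]; field_simp
  rw [norm_add_sq_real, norm_sub_sq_real, norm_smul, inner_smul_right, inner_smul_right, mul_pow,
    Real.norm_eq_abs, sq_abs, real_inner_comm ξ z.1, real_inner_comm ξ z.2]
  linear_combination (-2 * c) * hc'

theorem exchange_fst_add_snd (ξ : Space d) (z : Space d × Space d) :
    (exchange ξ z).1 + (exchange ξ z).2 = z.1 + z.2 := by
  simp only [exchange]; abel

/-- Self-adjointness; for a measure-preserving involution this gives commutation with the Fourier
transform on pairs. -/
theorem inner_exchange (ξ : Space d) (z w : Space d × Space d) :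
    ⟪(exchange ξ z).1, w.1⟫ + ⟪(exchange ξ z).2, w.2⟫ =
      ⟪z.1, (exchange ξ w).1⟫ + ⟪z.2, (exchange ξ w).2⟫ := by
  simp only [exchange, inner_add_left, inner_sub_left, inner_add_right, inner_sub_right,
    inner_smul_left, inner_smul_right, real_inner_comm ξ z.1, real_inner_comm ξ z.2]
  simp only [conj_trivial]
  ring

/-- The exchange as a linear map. -/
def exchangeLinear (ξ : Space d) : (Space d × Space d) →ₗ[ℝ] (Space d × Space d) where
  toFun := exchange ξ
  map_add' z w := by
    have e : z.1 + w.1 - (z.2 + w.2) = (z.1 - z.2) + (w.1 - w.2) := by abel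
    simp only [exchange, Prod.fst_add, Prod.snd_add, e, inner_add_right, add_div, add_smul]
    ext1 <;> simp only [Prod.fst_add, Prod.snd_add] <;> abel
  map_smul' r z := by
    simp only [exchange, Prod.smul_fst, Prod.smul_snd, ← smul_sub, inner_smul_right, mul_div_assoc,
      mul_smul, RingHom.id_apply]
    ext1 <;> simp only [Prod.smul_fst, Prod.smul_snd, smul_add, smul_sub]

/-- A linear involution has determinant 1 or -1. -/
theorem measurePreserving_exchange {ξ : Space d} (hξ : ξ ≠ 0) :
    MeasurePreserving (exchange ξ) := by
  have : (volume : Measure (Space d × Space d)).IsAddHaarMeasure := by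
    rw [Measure.volume_eq_prod]; infer_instance
  have h1 : exchangeLinear ξ ∘ₗ exchangeLinear ξ = LinearMap.id :=
    LinearMap.ext fun z => exchange_exchange hξ z
  have h2 : LinearMap.det (exchangeLinear ξ) * LinearMap.det (exchangeLinear ξ) = 1 := by
    rw [← LinearMap.det_comp, h1, LinearMap.det_id]
  have h3 : LinearMap.det (exchangeLinear ξ) ≠ 0 := left_ne_zero_of_mul_eq_one h2
  have h4 : |LinearMap.det (exchangeLinear ξ)| = 1 := by
    rw [← abs_mul_abs_self] at h2
    nlinarith [abs_nonneg (LinearMap.det (exchangeLinear ξ))]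
  refine ⟨measurable_exchange.comp measurable_prodMk_left, ?_⟩
  have h5 := Measure.map_linearMap_addHaar_eq_smul_addHaar
    (volume : Measure (Space d × Space d)) h3
  rw [abs_inv, h4, inv_one, ENNReal.ofReal_one, one_smul] at h5
  exact h5

end

/-! ### The functional equation on rectangles -/

section

section Rectangles

variable {E : Type*} [NormedAddCommGroup E] [InnerProductSpace ℝ E] [FiniteDimensional ℝ E]

theorem exists_orthogonal_norm_eq (hE : 2 ≤ Module.finrank ℝ E) (x : E) :
    ∃ y : E, ⟪x, y⟫ = 0 ∧ ‖y‖ = ‖x‖ := by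
  have h1 := Submodule.finrank_add_finrank_orthogonal (ℝ ∙ x)
  have h2 : Module.finrank ℝ (ℝ ∙ x) ≤ 1 := (finrank_span_le_card {x}).trans (by simp)
  have h3 : 0 < Module.finrank ℝ (ℝ ∙ x)ᗮ := by omega
  have := Module.finrank_pos_iff.1 h3
  obtain ⟨⟨v, hv⟩, hv0⟩ := exists_ne (0 : (ℝ ∙ x)ᗮ)
  have hv0' : ‖v‖ ≠ 0 := by simpa using hv0
  refine ⟨(‖x‖ / ‖v‖) • v, ?_, ?_⟩
  · rw [inner_smul_right, Submodule.mem_orthogonal_singleton_iff_inner_right.1 hv, mul_zero]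
  · rw [norm_smul, Real.norm_of_nonneg (by positivity), div_mul_cancel₀ _ hv0']

variable {h : E → ℂ}

/-- Otherwise let `z` be a zero nearest to `o`, and take a square with diagonal from `o` to `z`. The
product over that diagonal vanishes, so one of the other two corners is a zero, nearer to `o` by the
factor √2. -/
theorem ne_zero_of_rectangles (hE : 2 ≤ Module.finrank ℝ E) (hh : Continuous h)
    (hne : ∃ o, h o ≠ 0)
    (heq : ∀ m x y, ‖x‖ = ‖y‖ → h (m + x) * h (m - x) = h (m + y) * h (m - y)) (p : E) :
    h p ≠ 0 := by
  obtain ⟨o, ho⟩ := hne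
  intro hp
  have hZ : IsClosed {p | h p = 0} := isClosed_eq hh continuous_const
  obtain ⟨z, hz, hzd⟩ := hZ.exists_infDist_eq_dist ⟨p, hp⟩ o
  have hz : h z = 0 := hz
  have hzo : z ≠ o := fun e => ho (e ▸ hz)
  obtain ⟨y, hy1, hy2⟩ := exists_orthogonal_norm_eq hE ((1 / 2 : ℝ) • (z - o))
  have h1 := heq ((1 / 2 : ℝ) • (z + o)) ((1 / 2 : ℝ) • (z - o)) y hy2.symm
  have e1 : (1 / 2 : ℝ) • (z + o) + (1 / 2 : ℝ) • (z - o) = z := by module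
  have hn : ‖(1 / 2 : ℝ) • (z - o)‖ = ‖z - o‖ / 2 := by
    rw [norm_smul, Real.norm_of_nonneg (by norm_num)]; ring
  have hpos : 0 < ‖z - o‖ := norm_pos_iff.2 (sub_ne_zero.2 hzo)
  rw [e1, hz, zero_mul] at h1
  have key : ∀ w, h w = 0 → ‖w - o‖ ^ 2 = ‖z - o‖ ^ 2 / 2 → False := by
    intro w hw hwo
    have h2 := Metric.infDist_le_dist_of_mem (x := o) (show w ∈ {p | h p = 0} from hw)
    rw [hzd, dist_comm, dist_comm o, dist_eq_norm, dist_eq_norm] at h2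
    nlinarith [norm_nonneg (w - o)]
  have e2 : ∀ y' : E, ⟪(1 / 2 : ℝ) • (z - o), y'⟫ = 0 → ‖y'‖ = ‖z - o‖ / 2 →
      ‖(1 / 2 : ℝ) • (z + o) + y' - o‖ ^ 2 = ‖z - o‖ ^ 2 / 2 := by
    intro y' h3 h4
    have : (1 / 2 : ℝ) • (z + o) + y' - o = (1 / 2 : ℝ) • (z - o) + y' := by module
    rw [this, norm_add_sq_real, h3, hn, h4]
    ring
  rcases mul_eq_zero.1 h1.symm with h2 | h2
  · exact key _ h2 (e2 y hy1 (hy2.trans hn))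
  · rw [sub_eq_add_neg] at h2
    exact key _ h2 (e2 (-y) (by rw [inner_neg_right, hy1, neg_zero])
      (by rw [norm_neg]; exact hy2.trans hn))

/-- Rotate the segment from `q` to `p` about its midpoint in the plane of `p - q` and `w`. The
product of the values at its ends is constant; differentiating at angle zero gives the claim, as the
ends start in opposite directions along `w`. -/
theorem logDeriv_eq_of_rectangles (hh : Differentiable ℝ h) (hne : ∀ p, h p ≠ 0)
    (heq : ∀ m x y, ‖x‖ = ‖y‖ → h (m + x) * h (m - x) = h (m + y) * h (m - y))
    (p q w : E) (hw : ⟪p - q, w⟫ = 0) :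
    (h p)⁻¹ * fderiv ℝ h p w = (h q)⁻¹ * fderiv ℝ h q w := by
  by_cases hpq : p = q
  · rw [hpq]
  by_cases hw0 : w = 0
  · simp [hw0]
  have hw0' : ‖w‖ ≠ 0 := norm_ne_zero_iff.2 hw0
  set m : E := (1 / 2 : ℝ) • (p + q) with hm
  set x : E := (1 / 2 : ℝ) • (p - q) with hx
  have hx0 : ‖x‖ ≠ 0 := by
    rw [norm_ne_zero_iff, hx]
    exact smul_ne_zero (by norm_num) (sub_ne_zero.2 hpq)
  -- The scaling gives `r • w` the length of `x`, so that the combinations with cosine and sine run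
  -- through a circle.
  set r : ℝ := ‖x‖ / ‖w‖ with hr
  have hr0 : r ≠ 0 := div_ne_zero hx0 hw0'
  have hxw : ⟪x, r • w⟫ = 0 := by rw [hx, inner_smul_left, inner_smul_right, hw]; simp
  have hrw : ‖r • w‖ = ‖x‖ := by
    rw [norm_smul, Real.norm_of_nonneg (by positivity), hr, div_mul_cancel₀ _ hw0']
  have hmx : m + x = p := by rw [hm, hx]; module
  have hmx' : m - x = q := by rw [hm, hx]; module
  have hc : ∀ θ : ℝ, ‖Real.cos θ • x + Real.sin θ • r • w‖ = ‖x‖ := by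
    intro θ
    have : ‖Real.cos θ • x + Real.sin θ • r • w‖ ^ 2 = ‖x‖ ^ 2 := by
      rw [norm_add_sq_real, inner_smul_left, inner_smul_right, hxw, norm_smul (Real.cos θ), norm_smul (Real.sin θ), hrw,
        mul_pow, mul_pow, Real.norm_eq_abs, Real.norm_eq_abs, sq_abs, sq_abs]
      have := Real.sin_sq_add_cos_sq θ
      linear_combination (‖x‖ ^ 2) * this
    exact (sq_eq_sq₀ (norm_nonneg _) (norm_nonneg _)).1 this
  have hy : HasDerivAt (fun θ : ℝ => Real.cos θ • x + Real.sin θ • r • w) (r • w) 0 := by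
    have := ((Real.hasDerivAt_cos 0).smul_const x).add ((Real.hasDerivAt_sin 0).smul_const (r • w))
    refine HasDerivAt.congr_deriv this ?_
    simp
  have hy0 : Real.cos 0 • x + Real.sin 0 • r • w = x := by simp
  have hp : HasDerivAt (fun θ : ℝ => h (m + (Real.cos θ • x + Real.sin θ • r • w)))
      (fderiv ℝ h p (r • w)) 0 := by
    have h1 : HasFDerivAt h (fderiv ℝ h p) (m + (Real.cos 0 • x + Real.sin 0 • r • w)) := by
      rw [hy0, hmx]; exact (hh p).hasFDerivAt
    exact h1.comp_hasDerivAt 0 (hy.const_add m)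
  have hq : HasDerivAt (fun θ : ℝ => h (m - (Real.cos θ • x + Real.sin θ • r • w)))
      (fderiv ℝ h q (-(r • w))) 0 := by
    have h1 : HasFDerivAt h (fderiv ℝ h q) (m - (Real.cos 0 • x + Real.sin 0 • r • w)) := by
      rw [hy0, hmx']; exact (hh q).hasFDerivAt
    exact h1.comp_hasDerivAt 0 (hy.const_sub m)
  have hprod := hp.mul hq
  have hconst : (fun θ : ℝ => h (m + (Real.cos θ • x + Real.sin θ • r • w)) *
      h (m - (Real.cos θ • x + Real.sin θ • r • w))) = fun _ => h p * h q := by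
    funext θ
    rw [← heq m x _ (hc θ).symm, hmx, hmx']
  have hz := hprod.unique (by
    have := hasDerivAt_const (0 : ℝ) (h p * h q)
    rw [← hconst] at this
    exact this)
  rw [hy0, hmx, hmx', map_neg, map_smul, map_smul, Complex.real_smul, Complex.real_smul] at hz
  have hr0' : (r : ℂ) ≠ 0 := Complex.ofReal_ne_zero.2 hr0
  have h1 := hne p
  have h2 := hne q
  have h3 : fderiv ℝ h p w * h q = h p * fderiv ℝ h q w := by
    apply mul_left_cancel₀ hr0'
    linear_combination hz
  field_simp
  linear_combination h3

/-- A field of linear forms whose increments are proportional to the increments of the point is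
affine. -/
theorem exists_eq_inner_of_increments (hE : 2 ≤ Module.finrank ℝ E) (M : E → E →L[ℝ] ℂ)
    (h0 : M 0 = 0) (hM : ∀ p q w, ⟪p - q, w⟫ = 0 → M p w = M q w) :
    ∃ α : ℂ, ∀ p v, M p v = α * (⟪p, v⟫ : ℝ) := by
  have hnt : 0 < Module.finrank ℝ E := by omega
  have := Module.finrank_pos_iff.1 hnt
  set c : E → ℂ := fun p => M p p / (‖p‖ ^ 2 : ℝ) with hc
  -- Comparison with the point 0 shows that `M p` vanishes on the orthogonal complement of `p`. What
  -- remains is that `c` is constant.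
  have hMc : ∀ p, p ≠ 0 → ∀ v, M p v = c p * (⟪p, v⟫ : ℝ) := by
    intro p hp v
    have hn : ‖p‖ ^ 2 ≠ 0 := by have := norm_pos_iff.2 hp; positivity
    have h1 := hM p 0 (v - (⟪p, v⟫ / ‖p‖ ^ 2) • p) (by
      rw [sub_zero, inner_sub_right, inner_smul_right, real_inner_self_eq_norm_sq]
      field_simp
      ring)
    rw [h0, zero_apply, map_sub, map_smul, sub_eq_zero, Complex.real_smul] at h1
    rw [h1, hc]
    push_cast
    ring
  have hcc : ∀ p q, ⟪p, q⟫ ^ 2 ≠ ‖p‖ ^ 2 * ‖q‖ ^ 2 → c p = c q := by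
    intro p q hpq
    have hp : p ≠ 0 := by rintro rfl; simp at hpq
    have hq : q ≠ 0 := by rintro rfl; simp at hpq
    -- A multiple of the part of `p` orthogonal to `p - q`; its inner product with `p` is the Gram
    -- determinant of `p` and `q`.
    set w : E := (‖p - q‖ ^ 2) • p - ⟪p, p - q⟫ • (p - q) with hw
    have hw0 : ⟪p - q, w⟫ = 0 := by
      rw [hw, inner_sub_right, inner_smul_right, inner_smul_right, real_inner_self_eq_norm_sq,
        real_inner_comm p (p - q)]
      ring
    have h1 : ⟪p, w⟫ = ⟪q, w⟫ := by rw [← sub_eq_zero, ← inner_sub_left, hw0]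
    have h2 : ⟪p, w⟫ ≠ 0 := by
      have : ⟪p, w⟫ = ‖p‖ ^ 2 * ‖q‖ ^ 2 - ⟪p, q⟫ ^ 2 := by
        rw [hw, inner_sub_right, inner_smul_right, inner_smul_right, inner_sub_right,
          real_inner_self_eq_norm_sq, norm_sub_sq_real]
        ring
      rw [this, sub_ne_zero]
      exact hpq.symm
    have h3 := hM p q w hw0
    rw [hMc p hp, hMc q hq, ← h1] at h3
    exact mul_right_cancel₀ (Complex.ofReal_ne_zero.2 h2) h3
  obtain ⟨e, he⟩ := exists_ne (0 : E)
  obtain ⟨e', he1, he2⟩ := exists_orthogonal_norm_eq hE e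
  have hn : 0 < ‖e‖ := norm_pos_iff.2 he
  have hee : c e' = c e := by
    refine hcc _ _ ?_
    rw [real_inner_comm, he1, he2]
    have : 0 < ‖e‖ ^ 2 * ‖e‖ ^ 2 := by positivity
    rw [zero_pow two_ne_zero]
    exact this.ne
  refine ⟨c e, fun p v => ?_⟩
  by_cases hp : p = 0
  · simp [hp, h0]
  have hp0 : 0 < ‖p‖ := norm_pos_iff.2 hp
  rw [hMc p hp]
  congr 1
  by_cases h1 : ⟪p, e⟫ ^ 2 = ‖p‖ ^ 2 * ‖e‖ ^ 2
  -- A `p` parallel to `e` is compared with the orthogonal vector `e'` instead: by Bessel's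
  -- inequality it cannot be parallel to both.
  · rw [← hee]
    refine hcc _ _ fun h2 => ?_
    rw [he2] at h2
    have h3 : 0 ≤ ‖‖e‖ ^ 2 • p - ⟪p, e⟫ • e - ⟪p, e'⟫ • e'‖ ^ 2 := by positivity
    rw [norm_sub_sq_real, norm_sub_sq_real, inner_sub_left, inner_smul_left, inner_smul_left,
      inner_smul_left, inner_smul_right, inner_smul_right, inner_smul_right, he1, norm_smul,
      norm_smul, norm_smul, mul_pow, mul_pow, mul_pow, Real.norm_eq_abs, Real.norm_eq_abs,
      Real.norm_eq_abs, sq_abs, sq_abs, sq_abs, he2] at h3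
    simp only [conj_trivial] at h3
    have h4 : 0 < ‖p‖ ^ 2 * ‖e‖ ^ 2 * ‖e‖ ^ 2 := by positivity
    have h5 : (‖e‖ ^ 2) ^ 2 * ‖p‖ ^ 2 - ⟪p, e⟫ ^ 2 * ‖e‖ ^ 2 - ⟪p, e'⟫ ^ 2 * ‖e‖ ^ 2 ≥ 0 := by
      linarith
    rw [h1, h2] at h5
    linarith
  · exact hcc _ _ h1

/-- The logarithmic derivative is affine, hence the derivative of a quadratic function `G`, and then
`h * exp (-G)` is constant. -/
theorem gaussian_of_rectangles (hE : 2 ≤ Module.finrank ℝ E) (hh : Differentiable ℝ h)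
    (hne : ∃ o, h o ≠ 0)
    (heq : ∀ m x y, ‖x‖ = ‖y‖ → h (m + x) * h (m - x) = h (m + y) * h (m - y)) :
    ∃ (A C : ℂ) (B : E →L[ℝ] ℂ), ∀ p, h p = Complex.exp (A * (‖p‖ ^ 2 : ℝ) + B p + C) := by
  have hne' := ne_zero_of_rectangles hE hh.continuous hne heq
  have hL := logDeriv_eq_of_rectangles hh hne' heq
  set L : E → E →L[ℝ] ℂ := fun p => (h p)⁻¹ • fderiv ℝ h p with hLd
  obtain ⟨α, hα⟩ := exists_eq_inner_of_increments hE (fun p => L p - L 0) (sub_self _)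
    (fun p q w hw => by
      have := hL p q w hw
      simp only [hLd, sub_apply, smul_apply, smul_eq_mul]
      rw [this])
  set G : E → ℂ := fun p => α / 2 * (‖p‖ ^ 2 : ℝ) + L 0 p with hG
  have hGd : ∀ p, HasFDerivAt G (L p) p := by
    intro p
    have h1 : HasFDerivAt (fun p : E => ‖p‖ ^ 2) (2 • innerSL ℝ p) p :=
      (hasStrictFDerivAt_norm_sq p).hasFDerivAt
    have h2 := ((Complex.ofRealCLM.hasFDerivAt (x := ‖p‖ ^ 2)).comp p h1).const_mul (α / 2)
    have h3 := h2.add (L 0).hasFDerivAt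
    refine h3.congr_fderiv ?_
    ext v
    have := hα p v
    simp only [sub_apply] at this
    simp
    linear_combination -this
  have hconst : ∀ p, h p * Complex.exp (-G p) = h 0 * Complex.exp (-G 0) := by
    intro p
    refine is_const_of_fderiv_eq_zero (𝕜 := ℝ) (f := fun p => h p * Complex.exp (-G p)) ?_ ?_ p 0
    · exact fun x => ((hh x).hasFDerivAt.mul (hGd x).neg.cexp).differentiableAt
    · intro x
      refine ((hh x).hasFDerivAt.mul (hGd x).neg.cexp).fderiv.trans ?_
      ext v
      have := hne' x
      simp [hLd]
      field_simp
      ring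
  refine ⟨α / 2, Complex.log (h 0), L 0, fun p => ?_⟩
  have h1 := hconst p
  have hG0 : G 0 = 0 := by simp [hG]
  rw [hG0, neg_zero, Complex.exp_zero, mul_one, Complex.exp_neg,
    mul_inv_eq_iff_eq_mul₀ (Complex.exp_ne_zero _)] at h1
  rw [h1, Complex.exp_add (_ + _), Complex.exp_log (hne' 0), mul_comm]

end Rectangles

end

/-! ### Damping, and the exchange symmetry on the Fourier side -/

section

theorem ae_eq_of_fourier_fun_eq {E : Type*} [NormedAddCommGroup E] [InnerProductSpace ℝ E]
    [FiniteDimensional ℝ E] [MeasurableSpace E] [BorelSpace E] {f g : E → ℂ} (hf : Integrable f)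
    (hg : Integrable g) (h : ∀ x, 𝓕 f x = 𝓕 g x) : f =ᵐ[volume] g := by
  have key : ∀ {k : E → ℂ}, Integrable k → ∀ φ : 𝓢(E, ℂ), ∫ x, φ x • k x =
      ∫ x, (𝓕⁻ φ) x • 𝓕 k x := by
    intro k hk φ
    have h1 := VectorFourier.integral_fourierIntegral_smul_eq_flip (L := innerₗ E) (μ := volume)
      (ν := volume) Real.continuous_fourierChar continuous_inner (𝓕⁻ φ).integrable hk
    rw [flip_innerₗ] at h1
    refine Eq.trans (integral_congr_ae (Eventually.of_forall fun x => ?_)) h1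
    have h2 : 𝓕 (𝓕⁻ φ) x = φ x := by rw [FourierTransform.fourier_fourierInv_eq]
    simp only [← h2]
    rfl
  refine ae_eq_of_integral_contDiff_smul_eq hf.locallyIntegrable hg.locallyIntegrable
    fun χ hχ hχc => ?_
  have h1 : HasCompactSupport fun p => (χ p : ℂ) :=
    hχc.comp_left (g := fun x : ℝ => (x : ℂ)) (by simp)
  let φ : 𝓢(E, ℂ) := h1.toSchwartzMap (Complex.ofRealCLM.contDiff.comp hχ)
  have h2 := key hf φ
  simp only [h, ← key hg φ] at h2
  simp only [Complex.real_smul]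
  exact h2

variable {d : ℕ} [NeZero d]

/-- The product of `f` with a Gaussian. -/
def damp (f : Space d → ℂ) (ζ : Space d) : ℂ := ((Real.exp (-‖ζ‖ ^ 2) : ℝ) : ℂ) * f ζ

theorem measurable_damp {f : Space d → ℂ} (hf : Measurable f) : Measurable (damp f) := by
  unfold damp; fun_prop

/-- Damping gives a finite first moment, hence a differentiable Fourier transform. The Gaussian is
chosen because exchanges preserve |ζ|² + |η|². -/
theorem integrable_mul_norm_damp {f : Space d → ℂ} (hf : Measurable f) (h : smoothNorm f < ∞) :
    Integrable fun ζ => (1 + ‖ζ‖) * ‖damp f ζ‖ := by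
  have hm := measurable_damp hf
  refine ⟨by fun_prop, ?_⟩
  rw [hasFiniteIntegral_iff_ofReal (Eventually.of_forall fun y => by positivity)]
  have hd : (1 : ℝ) ≤ d := by exact_mod_cast NeZero.one_le
  have h1 := lintegral_norm_rpow_mul_exp_lt_top (d := d) (a := 0) (b := 2) (by linarith) two_pos
  have h2 := lintegral_norm_rpow_mul_exp_lt_top (d := d) (a := 3) (b := 2) (by linarith) two_pos
  have hle : ∀ ζ : Space d, ENNReal.ofReal ((1 + ‖ζ‖) * ‖damp f ζ‖) ≤
      ‖f ζ‖ₑ ^ 2 * ENNReal.ofReal (1 + ‖ζ‖)⁻¹ +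
      (ENNReal.ofReal 4 * ENNReal.ofReal (‖ζ‖ ^ (0 : ℝ) * Real.exp (-2 * ‖ζ‖ ^ 2)) +
        ENNReal.ofReal 4 * ENNReal.ofReal (‖ζ‖ ^ (3 : ℝ) * Real.exp (-2 * ‖ζ‖ ^ 2))) := by
    intro ζ
    rw [enorm_sq_eq_ofReal, ← ENNReal.ofReal_mul (by positivity),
      ← ENNReal.ofReal_mul (by positivity), ← ENNReal.ofReal_mul (by positivity),
      ← ENNReal.ofReal_add (by positivity) (by positivity),
      ← ENNReal.ofReal_add (by positivity) (by positivity)]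
    refine ENNReal.ofReal_le_ofReal ?_
    have e1 : Real.exp (-2 * ‖ζ‖ ^ 2) = Real.exp (-‖ζ‖ ^ 2) ^ 2 := by
      rw [← Real.exp_nat_mul]; congr 1; push_cast; ring
    have e2 : ‖damp f ζ‖ = Real.exp (-‖ζ‖ ^ 2) * ‖f ζ‖ := by
      rw [damp, norm_mul, Complex.norm_real, Real.norm_of_nonneg (Real.exp_pos _).le]
    have e3 : ‖ζ‖ ^ (3 : ℝ) = ‖ζ‖ ^ 3 := by exact_mod_cast Real.rpow_natCast ‖ζ‖ 3
    rw [e1, e2, e3, Real.rpow_zero]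
    set t := ‖ζ‖
    set E := Real.exp (-t ^ 2)
    have ht : 0 ≤ t := norm_nonneg _
    have h3 : (1 + t) ^ 3 ≤ 4 + 4 * t ^ 3 := by nlinarith [sq_nonneg (t - 1)]
    -- The inequality of arithmetic and geometric means, from the square of |f| - (1 + t)² E.
    have h4 : (1 + t) * (E * ‖f ζ‖) ≤ ‖f ζ‖ ^ 2 * (1 + t)⁻¹ + (1 + t) ^ 3 * E ^ 2 := by
      have h5 : 0 ≤ (‖f ζ‖ - (1 + t) ^ 2 * E) ^ 2 * (1 + t)⁻¹ := by positivity
      have h6 : 0 ≤ (1 + t) * (E * ‖f ζ‖) := by positivity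
      have h7 : (‖f ζ‖ - (1 + t) ^ 2 * E) ^ 2 * (1 + t)⁻¹ = ‖f ζ‖ ^ 2 * (1 + t)⁻¹ +
          (1 + t) ^ 3 * E ^ 2 - 2 * ((1 + t) * (E * ‖f ζ‖)) := by
        field_simp
        ring
      linarith
    have h8 : (1 + t) ^ 3 * E ^ 2 ≤ (4 + 4 * t ^ 3) * E ^ 2 := by gcongr
    linarith
  refine (lintegral_mono hle).trans_lt ?_
  rw [lintegral_add_left (by fun_prop), lintegral_add_left (by fun_prop),
    lintegral_const_mul _ (by fun_prop), lintegral_const_mul _ (by fun_prop)]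
  exact ENNReal.add_lt_top.2 ⟨h, ENNReal.add_lt_top.2
    ⟨ENNReal.mul_lt_top ENNReal.ofReal_lt_top h1, ENNReal.mul_lt_top ENNReal.ofReal_lt_top h2⟩⟩

theorem integrable_damp {f : Space d → ℂ} (hf : Measurable f) (h : smoothNorm f < ∞) :
    Integrable (damp f) := by
  refine (integrable_mul_norm_damp hf h).mono' (measurable_damp hf).aestronglyMeasurable
    (Eventually.of_forall fun ζ => ?_)
  nlinarith [mul_nonneg (norm_nonneg ζ) (norm_nonneg (damp f ζ))]

theorem differentiable_fourier_damp {f : Space d → ℂ} (hf : Measurable f) (h : smoothNorm f < ∞) :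
    Differentiable ℝ (𝓕 (damp f)) := by
  refine Real.differentiable_fourier (integrable_damp hf h) ?_
  refine (integrable_mul_norm_damp hf h).mono' (by have := measurable_damp hf; fun_prop)
    (Eventually.of_forall fun ζ => ?_)
  rw [Real.norm_of_nonneg (by positivity)]
  nlinarith [norm_nonneg (damp f ζ)]

theorem fourier_mul_fourier {f g : Space d → ℂ} (p q : Space d) :
    𝓕 f p * 𝓕 g q = ∫ z : Space d × Space d,
      character (-(⟪z.1, p⟫ + ⟪z.2, q⟫)) * (f z.1 * g z.2) := by
  rw [Real.fourier_eq, Real.fourier_eq, ← integral_prod_mul, ← Measure.volume_eq_prod]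
  refine integral_congr_ae (Eventually.of_forall fun z => ?_)
  simp only [neg_add, character_add, Circle.smul_def, smul_eq_mul]
  simp only [character]
  ring

theorem fourier_exchange {f g : Space d → ℂ} (hf : Measurable f) (hg : Measurable g)
    {ξ : Space d} (hξ : ξ ≠ 0)
    (h : ∀ᵐ z : Space d × Space d, f z.1 * g z.2 = f (exchange ξ z).1 * g (exchange ξ z).2)
    (w : Space d × Space d) :
    𝓕 f (exchange ξ w).1 * 𝓕 g (exchange ξ w).2 = 𝓕 f w.1 * 𝓕 g w.2 := by
  have hT := measurePreserving_exchange hξ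
  rw [fourier_mul_fourier, fourier_mul_fourier]
  have hm : Measurable fun z : Space d × Space d =>
      character (-(⟪(exchange ξ z).1, w.1⟫ + ⟪(exchange ξ z).2, w.2⟫)) * (f z.1 * g z.2) := by
    have h1 := hT.measurable.fst
    have h2 := hT.measurable.snd
    have h3 := measurable_character
    fun_prop
  simp only [← inner_exchange]
  conv_lhs => rw [← hT.map_eq]
  rw [integral_map hT.measurable.aemeasurable hm.aestronglyMeasurable]
  refine integral_congr_ae ?_
  filter_upwards [h] with z hz
  simp only [exchange_exchange hξ, ← hz]

theorem damp_mul_damp_exchange {f g : Space d → ℂ} {ξ : Space d} (hξ : ξ ≠ 0)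
    {z : Space d × Space d}
    (h : f z.1 * g z.2 = f (exchange ξ z).1 * g (exchange ξ z).2) :
    damp f z.1 * damp g z.2 = damp f (exchange ξ z).1 * damp g (exchange ξ z).2 := by
  have h1 : Real.exp (-‖z.1‖ ^ 2) * Real.exp (-‖z.2‖ ^ 2) =
      Real.exp (-‖(exchange ξ z).1‖ ^ 2) * Real.exp (-‖(exchange ξ z).2‖ ^ 2) := by
    rw [← Real.exp_add, ← Real.exp_add]
    congr 1
    linarith [norm_exchange_sq hξ z]
  have h2 : ((Real.exp (-‖z.1‖ ^ 2) : ℝ) : ℂ) * (Real.exp (-‖z.2‖ ^ 2) : ℝ) =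
      (Real.exp (-‖(exchange ξ z).1‖ ^ 2) : ℝ) * (Real.exp (-‖(exchange ξ z).2‖ ^ 2) : ℝ) := by
    exact_mod_cast h1
  simp only [damp]
  calc _ = (((Real.exp (-‖z.1‖ ^ 2) : ℝ) : ℂ) * (Real.exp (-‖z.2‖ ^ 2) : ℝ)) * (f z.1 * g z.2) := by
        ring
    _ = _ := by rw [h2, h]; ring

/-- The expression is continuous in ξ away from 0, and a set of full measure is dense. -/
theorem exchange_of_ae {h k : Space d → ℂ} (hh : Continuous h) (hk : Continuous k)
    (w : Space d × Space d)
    (hae : ∀ᵐ ξ : Space d, h (exchange ξ w).1 * k (exchange ξ w).2 = h w.1 * k w.2)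
    {ξ : Space d} (hξ : ξ ≠ 0) :
    h (exchange ξ w).1 * k (exchange ξ w).2 = h w.1 * k w.2 := by
  by_contra hne
  have h0 : ‖ξ‖ ^ 2 ≠ 0 := by have := norm_pos_iff.2 hξ; positivity
  have hc : ContinuousAt (fun ξ : Space d => h (exchange ξ w).1 * k (exchange ξ w).2) ξ := by
    have h1 : ContinuousAt (fun ξ : Space d => ⟪ξ, w.1 - w.2⟫ / ‖ξ‖ ^ 2) ξ :=
      ContinuousAt.div (by fun_prop) (by fun_prop) h0
    refine (hh.continuousAt.comp ?_).mul (hk.continuousAt.comp ?_)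
    · exact continuousAt_const.add (h1.smul continuousAt_id)
    · exact continuousAt_const.sub (h1.smul continuousAt_id)
  have h2 := hc.eventually_ne hne
  have hd := Measure.dense_of_ae hae
  obtain ⟨x, hx1, hx2⟩ := hd.inter_nhds_nonempty h2
  exact hx2 hx1

/-- For |x| = |y| the exchange along x + y carries (m + x, m - x) to (m + y, m - y). If y = -x that
direction degenerates, and for x ≠ 0 a nonzero vector orthogonal to x is used; it exists because d ≥
2. -/
theorem rectangles_of_exchange (hd : 2 ≤ d) {h k : Space d → ℂ}
    (hT : ∀ ξ : Space d, ξ ≠ 0 → ∀ w, h (exchange ξ w).1 * k (exchange ξ w).2 = h w.1 * k w.2)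
    (m x y : Space d) (hxy : ‖x‖ = ‖y‖) : h (m + x) * k (m - x) = h (m + y) * k (m - y) := by
  have e0 : m + x - (m - x) = (2 : ℝ) • x := by module
  by_cases hs : x + y = 0
  · have hy : y = -x := (neg_eq_of_add_eq_zero_right hs).symm
    by_cases hx : x = 0
    · simp [hy, hx]
    obtain ⟨ξ, h1, h2⟩ := exists_orthogonal_norm_eq (by simpa using hd) x
    have hξ : ξ ≠ 0 := by
      rw [← norm_ne_zero_iff, h2]; exact norm_ne_zero_iff.2 hx
    have h3 := hT ξ hξ (m + x, m - x)
    simp only [exchange, e0, inner_smul_right, real_inner_comm, h1] at h3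
    simp only [mul_zero, zero_div, zero_smul, add_zero, sub_zero] at h3
    rw [← h3, hy, sub_neg_eq_add, sub_eq_add_neg]
  · have hn : ‖x + y‖ ^ 2 ≠ 0 := by have := norm_pos_iff.2 hs; positivity
    have h3 := hT (x + y) hs (m + x, m - x)
    have h4 : ⟪x + y, (2 : ℝ) • x⟫ / ‖x + y‖ ^ 2 = 1 := by
      rw [div_eq_one_iff_eq hn, inner_smul_right, inner_add_left, real_inner_self_eq_norm_sq,
        norm_add_sq_real, ← hxy, real_inner_comm y x]
      ring
    simp only [exchange, e0, h4, one_smul] at h3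
    rw [← h3]
    congr 2 <;> abel

theorem fourier_rectangles (hd : 2 ≤ d) {a : ℝ} {f g : Space d → ℂ} (hf : Measurable f)
    (hg : Measurable g) (hfs : smoothNorm f < ∞) (hgs : smoothNorm g < ∞)
    (h : totalDefect a f g = 0) (m x y : Space d) (hxy : ‖x‖ = ‖y‖) :
    𝓕 (damp f) (m + x) * 𝓕 (damp g) (m - x) = 𝓕 (damp f) (m + y) * 𝓕 (damp g) (m - y) := by
  refine rectangles_of_exchange hd (fun ξ hξ w => exchange_of_ae
    (differentiable_fourier_damp hf hfs).continuous
    (differentiable_fourier_damp hg hgs).continuous w ?_ hξ) m x y hxy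
  filter_upwards [ae_exchange_eq hf hg h, Measure.ae_ne (volume : Measure (Space d)) 0] with η h1 hη
  refine fourier_exchange (measurable_damp hf) (measurable_damp hg) hη ?_ w
  filter_upwards [h1] with z hz
  exact damp_mul_damp_exchange hη hz

/-- The choice y = -x gives h(p) k(q) = h(q) k(p). -/
theorem exists_smul_of_rectangles {E : Type*} [NormedAddCommGroup E] [InnerProductSpace ℝ E]
    {h k : E → ℂ} (hh : ∃ o, h o ≠ 0) (hk : ∃ o, k o ≠ 0)
    (heq : ∀ m x y, ‖x‖ = ‖y‖ → h (m + x) * k (m - x) = h (m + y) * k (m - y)) :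
    ∃ c : ℂ, c ≠ 0 ∧ ∀ p, k p = c * h p := by
  have hsym : ∀ p q, h p * k q = h q * k p := by
    intro p q
    have := heq ((1 / 2 : ℝ) • (p + q)) ((1 / 2 : ℝ) • (p - q)) (-((1 / 2 : ℝ) • (p - q)))
      (norm_neg _).symm
    have e1 : (1 / 2 : ℝ) • (p + q) + (1 / 2 : ℝ) • (p - q) = p := by module
    have e2 : (1 / 2 : ℝ) • (p + q) - (1 / 2 : ℝ) • (p - q) = q := by module
    rwa [sub_neg_eq_add, ← sub_eq_add_neg, e1, e2] at this
  obtain ⟨o, ho⟩ := hh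
  obtain ⟨o', ho'⟩ := hk
  have hc : ∀ p, k p = k o / h o * h p := fun p => by
    have := hsym p o
    field_simp
    linear_combination -this
  refine ⟨k o / h o, fun h0 => ho' (by rw [hc, h0, zero_mul]), hc⟩

theorem ae_eq_smul_of_fourier_damp {f : Space d → ℂ} (hf : Measurable f) (hfs : smoothNorm f < ∞)
    {g : Space d → ℂ} (hg : Measurable g) (hgs : smoothNorm g < ∞) (c : ℂ)
    (h : ∀ p, 𝓕 (damp g) p = c * 𝓕 (damp f) p) : g =ᵐ[volume] fun x => c * f x := by
  have h1 : damp g =ᵐ[volume] fun x => c * damp f x := by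
    refine ae_eq_of_fourier_fun_eq (integrable_damp hg hgs)
      ((integrable_damp hf hfs).const_mul c) fun x => ?_
    rw [h, Real.fourier_eq, Real.fourier_eq, ← integral_const_mul]
    refine integral_congr_ae (Eventually.of_forall fun v => ?_)
    simp only [Circle.smul_def, smul_eq_mul]
    ring
  filter_upwards [h1] with x hx
  have h2 : ((Real.exp (-‖x‖ ^ 2) : ℝ) : ℂ) ≠ 0 := Complex.ofReal_ne_zero.2 (Real.exp_pos _).ne'
  simp only [damp] at hx
  apply mul_left_cancel₀ h2
  rw [hx]; ring

end

/-! ### Gaussians, their Fourier transforms, and the case of zero defect -/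

section

/-- The Gaussian with quadratic, linear and constant coefficients `a`, `b`, `c`. -/
def gaussianFun {d : ℕ} (a : ℂ) (b : Fin d → ℂ) (c : ℂ) (η : Space d) : ℂ :=
  Complex.exp (a * ((‖η‖ ^ 2 : ℝ) : ℂ) + ∑ i, b i * ((η i : ℝ) : ℂ) + c)

theorem continuous_gaussianFun {d : ℕ} (a : ℂ) (b : Fin d → ℂ) (c : ℂ) :
    Continuous (gaussianFun a b c) := by
  unfold gaussianFun
  fun_prop

theorem gaussianFun_ne_zero {d : ℕ} (a : ℂ) (b : Fin d → ℂ) (c : ℂ) (η : Space d) :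
    gaussianFun a b c η ≠ 0 := Complex.exp_ne_zero _

theorem gaussianFun_smul {d : ℕ} (a : ℂ) (b : Fin d → ℂ) (c : ℂ) (r : ℝ) (η : Space d) :
    gaussianFun a b c (r • η) = gaussianFun (a * (r ^ 2 : ℝ)) (fun i => r * b i) c η := by
  simp only [gaussianFun, norm_smul, mul_pow, Real.norm_eq_abs, sq_abs, PiLp.smul_apply,
    smul_eq_mul]
  congr 3
  · push_cast; ring
  · refine Finset.sum_congr rfl fun i _ => ?_
    push_cast; ring

theorem gaussianFun_eq_toLp {d : ℕ} (a : ℂ) (b : Fin d → ℂ) (c : ℂ) (x : Fin d → ℝ) :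
    gaussianFun a b c (WithLp.toLp 2 x) =
      Complex.exp (-(-a) * ∑ i, (x i : ℂ) ^ 2 + ∑ i, b i * x i) * Complex.exp c := by
  rw [gaussianFun, EuclideanSpace.real_norm_sq_eq, ← Complex.exp_add]
  congr 3
  push_cast
  simp

theorem integrable_gaussianFun {d : ℕ} {a : ℂ} (ha : a.re < 0) (b : Fin d → ℂ) (c : ℂ) :
    Integrable (gaussianFun a b c) := by
  rw [← (PiLp.volume_preserving_toLp (Fin d)).integrable_comp
    (continuous_gaussianFun a b c).aestronglyMeasurable]
  refine ((GaussianFourier.integrable_cexp_neg_mul_sum_add (b := -a) (by simpa using ha) b).mul_const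
    (Complex.exp c)).congr (Eventually.of_forall fun x => ?_)
  exact (gaussianFun_eq_toLp a b c x).symm

theorem fourier_gaussianFun {d : ℕ} {a : ℂ} (ha : a.re < 0) (b : Fin d → ℂ) (c : ℂ) (p : Space d) :
    𝓕 (gaussianFun a b c) p = (Real.pi / (-a)) ^ (d / 2 : ℂ) *
      Complex.exp ((∑ i, (b i - 2 * Real.pi * Complex.I * p i) ^ 2) / (4 * (-a))) *
      Complex.exp c := by
  have h1 := GaussianFourier.integral_cexp_neg_mul_sum_add (b := -a) (by simpa using ha)
    (fun i => b i - 2 * Real.pi * Complex.I * p i)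
  rw [Fintype.card_fin] at h1
  rw [← h1, ← integral_mul_const, Real.fourier_eq',
    ← (PiLp.volume_preserving_toLp (Fin d)).integral_comp
      (MeasurableEquiv.toLp 2 (Fin d → ℝ)).measurableEmbedding]
  refine integral_congr_ae (Eventually.of_forall fun x => ?_)
  simp only [smul_eq_mul]
  rw [gaussianFun_eq_toLp, ← Complex.exp_add, ← Complex.exp_add, ← Complex.exp_add]
  congr 1
  have e1 : ((⟪WithLp.toLp 2 x, p⟫ : ℝ) : ℂ) = ∑ i, (p i : ℂ) * (x i : ℂ) := by
    rw [PiLp.inner_apply]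
    push_cast
    refine Finset.sum_congr rfl fun i _ => ?_
    simp
  have e2 : ∑ i, (b i - 2 * Real.pi * Complex.I * p i) * (x i : ℂ) =
      ∑ i, b i * (x i : ℂ) - 2 * Real.pi * Complex.I * ∑ i, (p i : ℂ) * (x i : ℂ) := by
    rw [Finset.mul_sum, ← Finset.sum_sub_distrib]
    refine Finset.sum_congr rfl fun i _ => ?_
    ring
  rw [e2, ← e1]
  push_cast
  ring

theorem exists_gaussianFun_of_fourier {d : ℕ} {f : Space d → ℂ} (hf : Integrable f) {A C : ℂ}
    (hA : A.re < 0) (B : Space d →L[ℝ] ℂ)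
    (h : ∀ p, 𝓕 f p = Complex.exp (A * (‖p‖ ^ 2 : ℝ) + B p + C)) :
    ∃ (a c : ℂ) (b : Fin d → ℂ), f =ᵐ[volume] gaussianFun a b c := by
  have hA0 : A ≠ 0 := by rintro rfl; simp at hA
  have hπ : (Real.pi : ℂ) ≠ 0 := Complex.ofReal_ne_zero.2 Real.pi_ne_zero
  set β : Fin d → ℂ := fun i => B (EuclideanSpace.single i 1) with hβ
  -- The coefficients come from matching with `fourier_gaussianFun`: π²/a = A and iπb/a = β, while
  -- `c` absorbs the constants.
  set a : ℂ := Real.pi ^ 2 / A with ha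
  have ha0 : a ≠ 0 := div_ne_zero (pow_ne_zero _ hπ) hA0
  have hare : a.re < 0 := by
    rw [ha, ← Complex.ofReal_pow, Complex.div_re]
    simp only [Complex.ofReal_re, Complex.ofReal_im, zero_mul, zero_div, add_zero]
    have := Complex.normSq_pos.2 hA0
    exact div_neg_of_neg_of_pos (mul_neg_of_pos_of_neg (by positivity) hA) this
  set b : Fin d → ℂ := fun i => -(β i * a * Complex.I / Real.pi) with hb
  set K : ℂ := (Real.pi / (-a)) ^ (d / 2 : ℂ) with hK
  have hK0 : K ≠ 0 := by
    rw [hK, Complex.cpow_def_of_ne_zero (div_ne_zero hπ (neg_ne_zero.2 ha0))]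
    exact Complex.exp_ne_zero _
  set c : ℂ := C - Complex.log K - (∑ i, b i ^ 2) / (4 * (-a)) with hc
  refine ⟨a, c, b, ae_eq_of_fourier_fun_eq hf (integrable_gaussianFun hare b c) fun p => ?_⟩
  rw [h, fourier_gaussianFun hare, ← hK]
  have e1 : B p = ∑ i, β i * (p i : ℂ) := by
    have : p = ∑ i, p i • EuclideanSpace.single i (1 : ℝ) := by
      simpa using ((EuclideanSpace.basisFun (Fin d) ℝ).sum_repr p).symm
    conv_lhs => rw [this]
    rw [map_sum]
    refine Finset.sum_congr rfl fun i _ => ?_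
    rw [map_smul, Complex.real_smul, mul_comm]
  have e2 : ((‖p‖ ^ 2 : ℝ) : ℂ) = ∑ i, (p i : ℂ) ^ 2 := by
    rw [EuclideanSpace.real_norm_sq_eq]
    push_cast
    simp
  have e3 : (∑ i, (b i - 2 * Real.pi * Complex.I * p i) ^ 2) / (4 * (-a)) =
      (∑ i, b i ^ 2) / (4 * (-a)) + ∑ i, β i * (p i : ℂ) + A * ∑ i, (p i : ℂ) ^ 2 := by
    rw [Finset.sum_div, Finset.sum_div, Finset.mul_sum, ← Finset.sum_add_distrib,
      ← Finset.sum_add_distrib]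
    refine Finset.sum_congr rfl fun i _ => ?_
    have hAa : A = Real.pi ^ 2 / a := by rw [ha]; field_simp
    rw [hAa, hb]
    field_simp
    have := Complex.I_sq
    linear_combination (-4 * (p i : ℂ) ^ 2 * Real.pi ^ 4 - 4 * a * β i * p i * Real.pi ^ 2 ) * this
  rw [e1, e2, e3, ← Complex.exp_log hK0, ← Complex.exp_add, ← Complex.exp_add, hc]
  congr 1
  ring


/-- In the product of the values at p and -p the linear terms cancel. With Re A ≥ 0 its modulus
would stay above a positive constant, against the Riemann-Lebesgue lemma. -/
theorem re_neg_of_fourier {d : ℕ} [NeZero d] {f : Space d → ℂ} {A C : ℂ} (B : Space d →L[ℝ] ℂ)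
    (h : ∀ p, 𝓕 f p = Complex.exp (A * (‖p‖ ^ 2 : ℝ) + B p + C)) : A.re < 0 := by
  by_contra hA
  rw [not_lt] at hA
  have h1 : Tendsto (𝓕 f) (cocompact (Space d)) (𝓝 0) := tendsto_integral_exp_inner_smul_cocompact f
  have h2 : Tendsto (fun p => 𝓕 f (-p)) (cocompact (Space d)) (𝓝 0) :=
    h1.comp (Homeomorph.neg (Space d)).isClosedEmbedding.tendsto_cocompact
  have h3 := (h1.mul h2).norm
  rw [mul_zero, norm_zero] at h3
  have : Nonempty (Fin d) := ⟨0⟩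
  have : NoncompactSpace (Space d) := NormedSpace.noncompactSpace ℝ _
  have h4 := (h3.eventually (gt_mem_nhds (Real.exp_pos (2 * C.re)))).exists
  obtain ⟨p, hp⟩ := h4
  rw [h, h, ← Complex.exp_add, Complex.norm_exp] at hp
  have h5 := Real.exp_lt_exp.1 hp
  have h6 : (A * (‖p‖ ^ 2 : ℝ) + B p + C + (A * (‖-p‖ ^ 2 : ℝ) + B (-p) + C)) =
      ((‖p‖ ^ 2 : ℝ) : ℂ) * (2 * A) + 2 * C := by
    rw [map_neg, norm_neg]; ring
  rw [h6, Complex.add_re, Complex.re_ofReal_mul] at h5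
  simp only [Complex.mul_re, Complex.re_ofNat, Complex.im_ofNat, zero_mul, sub_zero] at h5
  nlinarith [sq_nonneg ‖p‖, mul_nonneg (sq_nonneg ‖p‖) hA]

variable {d : ℕ} [NeZero d]

/-- On the ball of radius n ≥ 1 the integral is at least a constant times n^d/(1 + n), which is at
least n/2 as d ≥ 2. -/
theorem lintegral_inv_one_add_norm_eq_top (hd : 2 ≤ d) :
    ∫⁻ x : Space d, ENNReal.ofReal (1 + ‖x‖)⁻¹ = ∞ := by
  by_contra hI
  set v : ℝ≥0∞ := volume (Metric.ball (0 : Space d) 1) with hv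
  have hv0 : v ≠ 0 := (Metric.measure_ball_pos _ _ one_pos).ne'
  obtain ⟨n, hn⟩ := ENNReal.exists_nat_mul_gt (a := v * ENNReal.ofReal (1 / 2))
    (mul_ne_zero hv0 (by simp)) hI
  have hn0 : n ≠ 0 := by rintro rfl; simp at hn
  have hn1 : (1 : ℝ) ≤ n := by exact_mod_cast Nat.one_le_iff_ne_zero.2 hn0
  refine absurd hn (not_lt.2 ?_)
  have h1 : ENNReal.ofReal (1 + n : ℝ)⁻¹ * volume (Metric.ball (0 : Space d) n) ≤
      ∫⁻ x : Space d, ENNReal.ofReal (1 + ‖x‖)⁻¹ := by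
    rw [← setLIntegral_const]
    refine (setLIntegral_mono (by fun_prop) fun x hx => ?_).trans (setLIntegral_le_lintegral _ _)
    rw [mem_ball_zero_iff] at hx
    gcongr
  refine le_trans ?_ h1
  rw [Measure.addHaar_ball _ _ (by positivity), ← hv, finrank_euclideanSpace_fin,
    ← mul_assoc (ENNReal.ofReal _), ← ENNReal.ofReal_mul (by positivity),
    ← ENNReal.ofReal_natCast n, mul_comm v, ← mul_assoc, ← ENNReal.ofReal_mul (by positivity)]
  refine mul_le_mul_left (ENNReal.ofReal_le_ofReal ?_) v
  have h2 : (n : ℝ) ^ 2 ≤ (n : ℝ) ^ d := pow_le_pow_right₀ hn1 hd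
  rw [inv_mul_eq_div, le_div_iff₀ (by positivity)]
  nlinarith

/-- Adding the values at η and -η removes the linear term: if Re a ≥ 0, the sum of squared moduli is
bounded below, and the weight alone has infinite integral. -/
theorem re_neg_of_smoothNorm (hd : 2 ≤ d) {a c : ℂ} {b : Fin d → ℂ}
    (h : smoothNorm (gaussianFun a b c) < ∞) : a.re < 0 := by
  by_contra ha
  rw [not_lt] at ha
  have hm := (continuous_gaussianFun a b c).measurable
  have h1 : ENNReal.ofReal (2 * Real.exp (2 * c.re)) *
      ∫⁻ x : Space d, ENNReal.ofReal (1 + ‖x‖)⁻¹ ≤ 2 * smoothNorm (gaussianFun a b c) := by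
    have hneg : smoothNorm (gaussianFun a b c) =
        ∫⁻ η, ‖gaussianFun a b c (-η)‖ₑ ^ 2 * ENNReal.ofReal (1 + ‖η‖)⁻¹ := by
      have := (Measure.measurePreserving_neg (volume : Measure (Space d))).lintegral_comp
        (f := fun η => ‖gaussianFun a b c η‖ₑ ^ 2 * ENNReal.ofReal (1 + ‖η‖)⁻¹) (by fun_prop)
      simp only [norm_neg] at this
      exact this.symm
    rw [two_mul (smoothNorm _)]
    nth_rewrite 2 [hneg]
    rw [smoothNorm, ← lintegral_add_left (by fun_prop),
      ← lintegral_const_mul' _ _ ENNReal.ofReal_ne_top]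
    refine lintegral_mono fun η => ?_
    rw [← add_mul, enorm_sq_eq_ofReal, enorm_sq_eq_ofReal,
      ← ENNReal.ofReal_add (by positivity) (by positivity)]
    gcongr
    have h2 : Real.exp (2 * c.re) ≤ ‖gaussianFun a b c η‖ * ‖gaussianFun a b c (-η)‖ := by
      have h3 : a * ((‖η‖ ^ 2 : ℝ) : ℂ) + ∑ i, b i * ((η i : ℝ) : ℂ) + c +
          (a * ((‖-η‖ ^ 2 : ℝ) : ℂ) + ∑ i, b i * (((-η) i : ℝ) : ℂ) + c) =
          ((‖η‖ ^ 2 : ℝ) : ℂ) * (2 * a) + 2 * c := by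
        simp only [norm_neg, PiLp.neg_apply, Complex.ofReal_neg, mul_neg, Finset.sum_neg_distrib]
        ring
      rw [← norm_mul, gaussianFun, gaussianFun, ← Complex.exp_add, Complex.norm_exp, h3,
        Complex.add_re, Complex.re_ofReal_mul]
      refine Real.exp_le_exp.2 ?_
      simp only [Complex.mul_re, Complex.re_ofNat, Complex.im_ofNat, zero_mul, sub_zero]
      nlinarith [mul_nonneg (sq_nonneg ‖η‖) ha]
    nlinarith [sq_nonneg (‖gaussianFun a b c η‖ - ‖gaussianFun a b c (-η)‖)]
  rw [lintegral_inv_one_add_norm_eq_top hd, ENNReal.mul_top (by simp; positivity), top_le_iff] at h1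
  exact (ENNReal.mul_lt_top (by simp) h).ne h1

theorem exists_fourier_damp_ne_zero {f : Space d → ℂ} (hf : Measurable f) (hfs : smoothNorm f < ∞)
    (hf0 : ¬ f =ᵐ[volume] 0) : ∃ o, 𝓕 (damp f) o ≠ 0 := by
  by_contra! h
  refine hf0 ((ae_eq_smul_of_fourier_damp hf hfs hf hfs 0 fun p => ?_).trans ?_)
  · rw [h, mul_zero]
  · exact Eventually.of_forall fun x => zero_mul _

theorem gaussian_of_totalDefect_eq_zero (hd : 2 ≤ d) {s : ℝ} {f g : Space d → ℂ}
    (hf : Measurable f) (hg : Measurable g) (hfs : smoothNorm f < ∞) (hgs : smoothNorm g < ∞)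
    (hf0 : ¬ f =ᵐ[volume] 0) (hg0 : ¬ g =ᵐ[volume] 0) (h : totalDefect s f g = 0) :
    (∃ (a c : ℂ) (b : Fin d → ℂ), a.re < 0 ∧ f =ᵐ[volume] gaussianFun a b c) ∧
      ∃ k : ℂ, g =ᵐ[volume] fun x => k * f x := by
  have hrect := fourier_rectangles hd hf hg hfs hgs h
  have hfn := exists_fourier_damp_ne_zero hf hfs hf0
  obtain ⟨k, hk0, hk⟩ := exists_smul_of_rectangles hfn (exists_fourier_damp_ne_zero hg hgs hg0) hrect
  refine ⟨?_, k, ae_eq_smul_of_fourier_damp hf hfs hg hgs k hk⟩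
  obtain ⟨A, C, B, hABC⟩ := gaussian_of_rectangles (by simpa using hd)
    (differentiable_fourier_damp hf hfs) hfn (fun m x y hxy => by
      have := hrect m x y hxy
      rw [hk, hk] at this
      apply mul_left_cancel₀ hk0
      linear_combination this)
  obtain ⟨a, c, b, hab⟩ := exists_gaussianFun_of_fourier (integrable_damp hf hfs)
    (re_neg_of_fourier B hABC) B hABC
  -- Undoing the damping adds 1 to the quadratic coefficient. The sign of its real part is therefore
  -- not inherited and is recovered from the finiteness of `smoothNorm f`.
  have hfg : f =ᵐ[volume] gaussianFun (a + 1) b c := by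
    filter_upwards [hab] with η hη
    have h2 : ((Real.exp (-‖η‖ ^ 2) : ℝ) : ℂ) ≠ 0 := Complex.ofReal_ne_zero.2 (Real.exp_pos _).ne'
    apply mul_left_cancel₀ h2
    rw [damp] at hη
    rw [hη, gaussianFun, gaussianFun, Complex.ofReal_exp, ← Complex.exp_add]
    congr 1
    push_cast
    ring
  refine ⟨a + 1, c, b, re_neg_of_smoothNorm hd (b := b) (c := c) ?_, hfg⟩
  refine lt_of_le_of_lt (le_of_eq ?_) hfs
  refine lintegral_congr_ae ?_
  filter_upwards [hfg] with η hη
  rw [hη]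

/-- The product of the two Gaussians depends only on |ζ|² + |η|² and ζ + η, which exchanges
preserve. -/
theorem totalDefect_gaussianFun (s : ℝ) (a c k : ℂ) (b : Fin d → ℂ) :
    totalDefect s (gaussianFun a b c) (fun x => k * gaussianFun a b c x) = 0 := by
  refine lintegral_eq_zero_of_ae_eq_zero (Eventually.of_forall fun e => ?_)
  refine lintegral_eq_zero_of_ae_eq_zero (Eventually.of_forall fun z => ?_)
  have he : (e : Space d) ≠ 0 := by
    rw [← norm_ne_zero_iff, norm_eq_of_mem_sphere e]; exact one_ne_zero
  have h1 := norm_exchange_sq he z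
  have h2 := exchange_fst_add_snd (e : Space d) z
  have key : ∀ w : Space d × Space d, gaussianFun a b c w.1 * (k * gaussianFun a b c w.2) =
      k * Complex.exp (a * ((‖w.1‖ ^ 2 + ‖w.2‖ ^ 2 : ℝ) : ℂ) +
        ∑ i, b i * (((w.1 + w.2) i : ℝ) : ℂ) + 2 * c) := by
    intro w
    rw [mul_left_comm, gaussianFun, gaussianFun, ← Complex.exp_add]
    congr 2
    simp only [PiLp.add_apply, Complex.ofReal_add, mul_add, Finset.sum_add_distrib]
    ring
  simp only [exchangeDefect, key, h1, h2, sub_self, enorm_zero, Pi.zero_apply]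
  simp

end

/-! ### Finite energy of Gaussians, the estimate, and its extremisers -/

section

variable {d : ℕ} [NeZero d]

theorem exists_norm_gaussianFun_sq_le {a : ℂ} (ha : a.re < 0) (b : Fin d → ℂ) (c : ℂ) :
    ∃ D : ℝ, 0 ≤ D ∧ ∀ η, ‖gaussianFun a b c η‖ ^ 2 ≤ D * Real.exp (a.re * ‖η‖ ^ 2) := by
  set β : ℝ := ∑ i, ‖b i‖ with hβ
  refine ⟨Real.exp (β ^ 2 / (-a.re) + 2 * c.re), (Real.exp_pos _).le, fun η => ?_⟩
  rw [gaussianFun, Complex.norm_exp, ← Real.exp_nat_mul, ← Real.exp_add]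
  refine Real.exp_le_exp.2 ?_
  have h1 : (∑ i, b i * ((η i : ℝ) : ℂ)).re ≤ β * ‖η‖ := by
    refine (Complex.re_le_norm _).trans ((norm_sum_le _ _).trans ?_)
    rw [hβ, Finset.sum_mul]
    refine Finset.sum_le_sum fun i _ => ?_
    rw [norm_mul, Complex.norm_real]
    exact mul_le_mul_of_nonneg_left (PiLp.norm_apply_le η i) (norm_nonneg _)
  rw [Complex.add_re, Complex.add_re, Complex.re_mul_ofReal]
  have h2 : 2 * (β * ‖η‖) ≤ -a.re * ‖η‖ ^ 2 + β ^ 2 / (-a.re) := by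
    have h3 : 0 < -a.re := by linarith
    have h4 : 0 ≤ (-a.re * ‖η‖ - β) ^ 2 / (-a.re) := by positivity
    have h5 : (-a.re * ‖η‖ - β) ^ 2 / (-a.re) =
        -a.re * ‖η‖ ^ 2 + β ^ 2 / (-a.re) - 2 * (β * ‖η‖) := by
      generalize -a.re = q at h3
      field_simp
      ring
    linarith
  push_cast
  linarith

/-- Since |ζ - η|² ≤ 2|ζ|² + 2|η|², part of the Gaussian decay can be traded for decay in ζ - η. The
integral then separates, and the singularity of the kernel is integrable because the exponent
exceeds -1 ≥ -d. -/
theorem energy_gaussianFun_lt_top {σ : ℝ} (hσ : (1 - (d : ℝ)) / 4 < σ) {a : ℂ} (ha : a.re < 0)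
    (b : Fin d → ℂ) (c k : ℂ) :
    energy σ (gaussianFun a b c) (fun x => k * gaussianFun a b c x) < ∞ := by
  obtain ⟨D, hD, hle⟩ := exists_norm_gaussianFun_sq_le ha b c
  have hd : (1 : ℝ) ≤ d := by exact_mod_cast NeZero.one_le
  set s : ℝ := 4 * σ + d - 2 with hs
  set q : ℝ := -a.re with hq
  have hq0 : 0 < q := by rw [hq]; linarith
  have h1 := lintegral_norm_rpow_mul_exp_lt_top (d := d) (a := s) (b := q / 4)
    (by rw [hs]; linarith) (by positivity)
  have h2 := lintegral_norm_rpow_mul_exp_lt_top (d := d) (a := 0) (b := q / 2)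
    (by linarith) (by positivity)
  set X : ℝ≥0∞ := ∫⁻ x : Space d, ENNReal.ofReal (‖x‖ ^ s * Real.exp (-(q / 4) * ‖x‖ ^ 2)) with hX
  have hpt : ∀ z : Space d × Space d, ‖gaussianFun a b c z.1‖ₑ ^ 2 *
      ‖k * gaussianFun a b c z.2‖ₑ ^ 2 * ENNReal.ofReal (‖z.1 - z.2‖ ^ s) ≤
      ENNReal.ofReal (D * D * ‖k‖ ^ 2) *
        (ENNReal.ofReal (‖z.1‖ ^ (0 : ℝ) * Real.exp (-(q / 2) * ‖z.1‖ ^ 2)) *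
        ENNReal.ofReal (‖z.1 - z.2‖ ^ s * Real.exp (-(q / 4) * ‖z.1 - z.2‖ ^ 2))) := by
    intro z
    rw [enorm_sq_eq_ofReal, enorm_sq_eq_ofReal, ← ENNReal.ofReal_mul (by positivity),
      ← ENNReal.ofReal_mul (by positivity), ← ENNReal.ofReal_mul (by positivity),
      ← ENNReal.ofReal_mul (by positivity), norm_mul, mul_pow, Real.rpow_zero, one_mul]
    refine ENNReal.ofReal_le_ofReal ?_
    have h3 : Real.exp (a.re * ‖z.1‖ ^ 2) * Real.exp (a.re * ‖z.2‖ ^ 2) ≤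
        Real.exp (-(q / 2) * ‖z.1‖ ^ 2) * Real.exp (-(q / 4) * ‖z.1 - z.2‖ ^ 2) := by
      rw [← Real.exp_add, ← Real.exp_add]
      refine Real.exp_le_exp.2 ?_
      have h4 : ‖z.1 - z.2‖ ^ 2 ≤ 2 * ‖z.1‖ ^ 2 + 2 * ‖z.2‖ ^ 2 := by
        have := norm_sub_le z.1 z.2
        nlinarith [sq_nonneg (‖z.1‖ - ‖z.2‖), norm_nonneg (z.1 - z.2)]
      have h5 : a.re = -q := by rw [hq]; ring
      rw [h5]
      nlinarith [norm_nonneg z.1, norm_nonneg z.2]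
    calc ‖gaussianFun a b c z.1‖ ^ 2 * (‖k‖ ^ 2 * ‖gaussianFun a b c z.2‖ ^ 2) * ‖z.1 - z.2‖ ^ s
        ≤ D * Real.exp (a.re * ‖z.1‖ ^ 2) * (‖k‖ ^ 2 * (D * Real.exp (a.re * ‖z.2‖ ^ 2))) *
          ‖z.1 - z.2‖ ^ s := by
          have e1 := hle z.1
          have e2 := hle z.2
          gcongr
      _ = D * D * ‖k‖ ^ 2 * ‖z.1 - z.2‖ ^ s *
          (Real.exp (a.re * ‖z.1‖ ^ 2) * Real.exp (a.re * ‖z.2‖ ^ 2)) := by ring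
      _ ≤ D * D * ‖k‖ ^ 2 * ‖z.1 - z.2‖ ^ s *
          (Real.exp (-(q / 2) * ‖z.1‖ ^ 2) * Real.exp (-(q / 4) * ‖z.1 - z.2‖ ^ 2)) := by gcongr
      _ = _ := by ring
  refine (lintegral_mono hpt).trans_lt ?_
  rw [lintegral_const_mul' _ _ ENNReal.ofReal_ne_top]
  refine ENNReal.mul_lt_top ENNReal.ofReal_lt_top ?_
  rw [Measure.volume_eq_prod, lintegral_prod _ (by fun_prop)]
  have h6 : ∀ x : Space d, ∫⁻ y : Space d,
      ENNReal.ofReal (‖x‖ ^ (0 : ℝ) * Real.exp (-(q / 2) * ‖x‖ ^ 2)) *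
      ENNReal.ofReal (‖x - y‖ ^ s * Real.exp (-(q / 4) * ‖x - y‖ ^ 2)) =
      ENNReal.ofReal (‖x‖ ^ (0 : ℝ) * Real.exp (-(q / 2) * ‖x‖ ^ 2)) * X := fun x => by
    rw [lintegral_const_mul' _ _ ENNReal.ofReal_ne_top, hX,
      ← lintegral_sub_left_eq_self (fun x : Space d =>
        ENNReal.ofReal (‖x‖ ^ s * Real.exp (-(q / 4) * ‖x‖ ^ 2))) x]
  simp only [h6]
  rw [lintegral_mul_const _ (by fun_prop)]
  exact ENNReal.mul_lt_top h2 h1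

theorem energy_ne_zero {σ : ℝ} {f g : Space d → ℂ} (hf : Measurable f) (hg : Measurable g)
    (hf0 : ∀ x, f x ≠ 0) (hg0 : ∀ x, g x ≠ 0) : energy σ f g ≠ 0 := by
  intro h
  have hm : Measurable fun z : Space d × Space d => ‖f z.1‖ₑ ^ 2 * ‖g z.2‖ₑ ^ 2 *
      ENNReal.ofReal (‖z.1 - z.2‖ ^ (4 * σ + (d : ℝ) - 2)) := by fun_prop
  have hz := Measure.ae_ae_of_ae_prod ((lintegral_eq_zero_iff hm).1 h)
  obtain ⟨x, hx⟩ := hz.exists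
  obtain ⟨y, hy, hne⟩ := (hx.and (Measure.ae_ne volume x)).exists
  have h1 : 0 < ‖x - y‖ := norm_pos_iff.2 (sub_ne_zero.2 hne.symm)
  have h2 : 0 < ‖x - y‖ ^ (4 * σ + (d : ℝ) - 2) := by positivity
  simp [hf0 x, hg0 y, not_le.2 h2] at hy

/-- A measurable function that represents the Fourier transform, in Mathlib's normalisation, of a
distribution whose Fourier transform is the function `f`. -/
structure IsTransform (u₀ : 𝓢'(Space d, ℂ)) (f f₀ : Space d → ℂ) : Prop where
  measurable : Measurable f₀
  isFunction : IsFunction (𝓕 u₀) f₀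
  ae_eq : (fun x => f ((2 * Real.pi) • x)) =ᵐ[volume] f₀

theorem exists_isTransform {u₀ : 𝓢'(Space d, ℂ)} {f : Space d → ℂ}
    (hf : HasFourierTransform u₀ f) : ∃ f₀, IsTransform u₀ f f₀ := by
  have hm : AEStronglyMeasurable (fun x => f ((2 * Real.pi) • x)) volume :=
    (IsFunction.locallyIntegrable hf).aestronglyMeasurable
  exact ⟨hm.mk _, hm.stronglyMeasurable_mk.measurable, IsFunction.congr hf hm.ae_eq_mk, hm.ae_eq_mk⟩

theorem ae_comp_smul_iff {r : ℝ} (hr : r ≠ 0) {P : Space d → Prop} :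
    (∀ᵐ x, P (r • x)) ↔ ∀ᵐ x, P x := by
  have key : ∀ {s : ℝ}, s ≠ 0 → ∀ {Q : Space d → Prop}, (∀ᵐ x, Q x) → ∀ᵐ x, Q (s • x) := by
    intro s hs Q hQ
    have : Measure.QuasiMeasurePreserving (fun x : Space d => s • x) volume volume := by
      refine ⟨measurable_const_smul s, ?_⟩
      rw [Measure.map_addHaar_smul _ hs]
      exact Measure.smul_absolutelyContinuous
    exact this.ae hQ
  refine ⟨fun h => ?_, key hr⟩
  have := key (inv_ne_zero hr) h
  simpa only [smul_inv_smul₀ hr] using this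

section Transforms

variable {u₀ v₀ : 𝓢'(Space d, ℂ)} {f g f₀ g₀ : Space d → ℂ} {σ : ℝ} {u v : SpaceTime d → ℂ}

theorem IsTransform.ae_ne_zero (hf : IsTransform u₀ f f₀) (hu : u₀ ≠ 0) : ¬ f₀ =ᵐ[volume] 0 := by
  intro h
  refine hu (eq_of_fourier_eq ?_)
  rw [hf.isFunction.eq_zero h, FourierTransform.fourier_zero]

theorem IsTransform.energy_eq (hf : IsTransform u₀ f f₀) (hg : IsTransform v₀ g g₀) :
    energy σ f g =
      ENNReal.ofReal ((2 * Real.pi) ^ (3 * (d : ℝ) + 4 * σ - 2)) * energy σ f₀ g₀ := by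
  rw [energy_rescale, energy_congr hf.ae_eq hg.ae_eq]

theorem IsTransform.energy_lt_top (hf : IsTransform u₀ f f₀) (hg : IsTransform v₀ g g₀) :
    energy σ f g < ∞ ↔ energy σ f₀ g₀ < ∞ := by
  have h0 : (0 : ℝ) < (2 * Real.pi) ^ (3 * (d : ℝ) + 4 * σ - 2) := by positivity
  rw [hf.energy_eq hg]
  refine ⟨fun h => ENNReal.lt_top_of_mul_ne_top_right h.ne (by simpa using h0),
    fun h => ENNReal.mul_lt_top ENNReal.ofReal_lt_top h⟩

theorem IsTransform.smoothNorm_lt_top (hσ : (1 - (d : ℝ)) / 4 < σ) (hf : IsTransform u₀ f f₀)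
    (hg : IsTransform v₀ g g₀) (h : energy σ f g < ∞) (hu : u₀ ≠ 0) (hv : v₀ ≠ 0) :
    smoothNorm f₀ < ∞ ∧ smoothNorm g₀ < ∞ := by
  have h0 := (hf.energy_lt_top hg).1 h
  refine ⟨smoothNorm_lt_top_of_energy hσ hf.1 hg.1 h0 (hg.ae_ne_zero hv), ?_⟩
  rw [energy_comm hf.1 hg.1] at h0
  exact smoothNorm_lt_top_of_energy hσ hg.1 hf.1 h0 (hf.ae_ne_zero hu)

theorem IsTransform.fracLaplacianNorm_sq_add_defect (hσ : (1 - (d : ℝ)) / 4 < σ)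
    (hf : IsTransform u₀ f f₀) (hg : IsTransform v₀ g g₀) (h : energy σ f g < ∞) (hu₀ : u₀ ≠ 0)
    (hv₀ : v₀ ≠ 0) (hu : IsSolution u₀ u) (hv : IsSolution v₀ v) :
    2 * fracLaplacianNorm σ (fun p => u p * (starRingEnd ℂ) (v p)) ^ 2 +
      ENNReal.ofReal ((2 * Real.pi) ^ (4 * σ) / (4 * Real.pi)) *
        totalDefect (4 * σ + d - 2) f₀ g₀ =
    2 * (ENNReal.ofReal (OT d σ) * energy σ f g) := by
  obtain ⟨h1, h2⟩ := hf.smoothNorm_lt_top hσ hg h hu₀ hv₀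
  rw [BilinearSchrodinger.fracLaplacianNorm_sq_add_defect hσ hf.1 hg.1 h1 h2
    (hu.isEvolution hf.1 hf.2 h1) (hv.isEvolution hg.1 hg.2 h2) ((hf.energy_lt_top hg).1 h),
    hf.energy_eq hg, ENNReal.ofReal_mul' (by positivity), mul_assoc (ENNReal.ofReal (OT d σ))]

theorem fracLaplacianNorm_sq_le (hσ : (1 - (d : ℝ)) / 4 < σ) (hf : HasFourierTransform u₀ f)
    (hg : HasFourierTransform v₀ g) (h : energy σ f g < ∞) (hu : IsSolution u₀ u)
    (hv : IsSolution v₀ v) :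
    fracLaplacianNorm σ (fun p => u p * (starRingEnd ℂ) (v p)) ^ 2 ≤
      ENNReal.ofReal (OT d σ) * energy σ f g := by
  -- With one datum zero the energy says nothing about the other, but by uniqueness the product of
  -- the solutions vanishes almost everywhere.
  by_cases hu₀ : u₀ = 0
  · subst hu₀
    rw [fracLaplacianNorm_zero]
    · simp
    · filter_upwards [hu.ae_eq isSolution_zero] with p hp
      simp [hp]
  by_cases hv₀ : v₀ = 0
  · subst hv₀
    rw [fracLaplacianNorm_zero]
    · simp
    · filter_upwards [hv.ae_eq isSolution_zero] with p hp
      simp [hp]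
  obtain ⟨f₀, hf₀⟩ := exists_isTransform hf
  obtain ⟨g₀, hg₀⟩ := exists_isTransform hg
  have h1 := hf₀.fracLaplacianNorm_sq_add_defect hσ hg₀ h hu₀ hv₀ hu hv
  have h2 := le_self_add.trans h1.le
  rwa [ENNReal.mul_le_mul_iff_right (by simp) (by simp)] at h2

theorem IsTransform.gaussian (ha : ∃ (a c : ℂ) (b : Fin d → ℂ), a.re < 0 ∧
    f₀ =ᵐ[volume] gaussianFun a b c) (hf : IsTransform u₀ f f₀) : IsGaussian f := by
  obtain ⟨a, c, b, ha, hab⟩ := ha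
  have hπ : (2 * Real.pi) ≠ 0 := by positivity
  refine ⟨a * (((2 * Real.pi)⁻¹ ^ 2 : ℝ) : ℂ), c, fun i => ((2 * Real.pi)⁻¹ : ℝ) * b i, ?_, ?_⟩
  · rw [Complex.re_mul_ofReal]
    exact mul_neg_of_neg_of_pos ha (by positivity)
  · have h1 : ∀ᵐ x : Space d, f ((2 * Real.pi) • x) = gaussianFun a b c x :=
      hf.ae_eq.trans hab
    have h2 := (ae_comp_smul_iff (inv_ne_zero hπ)).2 h1
    filter_upwards [h2] with x hx
    rw [smul_inv_smul₀ hπ, gaussianFun_smul] at hx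
    exact hx

theorem exists_isTransform_gaussianFun (hf : HasFourierTransform u₀ f) (h : IsGaussian f) :
    ∃ (a c : ℂ) (b : Fin d → ℂ), a.re < 0 ∧ IsTransform u₀ f (gaussianFun a b c) := by
  obtain ⟨a, c, b, ha, hab⟩ := h
  have hπ : (2 * Real.pi) ≠ 0 := by positivity
  have h1 : ∀ᵐ x : Space d, f ((2 * Real.pi) • x) = gaussianFun a b c ((2 * Real.pi) • x) :=
    (ae_comp_smul_iff hπ).2 hab
  have h2 : (fun x => f ((2 * Real.pi) • x)) =ᵐ[volume]
      gaussianFun (a * ((2 * Real.pi) ^ 2 : ℝ)) (fun i => (2 * Real.pi : ℝ) * b i) c := by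
    filter_upwards [h1] with x hx
    rw [hx, gaussianFun_smul]
  refine ⟨_, c, _, ?_, (continuous_gaussianFun _ _ c).measurable, IsFunction.congr hf h2, h2⟩
  rw [Complex.re_mul_ofReal]
  exact mul_neg_of_neg_of_pos ha (by positivity)

theorem IsTransform.const_smul (hf : IsTransform u₀ f f₀) (k : ℂ)
    (hg : HasFourierTransform (k • u₀) g) : IsTransform (k • u₀) g (fun x => k * f₀ x) := by
  have h1 : IsFunction (𝓕 (k • u₀)) (fun x => k * f₀ x) := by
    intro φ
    have e : (fun x => φ x * (k * f₀ x)) = fun x => k * (φ x * f₀ x) := by funext x; ring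
    have e2 : 𝓕 (k • u₀) = k • 𝓕 u₀ := FourierTransform.fourier_smul k u₀
    rw [e, e2, integral_const_mul]
    refine ⟨(hf.isFunction φ).1.const_mul k, ?_⟩
    rw [← (hf.isFunction φ).2]
    rfl
  exact ⟨hf.measurable.const_mul k, h1, IsFunction.ae_eq hg h1⟩

theorem fracLaplacianNorm_sq_eq_of_gaussian (hσ : (1 - (d : ℝ)) / 4 < σ)
    (hf : HasFourierTransform u₀ f) (hg : HasFourierTransform v₀ g) (hu : IsSolution u₀ u)
    (hv : IsSolution v₀ v) (hu₀ : u₀ ≠ 0) (hv₀ : v₀ ≠ 0) (hG : IsGaussian f)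
    (hk : ∃ k : ℂ, v₀ = k • u₀) :
    energy σ f g < ∞ ∧ fracLaplacianNorm σ (fun p => u p * (starRingEnd ℂ) (v p)) ^ 2 =
      ENNReal.ofReal (OT d σ) * energy σ f g := by
  obtain ⟨k, rfl⟩ := hk
  obtain ⟨a, c, b, ha, hT⟩ := exists_isTransform_gaussianFun hf hG
  have hT' := hT.const_smul k hg
  have hfin := (hT.energy_lt_top hT').2 (energy_gaussianFun_lt_top hσ ha b c k)
  refine ⟨hfin, ?_⟩
  have h1 := hT.fracLaplacianNorm_sq_add_defect hσ hT' hfin hu₀ hv₀ hu hv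
  rw [totalDefect_gaussianFun, mul_zero, add_zero] at h1
  exact (ENNReal.mul_right_inj (by simp) (by simp)).1 h1

theorem gaussian_of_fracLaplacianNorm_sq_eq (hd : 2 ≤ d) (hσ : (1 - (d : ℝ)) / 4 < σ)
    (hf : HasFourierTransform u₀ f) (hg : HasFourierTransform v₀ g) (hu : IsSolution u₀ u)
    (hv : IsSolution v₀ v) (hu₀ : u₀ ≠ 0) (hv₀ : v₀ ≠ 0) (h : energy σ f g < ∞)
    (heq : fracLaplacianNorm σ (fun p => u p * (starRingEnd ℂ) (v p)) ^ 2 =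
      ENNReal.ofReal (OT d σ) * energy σ f g) :
    IsGaussian f ∧ ∃ k : ℂ, v₀ = k • u₀ := by
  obtain ⟨f₀, hf₀⟩ := exists_isTransform hf
  obtain ⟨g₀, hg₀⟩ := exists_isTransform hg
  obtain ⟨h1, h2⟩ := hf₀.smoothNorm_lt_top hσ hg₀ h hu₀ hv₀
  have h3 := hf₀.fracLaplacianNorm_sq_add_defect hσ hg₀ h hu₀ hv₀ hu hv
  have hfin : 2 * (ENNReal.ofReal (OT d σ) * energy σ f g) ≠ ∞ :=
    ENNReal.mul_ne_top (by simp) (ENNReal.mul_ne_top ENNReal.ofReal_ne_top h.ne)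
  rw [heq] at h3
  -- Equality makes the norm term equal to the finite right side; cancelling leaves a vanishing
  -- defect.
  have h4 := ENNReal.add_right_inj hfin |>.1 (h3.trans (add_zero _).symm)
  have hc : ENNReal.ofReal ((2 * Real.pi) ^ (4 * σ) / (4 * Real.pi)) ≠ 0 := by
    have := Real.pi_pos
    simp only [ne_eq, ENNReal.ofReal_eq_zero, not_le]
    positivity
  have hD := (mul_eq_zero.1 h4).resolve_left hc
  obtain ⟨hG, k, hk⟩ := gaussian_of_totalDefect_eq_zero hd hf₀.1 hg₀.1 h1 h2
    (hf₀.ae_ne_zero hu₀) (hg₀.ae_ne_zero hv₀) hD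
  refine ⟨hf₀.gaussian hG, k, eq_of_fourier_eq ?_⟩
  have hkf : HasFourierTransform (k • u₀) (fun x => k * f x) := by
    intro φ
    have e : (fun x => φ x * (k * f ((2 * Real.pi) • x))) =
      fun x => k * (φ x * f ((2 * Real.pi) • x)) := by funext x; ring
    have e2 : 𝓕 (k • u₀) = k • 𝓕 u₀ := FourierTransform.fourier_smul k u₀
    rw [e, e2, integral_const_mul]
    refine ⟨(hf φ).1.const_mul k, ?_⟩
    rw [← (hf φ).2]
    rfl
  exact (hg₀.isFunction.congr hk).distribution_eq (hf₀.const_smul k hkf).isFunction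

end Transforms

theorem exists_gaussian_solution {σ : ℝ} (hσ : (1 - (d : ℝ)) / 4 < σ) :
    ∃ (u₀ : 𝓢'(Space d, ℂ)) (f : Space d → ℂ) (u : SpaceTime d → ℂ), u₀ ≠ 0 ∧
      HasFourierTransform u₀ f ∧ IsGaussian f ∧ IsSolution u₀ u ∧ energy σ f f ≠ 0 := by
  set G : Space d → ℂ := gaussianFun (-1) 0 0 with hG
  have ha : (-1 : ℂ).re < 0 := by simp
  have hGm : Measurable G := (continuous_gaussianFun _ _ _).measurable
  have hGi : Integrable G := integrable_gaussianFun ha _ _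
  obtain ⟨T, hT⟩ := exists_isFunction_of_integrable_inv_pow 0 (F := G) (by simpa using hGi)
  set f : Space d → ℂ := fun x => G ((2 * Real.pi)⁻¹ • x) with hf
  have hπ : (2 * Real.pi) ≠ 0 := by positivity
  have hfG : (fun x => f ((2 * Real.pi) • x)) = G := by
    funext x; simp only [hf, inv_smul_smul₀ hπ]
  have h1 : HasFourierTransform (𝓕⁻ T) f := by
    rw [HasFourierTransform, hfG, FourierTransform.fourier_fourierInv_eq]
    exact hT
  have hTr : IsTransform (𝓕⁻ T) f G :=
    ⟨hGm, by rw [FourierTransform.fourier_fourierInv_eq]; exact hT, by rw [hfG]⟩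
  have hne : 𝓕⁻ T ≠ 0 := by
    intro h0
    have h2 : IsFunction (𝓕 (𝓕⁻ T)) (0 : Space d → ℂ) := by
      rw [h0, FourierTransform.fourier_zero]; exact isFunction_zero
    obtain ⟨x, hx⟩ := (hTr.isFunction.ae_eq h2).exists
    exact gaussianFun_ne_zero _ _ _ x hx
  have hen : energy σ G G < ∞ := by
    have := energy_gaussianFun_lt_top hσ ha (0 : Fin d → ℂ) 0 1
    simpa only [one_mul] using this
  have hs := (hTr.smoothNorm_lt_top hσ hTr ((hTr.energy_lt_top hTr).2 hen) hne hne).1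
  obtain ⟨U, hU, -⟩ := exists_solution hGm hTr.isFunction hs
  refine ⟨𝓕⁻ T, f, U, hne, h1, hTr.gaussian ⟨-1, 0, 0, ha, Filter.EventuallyEq.rfl⟩, hU, ?_⟩
  refine energy_ne_zero ?_ ?_ ?_ ?_
  · exact hGm.comp (measurable_const_smul _)
  · exact hGm.comp (measurable_const_smul _)
  · exact fun x => gaussianFun_ne_zero _ _ _ _
  · exact fun x => gaussianFun_ne_zero _ _ _ _

end

end BilinearSchrodinger

end

theorem theorem1p1 (d : ℕ) (hd : 2 ≤ d) (σ : ℝ) (hσ : (1 - (d : ℝ)) / 4 < σ) :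
    -- nonzero initial data in the class have solutions that are functions on space-time
    (∀ (u₀ v₀ : 𝓢'(Space d, ℂ)) (f g : Space d → ℂ),
      HasFourierTransform u₀ f → HasFourierTransform v₀ g → energy σ f g < ∞ → u₀ ≠ 0 → v₀ ≠ 0 →
      (∃ u, IsSolution u₀ u) ∧ (∃ v, IsSolution v₀ v)) ∧
    -- the estimate
    (∀ (u₀ v₀ : 𝓢'(Space d, ℂ)) (f g : Space d → ℂ)
      (u v : SpaceTime d → ℂ),
      HasFourierTransform u₀ f → HasFourierTransform v₀ g →
      energy σ f g < ∞ →
      IsSolution u₀ u → IsSolution v₀ v →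
      fracLaplacianNorm σ (fun p => u p * (starRingEnd ℂ) (v p)) ^ 2 ≤
        ENNReal.ofReal (OT d σ) * energy σ f g) ∧
    -- optimality of the constant
    (∀ C : ℝ≥0∞,
      (∀ (u₀ v₀ : 𝓢'(Space d, ℂ)) (f g : Space d → ℂ)
        (u v : SpaceTime d → ℂ),
        HasFourierTransform u₀ f → HasFourierTransform v₀ g →
        energy σ f g < ∞ →
        IsSolution u₀ u → IsSolution v₀ v →
        fracLaplacianNorm σ (fun p => u p * (starRingEnd ℂ) (v p)) ^ 2 ≤
          C * energy σ f g) →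
      ENNReal.ofReal (OT d σ) ≤ C) ∧
    -- characterisation of the extremisers
    (∀ (u₀ v₀ : 𝓢'(Space d, ℂ)) (f g : Space d → ℂ)
      (u v : SpaceTime d → ℂ),
      HasFourierTransform u₀ f → HasFourierTransform v₀ g →
      IsSolution u₀ u → IsSolution v₀ v →
      u₀ ≠ 0 → v₀ ≠ 0 →
      ((energy σ f g < ∞ ∧
          fracLaplacianNorm σ (fun p => u p * (starRingEnd ℂ) (v p)) ^ 2 =
            ENNReal.ofReal (OT d σ) * energy σ f g) ↔
        (IsGaussian f ∧ ∃ c : ℂ, v₀ = c • u₀))) := by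
  have : NeZero d := ⟨by omega⟩
  refine ⟨fun u₀ v₀ f g hf hg h hu₀ hv₀ => ?_,
    fun u₀ v₀ f g u v hf hg h hu hv => fracLaplacianNorm_sq_le hσ hf hg h hu hv, fun C hC => ?_,
    fun u₀ v₀ f g u v hf hg hu hv hu₀ hv₀ => ⟨fun h =>
      gaussian_of_fracLaplacianNorm_sq_eq hd hσ hf hg hu hv hu₀ hv₀ h.1 h.2, fun h =>
      fracLaplacianNorm_sq_eq_of_gaussian hσ hf hg hu hv hu₀ hv₀ h.1 h.2⟩⟩
  · obtain ⟨f₀, hf₀⟩ := exists_isTransform hf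
    obtain ⟨g₀, hg₀⟩ := exists_isTransform hg
    obtain ⟨h1, h2⟩ := hf₀.smoothNorm_lt_top hσ hg₀ h hu₀ hv₀
    obtain ⟨u, hu, -⟩ := exists_solution hf₀.measurable hf₀.isFunction h1
    obtain ⟨v, hv, -⟩ := exists_solution hg₀.measurable hg₀.isFunction h2
    exact ⟨⟨u, hu⟩, v, hv⟩
  -- A Gaussian datum paired with itself attains equality; its energy is nonzero and finite, so it
  -- can be divided out.
  · obtain ⟨u₀, f, u, hu₀, hf, hG, hu, hE⟩ := exists_gaussian_solution (d := d) hσ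
    obtain ⟨hfin, heq⟩ := fracLaplacianNorm_sq_eq_of_gaussian hσ hf hf hu hu hu₀ hu₀ hG
      ⟨1, (one_smul ℂ u₀).symm⟩
    have h1 := hC u₀ u₀ f f u u hf hf hfin hu hu
    rwa [heq, ENNReal.mul_le_mul_iff_left hE hfin.ne] at h1
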